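/- Let $\mathbf{k}$ be a commutative ring with unit. For a pointed topological space $(X,x)$ let $\mathrm{Sing}^0(X,x)$ be the simplicial set of singular simplices $\sigma\colon\Delta^n\to X$ that send all vertices of $\Delta^n$ to $x$, and let $C^0_*(X)$ be its complex of normalized chains over $\mathbf{k}$ (the quotient of the free module on the simplices by the span of the degenerate ones, with $\partial\sigma=\sum_i(-1)^i d_i\sigma$). It is a dg coalgebra, with $C^0_0(X)=\mathbf{k}$, under the Alexander–Whitney coproduct $\Delta\sigma=\sum_{p+q=n}\sigma|_{[0,\dots,p]}\otimes\sigma|_{[p,\dots,n]}$, and a pointed map $f$ induces a map $C^0_*(f)$ of dg coalgebras. For a dg coalgebra $C$ in nonnegative degrees with $C_0=\mathbf{k}$, let $\tilde C=C_{>0}$ and let $\mathbf{\Omega}C=(T(s^{-1}\tilde C),D)$ be its cobar construction: the tensor algebra on $s^{-1}\tilde C$, where $s^{-1}$ lowers degrees by $1$, with the derivation $D$ of degree $-1$ given on generators $[c]=s^{-1}c$ by $$D[c]=-[\partial c]+\sum(-1)^{|c'|}[c'|c''],\qquad \Delta c=\sum c'\otimes c'',$$ with $[c]=0$ for $c\in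 C_0$. A map of such dg coalgebras is an *$\mathbf{\Omega}$-quasi-isomorphism* if it induces a quasi-isomorphism between the cobar constructions. Write the product of $\pi_1(X)=\pi_1(X,x)$ as concatenation of loops, the first factor being traversed first. Let $q\colon\mathbf{\Omega}C^0_*(X)\to\mathbf{k}[\pi_1(X)]$ be the map of dg algebras (the target with zero differential) with $q[\sigma]=[\sigma]-e$ for singular $1$-simplices $\sigma$, where on the right $[\sigma]\in\pi_1(X)$ is the class of the loop $\sigma$ and $e$ is the neutral element, and $q[\sigma]=0$ for simplices of dimension greater than $1$. Via $q$ every left $\mathbf{k}[\pi_1(X)]$-module $M$, placed in degree $0$, is a left dg $\mathbf{\Omega}C^0_*(X)$-module; let $m$ be its action map. Let $\tau\colon C^0_*(X)\to\mathbf{\Omega}C^0_*(X)$ be the universal twisting cochain, with $\tau(c)=-[c]$ for $c\in\tilde C$ and $\tau=0$ on $C^0_0(X)$. The chains of $X$ with local coefficients in $M$ are the twisted tensor product $$C_*(X;M)=C^0_*(X)\otimes_\tau M=\bigl(C^0_*(X)\otimes_{\mathbf{k}}M,\ \partial_\tau\bigr),\qquad \partial_\tau=\partial\otimes\mathrm{id}_M+(\mathrm{id}\otimes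 m)\circ(\mathrm{id}\otimes\tau\otimes\mathrm{id}_M)\circ(\Delta\otimes\mathrm{id}_M),$$ with the Koszul sign rule, that is, $\partial_\tau(c\otimes u)=\partial c\otimes u+\sum(-1)^{|c'|}c'\otimes\tau(c'')u$. **Statement.** Let $f\colon(X,x)\to(Y,y)$ be a continuous map of path connected pointed spaces such that $C^0_*(f)\colon C^0_*(X)\to C^0_*(Y)$ is an $\mathbf{\Omega}$-quasi-isomorphism. Let $M$ be a left $\mathbf{k}[\pi_1(Y)]$-module, regarded also as a left $\mathbf{k}[\pi_1(X)]$-module along $\pi_1(f)\colon\pi_1(X)\to\pi_1(Y)$. Then the induced chain map $$C_*(f)=C^0_*(f)\otimes\mathrm{id}_M\colon\ C_*(X;M)\longrightarrow C_*(Y;M)$$ is a quasi-isomorphism. -/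

import Mathlib

open CategoryTheory TensorProduct
open Finset.HasAntidiagonal (antidiagonal)

universe u v w w'

noncomputable section

namespace SSet

open Simplicial Opposite

variable (S : SSet.{u})

/-- The face of `σ` spanned by the vertices `a, …, a + l`. -/
def seg {n : ℕ} (a l : ℕ) (h : a + l ≤ n) (σ : S _⦋n⦌) : S _⦋l⦌ :=
  S.map (SimplexCategory.subinterval a l h).op σ

variable {S}

lemma subinterval_val {n : ℕ} (a l : ℕ) (h : a + l ≤ n) (i : Fin (l + 1)) :
    ((SimplexCategory.subinterval (n := n) a l h).toOrderHom i : ℕ) = i + a := rfl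

lemma δ_val {n : ℕ} (i : Fin (n + 2)) (j : Fin (n + 1)) :
    ((SimplexCategory.δ i).toOrderHom j : ℕ) = if (j : ℕ) < i then (j : ℕ) else j + 1 := by
  change ((Fin.succAbove i j : Fin (n + 2)) : ℕ) = _
  rw [Fin.succAbove]
  simp only [Fin.lt_def, Fin.val_castSucc]
  split_ifs <;> simp

lemma σ_val {n : ℕ} (i : Fin (n + 1)) (j : Fin (n + 2)) :
    ((SimplexCategory.σ i).toOrderHom j : ℕ) = if (i : ℕ) < j then (j : ℕ) - 1 else j := by
  change ((Fin.predAbove i j : Fin (n + 1)) : ℕ) = _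
  rw [Fin.predAbove]
  simp only [Fin.lt_def, Fin.val_castSucc]
  split_ifs <;> simp

lemma map_map_eq {a b b' c : SimplexCategory} (f : a ⟶ b) (g : b ⟶ c) (f' : a ⟶ b') (g' : b' ⟶ c)
    (h : ∀ i, (g.toOrderHom (f.toOrderHom i) : ℕ) = g'.toOrderHom (f'.toOrderHom i))
    (σ : S.obj (op c)) : S.map f.op (S.map g.op σ) = S.map f'.op (S.map g'.op σ) := by
  have e : f ≫ g = f' ≫ g' := by
    ext i : 3
    exact Fin.ext (h i)
  rw [← ConcreteCategory.comp_apply, ← ConcreteCategory.comp_apply, ← S.map_comp, ← S.map_comp,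
    ← op_comp, ← op_comp, e]

lemma map_map_eq' {a b c : SimplexCategory} (f : a ⟶ b) (g : b ⟶ c) (f' : a ⟶ c)
    (h : ∀ i, (g.toOrderHom (f.toOrderHom i) : ℕ) = f'.toOrderHom i)
    (σ : S.obj (op c)) : S.map f.op (S.map g.op σ) = S.map f'.op σ := by
  have e : f ≫ g = f' := by
    ext i : 3
    exact Fin.ext (h i)
  rw [← ConcreteCategory.comp_apply, ← S.map_comp, ← op_comp, e]

lemma seg_seg {n : ℕ} (a l b m : ℕ) (h : a + l ≤ m) (h' : b + m ≤ n) (σ : S _⦋n⦌) :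
    S.seg a l h (S.seg b m h' σ) = S.seg (b + a) l (by omega) σ := by
  refine map_map_eq' _ _ _ (fun i => ?_) σ
  simp only [subinterval_val]
  omega

lemma seg_δ_of_gt {n : ℕ} (a l : ℕ) (h : a + l ≤ n) (i : Fin (n + 2)) (hi : a + l < i)
    (σ : S _⦋n + 1⦌) : S.seg a l h (S.δ i σ) = S.seg a l (by omega) σ := by
  refine map_map_eq' _ _ _ (fun j => ?_) σ
  simp only [subinterval_val, δ_val]
  grind

lemma seg_δ_of_le {n : ℕ} (a l : ℕ) (h : a + l ≤ n) (i : Fin (n + 2)) (hi : i ≤ a)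
    (σ : S _⦋n + 1⦌) : S.seg a l h (S.δ i σ) = S.seg (a + 1) l (by omega) σ := by
  refine map_map_eq' _ _ _ (fun j => ?_) σ
  simp only [subinterval_val, δ_val]
  grind

lemma seg_δ_of_mem {n : ℕ} (a l : ℕ) (h : a + l ≤ n) (i : Fin (n + 2)) (j : Fin (l + 2))
    (hij : (i : ℕ) = a + j)
    (σ : S _⦋n + 1⦌) : S.seg a l h (S.δ i σ) = S.δ j (S.seg a (l + 1) (by omega) σ) := by
  refine map_map_eq _ _ _ _ (fun x => ?_) σ
  simp only [subinterval_val, δ_val]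
  grind

lemma map_mem_degenerate {n m : ℕ} (f : ⦋n⦌ ⟶ ⦋m⦌) (i j : Fin (n + 1)) (hij : i ≠ j)
    (h : f.toOrderHom i = f.toOrderHom j) (y : S _⦋m⦌) : S.map f.op y ∈ S.degenerate n := by
  obtain _ | n := n
  · exact absurd (Subsingleton.elim (α := Fin 1) i j) hij
  · obtain ⟨a, θ, rfl⟩ := SimplexCategory.eq_σ_comp_of_not_injective f (fun hf => hij (hf h))
    rw [op_comp, S.map_comp]
    exact S.σ_mem_degenerate a (S.map θ.op y)

lemma seg_mem_degenerate {n p q : ℕ} (h : p + q = n) {σ : S _⦋n⦌} (hσ : σ ∈ S.degenerate n) :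
    S.seg 0 p (by omega) σ ∈ S.degenerate p ∨ S.seg p q (by omega) σ ∈ S.degenerate q := by
  obtain _ | n := n
  · simp at hσ
  rw [degenerate_eq_iUnion_range_σ] at hσ
  simp only [Set.mem_iUnion, Set.mem_range] at hσ
  obtain ⟨i, y, rfl⟩ := hσ
  by_cases hi : (i : ℕ) < p
  · left
    have e := map_map_eq' (S := S) (SimplexCategory.subinterval 0 p (by omega))
      (SimplexCategory.σ i) (SimplexCategory.subinterval 0 p (by omega) ≫ SimplexCategory.σ i)
      (fun i => rfl) y
    rw [seg, SimplicialObject.σ, e]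
    refine map_mem_degenerate _ ⟨i, by omega⟩ ⟨i + 1, by omega⟩ (by simp) ?_ y
    apply Fin.ext
    simp [σ_val, subinterval_val]
  · right
    have e := map_map_eq' (S := S) (SimplexCategory.subinterval p q (by omega))
      (SimplexCategory.σ i) (SimplexCategory.subinterval p q (by omega) ≫ SimplexCategory.σ i)
      (fun i => rfl) y
    rw [seg, SimplicialObject.σ, e]
    refine map_mem_degenerate _ ⟨i - p, by omega⟩ ⟨i - p + 1, by omega⟩ (by simp) ?_ y
    apply Fin.ext
    simp [σ_val, subinterval_val]
    grind

end SSet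

section NormalizedChains

open Simplicial Opposite

variable (k : Type v) [CommRing k] (S : SSet.{u})

/-- Normalized `n`-chains: the free module on the `n`-simplices modulo the span of the
degenerate ones. -/
def NChain (n : ℕ) : Type (max u v) :=
  (S _⦋n⦌ →₀ k) ⧸ Submodule.span k ((fun σ => Finsupp.single σ (1 : k)) '' S.degenerate n)

namespace NChain

instance (n : ℕ) : AddCommGroup (NChain k S n) :=
  inferInstanceAs (AddCommGroup ((S _⦋n⦌ →₀ k) ⧸ Submodule.span k _))

instance (n : ℕ) : Module k (NChain k S n) :=
  inferInstanceAs (Module k ((S _⦋n⦌ →₀ k) ⧸ Submodule.span k _))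

variable {S}

/-- The class of a simplex. -/
def cls {n : ℕ} (σ : S _⦋n⦌) : NChain k S n := Submodule.Quotient.mk (Finsupp.single σ 1)

lemma cls_eq_zero {n : ℕ} {σ : S _⦋n⦌} (hσ : σ ∈ S.degenerate n) : cls k σ = 0 :=
  (Submodule.Quotient.mk_eq_zero _).2 (Submodule.subset_span ⟨σ, hσ, rfl⟩)

variable {k}

/-- The linear map on normalized chains with given values on simplices. -/
def lift {A : Type*} [AddCommGroup A] [Module k A] {n : ℕ} (F : S _⦋n⦌ → A)
    (hF : ∀ σ ∈ S.degenerate n, F σ = 0) : NChain k S n →ₗ[k] A :=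
  Submodule.liftQ _ (Finsupp.linearCombination k F) (by
    rw [Submodule.span_le]
    rintro _ ⟨σ, hσ, rfl⟩
    simp [hF σ hσ])

@[simp]
lemma lift_cls {A : Type*} [AddCommGroup A] [Module k A] {n : ℕ} (F : S _⦋n⦌ → A)
    (hF : ∀ σ ∈ S.degenerate n, F σ = 0) (σ : S _⦋n⦌) : lift F hF (cls k σ) = F σ :=
  (Submodule.liftQ_apply _ _ _).trans (by simp)

lemma hom_ext {A : Type*} [AddCommGroup A] [Module k A] {n : ℕ} {F G : NChain k S n →ₗ[k] A}
    (h : ∀ σ : S _⦋n⦌, F (cls k σ) = G (cls k σ)) : F = G := by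
  refine Submodule.linearMap_qext _ (Finsupp.lhom_ext' fun σ => LinearMap.ext_ring ?_)
  exact h σ

variable (k S)

lemma boundary_degenerate (n : ℕ) (σ : S _⦋n + 1⦌) (hσ : σ ∈ S.degenerate (n + 1)) :
    ∑ i : Fin (n + 2), (-1 : k) ^ (i : ℕ) • cls k (S.δ i σ) = 0 := by
  rw [SSet.degenerate_eq_iUnion_range_σ] at hσ
  simp only [Set.mem_iUnion, Set.mem_range] at hσ
  obtain ⟨j, y, rfl⟩ := hσ
  rw [← Finset.sum_subset (Finset.subset_univ {j.castSucc, j.succ})]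
  · rw [Finset.sum_pair (by simp [Fin.ext_iff])]
    have e : S.δ j.castSucc (S.σ j y) = S.δ j.succ (S.σ j y) := by
      refine SSet.map_map_eq _ _ _ _ (fun x => ?_) y
      simp only [SSet.δ_val, SSet.σ_val, Fin.val_castSucc, Fin.val_succ]
      grind
    rw [e, Fin.val_castSucc, Fin.val_succ, pow_succ]
    simp
  · intro i _ hi
    simp only [Finset.mem_insert, Finset.mem_singleton, not_or, Fin.ext_iff, Fin.val_castSucc,
      Fin.val_succ] at hi
    have e : S.δ i (S.σ j y) = S.map (SimplexCategory.δ i ≫ SimplexCategory.σ j).op y :=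
      SSet.map_map_eq' _ _ _ (fun x => rfl) y
    rw [e, cls_eq_zero, smul_zero]
    have hi2 := i.2
    have hj2 := j.2
    by_cases hij : (i : ℕ) < j
    · refine SSet.map_mem_degenerate _ ⟨j - 1, by omega⟩ ⟨j, by omega⟩
        (by simp [Fin.ext_iff]; omega) ?_ y
      apply Fin.ext
      simp only [SimplexCategory.comp_toOrderHom, OrderHom.comp_coe, Function.comp, SSet.σ_val,
        SSet.δ_val]
      grind
    · refine SSet.map_mem_degenerate _ ⟨j, by omega⟩ ⟨j + 1, by omega⟩
        (by simp [Fin.ext_iff]) ?_ y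
      apply Fin.ext
      simp only [SimplexCategory.comp_toOrderHom, OrderHom.comp_coe, Function.comp, SSet.σ_val,
        SSet.δ_val]
      grind

/-- The boundary `∂ σ = ∑ (-1) ^ i d_i σ`. -/
def boundary (n : ℕ) : NChain k S (n + 1) →ₗ[k] NChain k S n :=
  lift (fun σ => ∑ i : Fin (n + 2), (-1 : k) ^ (i : ℕ) • cls k (S.δ i σ))
    (boundary_degenerate k S n)

variable {k S}

lemma boundary_cls (n : ℕ) (σ : S _⦋n + 1⦌) :
    boundary k S n (cls k σ) = ∑ i : Fin (n + 2), (-1 : k) ^ (i : ℕ) • cls k (S.δ i σ) := by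
  simp [boundary]

variable (k S)

/-- The component `σ ↦ S(f_p)(σ) ⊗ S(l_q)(σ)` of the Alexander-Whitney coproduct; it is zero
unless `p + q = n`. -/
def aw (n p q : ℕ) : NChain k S n →ₗ[k] NChain k S p ⊗[k] NChain k S q :=
  if h : p + q = n then
    lift (fun σ => cls k (S.seg 0 p (by omega) σ) ⊗ₜ cls k (S.seg p q (by omega) σ))
      (fun σ hσ => by
        obtain h | h := SSet.seg_mem_degenerate h hσ
        · rw [cls_eq_zero k h, zero_tmul]
        · rw [cls_eq_zero k h, tmul_zero])
  else 0

variable {k S}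

lemma aw_cls (n p q : ℕ) (h : p + q = n) (σ : S _⦋n⦌) : aw k S n p q (cls k σ) =
    cls k (S.seg 0 p (by omega) σ) ⊗ₜ cls k (S.seg p q (by omega) σ) := by
  simp [aw, h]

lemma boundary_boundary (n : ℕ) (c : NChain k S (n + 2)) :
    boundary k S n (boundary k S (n + 1) c) = 0 := by
  suffices boundary k S n ∘ₗ boundary k S (n + 1) = 0 from LinearMap.congr_fun this c
  refine hom_ext fun σ => ?_
  simp only [LinearMap.comp_apply, boundary_cls, map_sum, map_smul, Finset.smul_sum,
    LinearMap.zero_apply, smul_smul, ← pow_add]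
  rw [← Finset.sum_product', Finset.univ_product_univ]
  let P := Fin (n + 3) × Fin (n + 2)
  refine Finset.sum_involution (fun ij _ =>
    if h : (ij.1 : ℕ) ≤ ij.2 then (⟨ij.2 + 1, by omega⟩, ⟨ij.1, by omega⟩)
    else (⟨ij.2, by omega⟩, ⟨ij.1 - 1, by omega⟩)) ?_ ?_ ?_ ?_
  · rintro ⟨i, j⟩ -
    dsimp only
    have e : ∀ (i' : Fin (n + 3)) (j' : Fin (n + 2)),
        ((i : ℕ) ≤ j → (i' : ℕ) = j + 1 ∧ (j' : ℕ) = i) →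
        (¬ (i : ℕ) ≤ j → (i' : ℕ) = j ∧ (j' : ℕ) = i - 1) →
        S.δ j (S.δ i σ) = S.δ j' (S.δ i' σ) ∧
        (-1 : k) ^ (i + j : ℕ) = - (-1 : k) ^ (i' + j' : ℕ) := by
      intro i' j' h1 h2
      constructor
      · refine SSet.map_map_eq _ _ _ _ (fun x => ?_) σ
        simp only [SSet.δ_val]
        grind
      · by_cases h : (i : ℕ) ≤ j
        · obtain ⟨a, b⟩ := h1 h
          rw [a, b, show (j + 1 + i : ℕ) = i + j + 1 by ring, pow_succ]
          simp
        · obtain ⟨a, b⟩ := h2 h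
          rw [a, b, show (i + j : ℕ) = j + (i - 1) + 1 by omega, pow_succ]
          simp
    split_ifs with h
    · obtain ⟨a, b⟩ := e ⟨j + 1, by omega⟩ ⟨i, by omega⟩ (fun _ => ⟨rfl, rfl⟩) (fun h' => (h' h).elim)
      rw [a, b, neg_smul, neg_add_cancel]
    · obtain ⟨a, b⟩ := e ⟨j, by omega⟩ ⟨i - 1, by omega⟩ (fun h' => (h h').elim) (fun _ => ⟨rfl, rfl⟩)
      rw [a, b, neg_smul, neg_add_cancel]
  · rintro ⟨i, j⟩ - -
    dsimp only
    split_ifs <;> simp only [ne_eq, Prod.mk.injEq, Fin.ext_iff] <;> omega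
  · simp
  · rintro ⟨i, j⟩ -
    dsimp only
    split_ifs <;> simp only [Prod.mk.injEq, Fin.ext_iff] at * <;> grind

lemma aw_boundary (n p q : ℕ) (c : NChain k S (n + 1)) : aw k S n p q (boundary k S n c) =
    (boundary k S p).rTensor (NChain k S q) (aw k S (n + 1) (p + 1) q c) +
      (-1 : k) ^ p • (boundary k S q).lTensor (NChain k S p) (aw k S (n + 1) p (q + 1) c) := by
  by_cases h : p + q = n
  swap
  · simp [aw, h, show ¬ (p + 1 + q = n + 1) by omega, show ¬ (p + (q + 1) = n + 1) by omega]
  subst h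
  suffices aw k S (p + q) p q ∘ₗ boundary k S (p + q) =
    (boundary k S p).rTensor (NChain k S q) ∘ₗ (aw k S (p + q + 1) (p + 1) q) +
      (-1 : k) ^ p • ((boundary k S q).lTensor (NChain k S p) ∘ₗ aw k S (p + q + 1) p (q + 1)) from
    LinearMap.congr_fun this c
  refine hom_ext fun σ => ?_
  simp only [LinearMap.comp_apply, LinearMap.add_apply, LinearMap.smul_apply, boundary_cls,
    map_sum, map_smul, aw_cls (p + q) p q rfl, aw_cls (p + q + 1) (p + 1) q (by omega),
    aw_cls (p + q + 1) p (q + 1) (by omega), LinearMap.rTensor_tmul, LinearMap.lTensor_tmul,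
    sum_tmul, tmul_sum, Finset.smul_sum, ← smul_tmul', tmul_smul]
  rw [Fin.sum_univ_castSucc (n := p + 1), Fin.sum_univ_succ (n := q + 1)]
  have e0 : cls k (S.δ (Fin.last (p + 1)) (S.seg 0 (p + 1) (by omega) σ)) ⊗ₜ[k]
      cls k (S.seg (p + 1) q (by omega) σ) =
      cls k (S.seg 0 p (by omega) σ) ⊗ₜ[k]
      cls k (S.δ 0 (S.seg p (q + 1) (by omega) σ)) := by
    congr 2
    · refine SSet.map_map_eq' _ _ _ (fun x => ?_) σ
      simp only [SSet.subinterval_val, SSet.δ_val, Fin.val_last]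
      grind
    · refine (SSet.map_map_eq' _ _ _ (fun x => ?_) σ).symm
      simp only [SSet.subinterval_val, SSet.δ_val, Fin.val_zero]
      grind
  rw [e0, ← (finCongr (show p + 1 + (q + 1) = p + q + 2 by omega)).sum_comp, Fin.sum_univ_add]
  simp only [Fin.val_last, Fin.val_zero, pow_zero, one_smul, pow_succ]
  have e1 : ∀ i : Fin (p + 1),
      (-1 : k) ^ ((finCongr (show p + 1 + (q + 1) = p + q + 2 by omega) (Fin.castAdd (q + 1) i) : ℕ)) •
      (cls k (S.seg 0 p (by omega) (S.δ (finCongr (show p + 1 + (q + 1) = p + q + 2 by omega) (Fin.castAdd (q + 1) i)) σ)) ⊗ₜ[k]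
       cls k (S.seg p q (by omega) (S.δ (finCongr (show p + 1 + (q + 1) = p + q + 2 by omega) (Fin.castAdd (q + 1) i)) σ))) =
      (-1 : k) ^ (i.castSucc : ℕ) • (cls k (S.δ i.castSucc (S.seg 0 (p + 1) (by omega) σ)) ⊗ₜ[k]
       cls k (S.seg (p + 1) q (by omega) σ)) := by
    intro i
    rw [SSet.seg_δ_of_mem 0 p _ _ i.castSucc (by simp), SSet.seg_δ_of_le p q _ _ (by simp; omega)]
    simp
  have e2 : ∀ j : Fin (q + 1),
      (-1 : k) ^ ((finCongr (show p + 1 + (q + 1) = p + q + 2 by omega) (Fin.natAdd (p + 1) j) : ℕ)) •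
      (cls k (S.seg 0 p (by omega) (S.δ (finCongr (show p + 1 + (q + 1) = p + q + 2 by omega) (Fin.natAdd (p + 1) j)) σ)) ⊗ₜ[k]
       cls k (S.seg p q (by omega) (S.δ (finCongr (show p + 1 + (q + 1) = p + q + 2 by omega) (Fin.natAdd (p + 1) j)) σ))) =
      (-1 : k) ^ p • (-1 : k) ^ (j.succ : ℕ) • (cls k (S.seg 0 p (by omega) σ) ⊗ₜ[k]
       cls k (S.δ j.succ (S.seg p (q + 1) (by omega) σ))) := by
    intro j
    rw [SSet.seg_δ_of_gt 0 p _ _ (by simp; omega), SSet.seg_δ_of_mem p q _ _ j.succ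
      (by simp; omega), smul_smul, ← pow_add]
    simp [add_comm, add_left_comm]
  simp only [e1, e2, mul_neg_one]
  have e3 : ∀ (r : k) (A B z : NChain k S p ⊗[k] NChain k S q),
      A + B = A + (-r) • z + (r • z + B) := by
    intro r A B z
    rw [neg_smul]
    abel
  exact e3 _ _ _ _

lemma aw_coassoc (n p q r : ℕ) (c : NChain k S n) :
    TensorProduct.assoc k (NChain k S p) (NChain k S q) (NChain k S r)
      ((aw k S (p + q) p q).rTensor (NChain k S r) (aw k S n (p + q) r c)) =
    (aw k S (q + r) q r).lTensor (NChain k S p) (aw k S n p (q + r) c) := by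
  by_cases h : p + q + r = n
  swap
  · simp [aw, h, show ¬ (p + (q + r) = n) by omega]
  subst h
  suffices (TensorProduct.assoc k (NChain k S p) (NChain k S q) (NChain k S r)).toLinearMap ∘ₗ
      (aw k S (p + q) p q).rTensor (NChain k S r) ∘ₗ (aw k S (p + q + r) (p + q) r) =
    (aw k S (q + r) q r).lTensor (NChain k S p) ∘ₗ aw k S (p + q + r) p (q + r) from
    LinearMap.congr_fun this c
  refine hom_ext fun σ => ?_
  simp only [LinearMap.comp_apply, aw_cls (p + q + r) (p + q) r rfl,
    aw_cls (p + q + r) p (q + r) (by omega), LinearMap.rTensor_tmul, LinearMap.lTensor_tmul,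
    aw_cls _ _ _ rfl, LinearEquiv.coe_coe, assoc_tmul, SSet.seg_seg]
  simp

variable (k S)

/-- The augmentation, sending every vertex to `1`. -/
def counit : NChain k S 0 →ₗ[k] k := lift (fun _ => 1) (by simp)

variable {k S}

lemma counit_boundary (c : NChain k S 1) : counit k S (boundary k S 0 c) = 0 := by
  suffices counit k S ∘ₗ boundary k S 0 = 0 from LinearMap.congr_fun this c
  refine hom_ext fun σ => ?_
  simp [boundary_cls, counit, Fin.sum_univ_two]

lemma seg_self {n : ℕ} (σ : S _⦋n⦌) (h : 0 + n ≤ n) : S.seg 0 n h σ = σ := by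
  have : SimplexCategory.subinterval 0 n h = 𝟙 _ := by
    ext i : 3
    exact Fin.ext (by simp [SSet.subinterval_val])
  simp [SSet.seg, this]

lemma aw_counit_left (n : ℕ) (c : NChain k S n) :
    TensorProduct.lid k (NChain k S n) ((counit k S).rTensor (NChain k S n) (aw k S n 0 n c)) = c := by
  suffices (TensorProduct.lid k (NChain k S n)).toLinearMap ∘ₗ (counit k S).rTensor (NChain k S n) ∘ₗ
      aw k S n 0 n = LinearMap.id from LinearMap.congr_fun this c
  refine hom_ext fun σ => ?_
  simp [aw_cls n 0 n (by omega), counit, seg_self]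

lemma aw_counit_right (n : ℕ) (c : NChain k S n) :
    TensorProduct.rid k (NChain k S n) ((counit k S).lTensor (NChain k S n) (aw k S n n 0 c)) = c := by
  suffices (TensorProduct.rid k (NChain k S n)).toLinearMap ∘ₗ (counit k S).lTensor (NChain k S n) ∘ₗ
      aw k S n n 0 = LinearMap.id from LinearMap.congr_fun this c
  refine hom_ext fun σ => ?_
  simp [aw_cls n n 0 (by omega), counit, seg_self]

lemma counit_bijective [Unique (S _⦋0⦌)] : Function.Bijective (counit k S) := by
  let g : k →ₗ[k] NChain k S 0 := LinearMap.toSpanSingleton k _ (cls k default)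
  have h1 : counit k S ∘ₗ g = LinearMap.id := by ext; simp [g, counit]
  have h2 : g ∘ₗ counit k S = LinearMap.id := hom_ext fun σ => by
    simp [g, counit, Unique.eq_default σ]
  exact ⟨Function.LeftInverse.injective (g := g) (LinearMap.congr_fun h2),
    Function.RightInverse.surjective (g := g) (LinearMap.congr_fun h1)⟩

end NChain

end NormalizedChains

/-- A connected (nonnegatively graded, coassociative, counital) dg coalgebra over `k`:
graded pieces `X n`, a differential `d` of degree `-1`, a coproduct given by its components
`Δ n p q : X n → X p ⊗ X q` (zero unless `p + q = n`), and a counit `ε` which is supported in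
degree `0` and identifies `X 0` with `k`. -/
structure ConnDGCoalg (k : Type v) [CommRing k] where
  X : ℕ → Type w
  [addCommGroup : ∀ n, AddCommGroup (X n)]
  [module : ∀ n, Module k (X n)]
  d : ∀ n, X (n + 1) →ₗ[k] X n
  Δ : ∀ n p q, X n →ₗ[k] X p ⊗[k] X q
  ε : X 0 →ₗ[k] k
  d_d : ∀ n (c : X (n + 2)), d n (d (n + 1) c) = 0
  Δ_eq_zero : ∀ n p q, p + q ≠ n → Δ n p q = 0
  /-- `Δ` is a chain map: `Δ d = (d ⊗ id + id ⊗ d) Δ`, with the Koszul sign. -/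
  Δ_d : ∀ n p q (c : X (n + 1)), Δ n p q (d n c) =
    (d p).rTensor (X q) (Δ (n + 1) (p + 1) q c) +
      (-1 : k) ^ p • (d q).lTensor (X p) (Δ (n + 1) p (q + 1) c)
  coassoc : ∀ n p q r (c : X n),
    TensorProduct.assoc k (X p) (X q) (X r)
      ((Δ (p + q) p q).rTensor (X r) (Δ n (p + q) r c)) =
    (Δ (q + r) q r).lTensor (X p) (Δ n p (q + r) c)
  ε_d : ∀ c : X 1, ε (d 0 c) = 0
  counit_left : ∀ n (c : X n), TensorProduct.lid k (X n) (ε.rTensor (X n) (Δ n 0 n c)) = c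
  counit_right : ∀ n (c : X n), TensorProduct.rid k (X n) (ε.lTensor (X n) (Δ n n 0 c)) = c
  ε_bijective : Function.Bijective ε

namespace ConnDGCoalg

variable {k : Type v} [CommRing k]

attribute [instance] ConnDGCoalg.addCommGroup ConnDGCoalg.module

/-- Morphisms of connected dg coalgebras. -/
structure Hom (C : ConnDGCoalg.{v, w} k) (C' : ConnDGCoalg.{v, w'} k) where
  f : ∀ n, C.X n →ₗ[k] C'.X n
  f_d : ∀ n (c : C.X (n + 1)), f n (C.d n c) = C'.d n (f (n + 1) c)
  f_Δ : ∀ n p q (c : C.X n),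
    C'.Δ n p q (f n c) = TensorProduct.map (f p) (f q) (C.Δ n p q c)
  f_ε : ∀ c : C.X 0, C'.ε (f 0 c) = C.ε c

variable (C : ConnDGCoalg.{v, w} k)

/-- The desuspension `s⁻¹ C̃` of the positive degree part of `C`; the summand with index `n`
is `C.X (n + 1)`, placed in degree `n`. -/
abbrev Desusp : Type w := DirectSum ℕ fun n => C.X (n + 1)

/-- The underlying algebra of the cobar construction `Ω C`, the tensor algebra `T(s⁻¹ C̃)`. -/
abbrev Cobar : Type (max v w) := TensorAlgebra k C.Desusp

/-- The degree `-1` map `c ↦ [c] = s⁻¹ c` from `C` to `Ω C`; it is zero on `C.X 0`. -/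
def gen : ∀ n, C.X n →ₗ[k] C.Cobar
  | 0 => 0
  | n + 1 => TensorAlgebra.ι k ∘ₗ DirectSum.lof k ℕ (fun n => C.X (n + 1)) n

/-- The map `c' ⊗ c'' ↦ [c' | c'']`. -/
def gen₂ (p q : ℕ) : C.X p ⊗[k] C.X q →ₗ[k] C.Cobar :=
  LinearMap.mul' k C.Cobar ∘ₗ TensorProduct.map (C.gen p) (C.gen q)

/-- The cobar differential on generators,
`D [c] = -[∂ c] + ∑ (-1) ^ |c'| [c' | c'']`, the sign being the Koszul sign of
`(s⁻¹ ⊗ s⁻¹) (c' ⊗ c'')`. -/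
def cobarDGen (n : ℕ) : C.X (n + 1) →ₗ[k] C.Cobar :=
  -(C.gen n ∘ₗ C.d n) +
    ∑ pq ∈ antidiagonal (n + 1), (-1 : k) ^ pq.1 • (C.gen₂ pq.1 pq.2 ∘ₗ C.Δ (n + 1) pq.1 pq.2)

/-- The sign automorphism `x ↦ (-1) ^ |x| x` of `Ω C`. -/
def cobarSign : C.Cobar →ₐ[k] C.Cobar :=
  TensorAlgebra.lift k (DirectSum.toModule k ℕ _ fun n => (-1 : k) ^ n • C.gen (n + 1))

/-- The algebra map `x ↦ !![(-1) ^ |x| x, D x; 0, x]`; that it is multiplicative says that `D`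
is a derivation of degree `-1`. -/
def cobarMat : C.Cobar →ₐ[k] Matrix (Fin 2) (Fin 2) C.Cobar :=
  TensorAlgebra.lift k (DirectSum.toModule k ℕ _ fun n =>
    { toFun := fun c => !![(-1 : k) ^ n • C.gen (n + 1) c, C.cobarDGen n c; 0, C.gen (n + 1) c]
      map_add' := fun a b => by ext i j; fin_cases i <;> fin_cases j <;> simp
      map_smul' := fun r a => by
        ext i j; fin_cases i <;> fin_cases j <;> simp [smul_comm r] })

/-- The differential of the cobar construction: the derivation of degree `-1` (see
`cobarD_mul`) given on generators by `cobarDGen` (see `cobarD_gen`). -/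
def cobarD : C.Cobar →ₗ[k] C.Cobar where
  toFun x := C.cobarMat x 0 1
  map_add' x y := by simp
  map_smul' r x := by simp

lemma gen_succ (n : ℕ) (c : C.X (n + 1)) :
    C.gen (n + 1) c = TensorAlgebra.ι k (DirectSum.lof k ℕ (fun n => C.X (n + 1)) n c) := rfl

theorem cobar_induction {P : C.Cobar → Prop} (one : P 1)
    (gen_mul : ∀ n (c : C.X (n + 1)) x, P x → P (C.gen (n + 1) c * x))
    (add : ∀ x y, P x → P y → P (x + y)) (smul : ∀ (r : k) x, P x → P (r • x)) (x : C.Cobar) :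
    P x := by
  have key : ∀ y x : C.Cobar, P x → P (y * x) := by
    intro y
    induction y using TensorAlgebra.induction with
    | algebraMap r => intro x hx; rw [← Algebra.smul_def]; exact smul _ _ hx
    | ι v =>
      induction v using DirectSum.induction_on with
      | zero => intro x hx; simpa using smul 0 x hx
      | of n c => intro x hx; exact gen_mul n c x hx
      | add a b ha hb => intro x hx; rw [map_add, add_mul]; exact add _ _ (ha x hx) (hb x hx)
    | mul a b ha hb => intro x hx; rw [mul_assoc]; exact ha _ (hb _ hx)
    | add a b ha hb => intro x hx; rw [add_mul]; exact add _ _ (ha x hx) (hb x hx)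
  simpa using key x 1 one

lemma cobarSign_gen (n : ℕ) (c : C.X (n + 1)) :
    C.cobarSign (C.gen (n + 1) c) = (-1 : k) ^ n • C.gen (n + 1) c := by
  simp [cobarSign, gen_succ]

lemma cobarMat_gen (n : ℕ) (c : C.X (n + 1)) :
    C.cobarMat (C.gen (n + 1) c) =
      !![(-1 : k) ^ n • C.gen (n + 1) c, C.cobarDGen n c; 0, C.gen (n + 1) c] := by
  rw [cobarMat, gen_succ, TensorAlgebra.lift_ι_apply, DirectSum.toModule_lof]
  rfl

lemma cobarMat_eq (x : C.Cobar) :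
    C.cobarMat x = !![C.cobarSign x, C.cobarD x; 0, x] := by
  have h : C.cobarMat x 0 0 = C.cobarSign x ∧ C.cobarMat x 1 0 = 0 ∧ C.cobarMat x 1 1 = x := by
    induction x using C.cobar_induction with
    | one => simp
    | gen_mul n c x ih =>
      obtain ⟨h1, h2, h3⟩ := ih
      simp [map_mul, cobarMat_gen, Matrix.mul_apply, h1, h2, h3, cobarSign_gen]
    | add x y hx hy => simp [hx, hy]
    | smul r x hx => simp [hx]
  obtain ⟨h1, h2, h3⟩ := h
  ext i j
  fin_cases i <;> fin_cases j <;> simp [h1, h2, h3, cobarD]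

lemma cobarD_gen (n : ℕ) (c : C.X (n + 1)) :
    C.cobarD (C.gen (n + 1) c) = C.cobarDGen n c := by
  simp [cobarD, cobarMat_gen]

/-- `D` is a derivation of degree `-1`. -/
lemma cobarD_mul (x y : C.Cobar) :
    C.cobarD (x * y) = C.cobarD x * y + C.cobarSign x * C.cobarD y := by
  have h := congrFun (congrFun (map_mul C.cobarMat x y) 0) 1
  simp only [cobarMat_eq] at h
  simpa [Matrix.mul_apply, add_comm] using h

lemma cobarD_one : C.cobarD 1 = 0 := by
  have := C.cobarMat_eq 1
  simp [cobarD]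

lemma antidiagonal_triple_sum {A : Type*} [AddCommMonoid A] (n : ℕ) (F : ℕ → ℕ → ℕ → A) :
    ∑ a ∈ antidiagonal n, ∑ b ∈ antidiagonal a.1, F b.1 b.2 a.2 =
      ∑ a ∈ antidiagonal n, ∑ b ∈ antidiagonal a.2, F a.1 b.1 b.2 := by
  rw [Finset.sum_sigma', Finset.sum_sigma']
  refine Finset.sum_bij' (fun x _ => ⟨(x.2.1, x.2.2 + x.1.2), (x.2.2, x.1.2)⟩)
    (fun x _ => ⟨(x.1.1 + x.2.1, x.2.2), (x.1.1, x.2.1)⟩) ?_ ?_ ?_ ?_ ?_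
  all_goals
    rintro ⟨⟨a, b⟩, ⟨c, d⟩⟩ h
    simp only [Finset.mem_sigma, Finset.HasAntidiagonal.mem_antidiagonal] at h
  all_goals grind [Finset.HasAntidiagonal.mem_antidiagonal]

/-- The part `-[∂ c]` of the differential of `[c]`. -/
def cobarD₁ : ∀ n, C.X n →ₗ[k] C.Cobar
  | 0 => 0
  | n + 1 => -(C.gen n ∘ₗ C.d n)

/-- The part `∑ (-1) ^ |c'| [c' | c'']` of the differential of `[c]`. -/
def cobarD₂ (n : ℕ) : C.X n →ₗ[k] C.Cobar :=
  ∑ pq ∈ antidiagonal n, (-1 : k) ^ pq.1 • (C.gen₂ pq.1 pq.2 ∘ₗ C.Δ n pq.1 pq.2)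

lemma gen₂_zero_left (q : ℕ) : C.gen₂ 0 q = 0 := by
  ext; simp [gen₂, gen]

lemma gen₂_zero_right (q : ℕ) : C.gen₂ q 0 = 0 := by
  ext; simp [gen₂, gen]

lemma cobarD_gen' (n : ℕ) : C.cobarD ∘ₗ C.gen n = C.cobarD₁ n + C.cobarD₂ n := by
  cases n with
  | zero => simp [gen, cobarD₁, cobarD₂, gen₂_zero_left]
  | succ n => ext c; exact C.cobarD_gen n c

lemma cobarSign_gen' (n : ℕ) (c : C.X n) :
    C.cobarSign (C.gen n c) = (-1 : k) ^ (n + 1) • C.gen n c := by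
  cases n with
  | zero => simp [gen]
  | succ n => rw [cobarSign_gen, pow_add, pow_add]; simp

lemma cobarD_gen₂ (p q : ℕ) (t : C.X p ⊗[k] C.X q) :
    C.cobarD (C.gen₂ p q t) =
      LinearMap.mul' k C.Cobar (TensorProduct.map (C.cobarD ∘ₗ C.gen p) (C.gen q) t) +
      (-1 : k) ^ (p + 1) •
        LinearMap.mul' k C.Cobar (TensorProduct.map (C.gen p) (C.cobarD ∘ₗ C.gen q) t) := by
  induction t using TensorProduct.induction_on with
  | zero => simp
  | tmul a b => simp [gen₂, cobarD_mul, cobarSign_gen']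
  | add a b ha hb => simp only [map_add, ha, hb, smul_add]; abel

lemma cobarSign_gen₂ (p q : ℕ) (t : C.X p ⊗[k] C.X q) :
    C.cobarSign (C.gen₂ p q t) = (-1 : k) ^ (p + q) • C.gen₂ p q t := by
  induction t using TensorProduct.induction_on with
  | zero => simp
  | tmul a b => simp [gen₂, cobarSign_gen', smul_smul]; ring_nf
  | add a b ha hb => simp only [map_add, ha, hb, smul_add]

/-- The map `a ⊗ (b ⊗ c) ↦ [a | b | c]`. -/
def gen₃ (p q r : ℕ) : C.X p ⊗[k] (C.X q ⊗[k] C.X r) →ₗ[k] C.Cobar :=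
  LinearMap.mul' k C.Cobar ∘ₗ TensorProduct.map (C.gen p) (C.gen₂ q r)

lemma gen₃_left (n p q r : ℕ) (t : C.X n ⊗[k] C.X r) :
    LinearMap.mul' k C.Cobar (TensorProduct.map (C.gen₂ p q ∘ₗ C.Δ n p q) (C.gen r) t) =
      C.gen₃ p q r (TensorProduct.assoc k _ _ _ ((C.Δ n p q).rTensor (C.X r) t)) := by
  induction t using TensorProduct.induction_on with
  | zero => simp
  | tmul a b =>
    simp only [TensorProduct.map_tmul, LinearMap.comp_apply, LinearMap.rTensor_tmul]
    induction C.Δ n p q a using TensorProduct.induction_on with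
    | zero => simp
    | tmul x y => simp [gen₃, gen₂, mul_assoc]
    | add x y hx hy => simp only [map_add, TensorProduct.add_tmul, ← hx, ← hy]
  | add a b ha hb => simp only [map_add, ha, hb]

lemma gen₃_right (n p q r : ℕ) (t : C.X p ⊗[k] C.X n) :
    LinearMap.mul' k C.Cobar (TensorProduct.map (C.gen p) (C.gen₂ q r ∘ₗ C.Δ n q r) t) =
      C.gen₃ p q r ((C.Δ n q r).lTensor (C.X p) t) := by
  induction t using TensorProduct.induction_on with
  | zero => simp
  | tmul a b => simp [gen₃]
  | add a b ha hb => simp only [map_add, ha, hb]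

lemma map_sum_left {A B A' B' : Type*} [AddCommGroup A] [AddCommGroup B] [AddCommGroup A']
    [AddCommGroup B'] [Module k A] [Module k B] [Module k A'] [Module k B'] {ι : Type*}
    (s : Finset ι) (f : ι → A →ₗ[k] A') (g : B →ₗ[k] B') (t : A ⊗[k] B) :
    TensorProduct.map (∑ i ∈ s, f i) g t = ∑ i ∈ s, TensorProduct.map (f i) g t := by
  classical
  induction s using Finset.induction_on with
  | empty => simp
  | insert i s hi ih => simp [Finset.sum_insert hi, TensorProduct.map_add_left, ih]

lemma map_sum_right {A B A' B' : Type*} [AddCommGroup A] [AddCommGroup B] [AddCommGroup A']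
    [AddCommGroup B'] [Module k A] [Module k B] [Module k A'] [Module k B'] {ι : Type*}
    (s : Finset ι) (f : A →ₗ[k] A') (g : ι → B →ₗ[k] B') (t : A ⊗[k] B) :
    TensorProduct.map f (∑ i ∈ s, g i) t = ∑ i ∈ s, TensorProduct.map f (g i) t := by
  classical
  induction s using Finset.induction_on with
  | empty => simp
  | insert i s hi ih => simp [Finset.sum_insert hi, TensorProduct.map_add_right, ih]

lemma cobarD_cobarD_coassoc (n : ℕ) (c : C.X n) :
    ∑ pq ∈ antidiagonal n, (-1 : k) ^ pq.1 •
      LinearMap.mul' k C.Cobar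
        (TensorProduct.map (C.cobarD₂ pq.1) (C.gen pq.2) (C.Δ n pq.1 pq.2 c)) =
    ∑ pq ∈ antidiagonal n,
      LinearMap.mul' k C.Cobar
        (TensorProduct.map (C.gen pq.1) (C.cobarD₂ pq.2) (C.Δ n pq.1 pq.2 c)) := by
  have h1 : ∀ pq ∈ antidiagonal n, (-1 : k) ^ pq.1 •
      LinearMap.mul' k C.Cobar
        (TensorProduct.map (C.cobarD₂ pq.1) (C.gen pq.2) (C.Δ n pq.1 pq.2 c)) =
      ∑ b ∈ antidiagonal pq.1, (-1 : k) ^ b.2 • C.gen₃ b.1 b.2 pq.2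
        (TensorProduct.assoc k _ _ _ ((C.Δ (b.1 + b.2) b.1 b.2).rTensor (C.X pq.2)
          (C.Δ n (b.1 + b.2) pq.2 c))) := by
    rintro ⟨s, r⟩ -
    simp only [cobarD₂, map_sum_left, map_sum, Finset.smul_sum, TensorProduct.map_smul_left,
      LinearMap.smul_apply, map_smul, smul_smul]
    refine Finset.sum_congr rfl ?_
    rintro ⟨p, q⟩ h
    rw [Finset.HasAntidiagonal.mem_antidiagonal] at h
    dsimp only at h ⊢
    subst h
    rw [gen₃_left, pow_add, mul_assoc, mul_comm, mul_assoc, ← pow_add, ← two_mul]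
    simp
  have h2 : ∀ pq ∈ antidiagonal n,
      LinearMap.mul' k C.Cobar
        (TensorProduct.map (C.gen pq.1) (C.cobarD₂ pq.2) (C.Δ n pq.1 pq.2 c)) =
      ∑ b ∈ antidiagonal pq.2, (-1 : k) ^ b.1 • C.gen₃ pq.1 b.1 b.2
        ((C.Δ (b.1 + b.2) b.1 b.2).lTensor (C.X pq.1)
          (C.Δ n pq.1 (b.1 + b.2) c)) := by
    rintro ⟨p, t⟩ -
    simp only [cobarD₂, map_sum_right, map_sum, TensorProduct.map_smul_right,
      LinearMap.smul_apply, map_smul]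
    refine Finset.sum_congr rfl ?_
    rintro ⟨q, r⟩ h
    rw [Finset.HasAntidiagonal.mem_antidiagonal] at h
    dsimp only at h ⊢
    subst h
    rw [gen₃_right]
  rw [Finset.sum_congr rfl h1, Finset.sum_congr rfl h2]
  simp only [C.coassoc]
  exact antidiagonal_triple_sum n fun p q r => (-1 : k) ^ q • C.gen₃ p q r
        ((C.Δ (q + r) q r).lTensor (C.X p) (C.Δ n p (q + r) c))

lemma mul'_cobarD₁_left (p q : ℕ) (t : C.X (p + 1) ⊗[k] C.X q) :
    LinearMap.mul' k C.Cobar (TensorProduct.map (C.cobarD₁ (p + 1)) (C.gen q) t) =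
      -C.gen₂ p q ((C.d p).rTensor (C.X q) t) := by
  induction t using TensorProduct.induction_on with
  | zero => simp
  | tmul a b => simp [cobarD₁, gen₂]
  | add a b ha hb => simp only [map_add, ha, hb]; abel

lemma mul'_cobarD₁_right (p q : ℕ) (t : C.X p ⊗[k] C.X (q + 1)) :
    LinearMap.mul' k C.Cobar (TensorProduct.map (C.gen p) (C.cobarD₁ (q + 1)) t) =
      -C.gen₂ p q ((C.d q).lTensor (C.X p) t) := by
  induction t using TensorProduct.induction_on with
  | zero => simp
  | tmul a b => simp [cobarD₁, gen₂]
  | add a b ha hb => simp only [map_add, ha, hb]; abel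

lemma cobarD_cobarD_chain (n : ℕ) (c : C.X (n + 1)) :
    C.cobarD₂ n (C.d n c) =
    ∑ pq ∈ antidiagonal (n + 1), ((-1 : k) ^ pq.1 •
      LinearMap.mul' k C.Cobar
        (TensorProduct.map (C.cobarD₁ pq.1) (C.gen pq.2) (C.Δ (n + 1) pq.1 pq.2 c)) -
      LinearMap.mul' k C.Cobar
        (TensorProduct.map (C.gen pq.1) (C.cobarD₁ pq.2) (C.Δ (n + 1) pq.1 pq.2 c))) := by
  rw [Finset.sum_sub_distrib, Finset.Nat.sum_antidiagonal_succ, Finset.Nat.sum_antidiagonal_succ']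
  simp only [mul'_cobarD₁_left, mul'_cobarD₁_right]
  simp only [cobarD₁, TensorProduct.map_zero_left, TensorProduct.map_zero_right,
    LinearMap.zero_apply, map_zero, smul_zero, zero_add]
  rw [← Finset.sum_sub_distrib]
  simp only [cobarD₂, LinearMap.sum_apply, LinearMap.smul_apply, LinearMap.comp_apply, C.Δ_d,
    map_add, map_smul, smul_add, smul_smul]
  refine Finset.sum_congr rfl ?_
  rintro ⟨p, q⟩ -
  simp only [← pow_add, ← two_mul]
  simp [pow_succ]

lemma cobarD_cobarD_gen (n : ℕ) (c : C.X n) : C.cobarD (C.cobarD (C.gen n c)) = 0 := by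
  cases n with
  | zero => simp [gen]
  | succ n =>
    have e : ∀ m (x : C.X m), C.cobarD (C.gen m x) = C.cobarD₁ m x + C.cobarD₂ m x :=
      fun m x => LinearMap.congr_fun (C.cobarD_gen' m) x
    rw [e]
    have h1 : C.cobarD (C.cobarD₁ (n + 1) c) = -C.cobarD₂ n (C.d n c) := by
      simp only [cobarD₁, LinearMap.neg_apply, LinearMap.comp_apply, map_neg, e]
      cases n with
      | zero => simp
      | succ n => simp [C.d_d]
    have h2 : C.cobarD (C.cobarD₂ (n + 1) c) = ∑ pq ∈ antidiagonal (n + 1), ((-1 : k) ^ pq.1 •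
        LinearMap.mul' k C.Cobar
          (TensorProduct.map (C.cobarD₁ pq.1) (C.gen pq.2) (C.Δ (n + 1) pq.1 pq.2 c)) -
        LinearMap.mul' k C.Cobar
          (TensorProduct.map (C.gen pq.1) (C.cobarD₁ pq.2) (C.Δ (n + 1) pq.1 pq.2 c))) := by
      rw [← add_zero (∑ pq ∈ _, _), ← sub_eq_zero.2 (C.cobarD_cobarD_coassoc (n + 1) c),
        ← Finset.sum_sub_distrib, ← Finset.sum_add_distrib, cobarD₂]
      simp only [LinearMap.sum_apply, LinearMap.smul_apply, LinearMap.comp_apply, map_sum,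
        map_smul, cobarD_gen₂, cobarD_gen', TensorProduct.map_add_left,
        TensorProduct.map_add_right, LinearMap.add_apply, map_add, smul_add, smul_smul]
      refine Finset.sum_congr rfl ?_
      rintro ⟨p, q⟩ -
      have hp : (-1 : k) ^ p * (-1) ^ (p + 1) = -1 := by
        rw [← pow_add, show p + (p + 1) = 2 * p + 1 by ring, pow_succ, pow_mul]; simp
      simp only [hp, neg_smul, one_smul]
      abel
    rw [map_add, h1, h2, ← cobarD_cobarD_chain]
    simp

lemma cobarSign_cobarD (x : C.Cobar) : C.cobarSign (C.cobarD x) = -C.cobarD (C.cobarSign x) := by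
  induction x using C.cobar_induction with
  | one => simp [cobarD_one]
  | gen_mul n c x ih =>
    have h : C.cobarSign (C.cobarD (C.gen (n + 1) c)) =
        -((-1 : k) ^ n • C.cobarD (C.gen (n + 1) c)) := by
      have e := LinearMap.congr_fun (C.cobarD_gen' (n + 1)) c
      simp only [LinearMap.comp_apply] at e
      rw [e]
      simp only [LinearMap.add_apply, map_add, smul_add, cobarD₁, cobarD₂, LinearMap.neg_apply,
        LinearMap.comp_apply, map_neg, cobarSign_gen', LinearMap.sum_apply, map_sum,
        LinearMap.smul_apply, map_smul, cobarSign_gen₂, neg_add, smul_neg, Finset.smul_sum,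
        ← Finset.sum_neg_distrib]
      congr 1
      · simp [pow_succ]
      · refine Finset.sum_congr rfl ?_
        rintro ⟨p, q⟩ h
        rw [Finset.HasAntidiagonal.mem_antidiagonal] at h
        dsimp only at h ⊢
        rw [h, smul_comm, pow_succ]
        simp
    rw [C.cobarD_mul, map_add, map_mul, map_mul, h, ih, map_mul, C.cobarD_mul]
    simp only [map_smul, cobarSign_gen]
    simp
    abel
  | add x y hx hy => simp only [map_add, hx, hy, neg_add]
  | smul r x hx => simp only [map_smul, hx, smul_neg]

/-- The cobar differential squares to zero. -/
lemma cobarD_cobarD (x : C.Cobar) : C.cobarD (C.cobarD x) = 0 := by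
  induction x using C.cobar_induction with
  | one => simp [cobarD_one]
  | gen_mul n c x ih =>
    rw [cobarD_mul, map_add, cobarD_mul, cobarD_mul, ih, cobarD_cobarD_gen, cobarSign_cobarD]
    simp
  | add x y hx hy => simp only [map_add, hx, hy, add_zero]
  | smul r x hx => simp only [map_smul, hx, smul_zero]

/-! ### The grading of the cobar construction -/

/-- The degree `m` part of `Ω C`, spanned by the monomials `[c₁ | … | cᵣ]` with
`∑ (|cᵢ| - 1) = m`. -/
def cobarDeg (m : ℕ) : Submodule k C.Cobar :=
  Submodule.span k {x | ∃ l : List (Σ n, C.X (n + 1)), (l.map Sigma.fst).sum = m ∧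
    x = (l.map fun s => C.gen (s.1 + 1) s.2).prod}

lemma one_mem_cobarDeg : (1 : C.Cobar) ∈ C.cobarDeg 0 :=
  Submodule.subset_span ⟨[], by simp, by simp⟩

lemma gen_mem_cobarDeg (n : ℕ) (c : C.X (n + 1)) : C.gen (n + 1) c ∈ C.cobarDeg n :=
  Submodule.subset_span ⟨[⟨n, c⟩], by simp, by simp⟩

lemma mul_mem_cobarDeg {a b n : ℕ} (hn : a + b = n) {x y : C.Cobar} (hx : x ∈ C.cobarDeg a)
    (hy : y ∈ C.cobarDeg b) : x * y ∈ C.cobarDeg n := by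
  subst hn
  have h := Submodule.mul_mem_mul hx hy
  rw [cobarDeg, cobarDeg, Submodule.span_mul_span] at h
  refine Submodule.span_mono ?_ h
  rintro _ ⟨_, ⟨l, hl, rfl⟩, _, ⟨l', hl', rfl⟩, rfl⟩
  exact ⟨l ++ l', by simp [hl, hl'], by simp⟩

lemma cobarD_gen_mem (n : ℕ) (c : C.X (n + 1)) :
    (∀ m, n = m + 1 → C.cobarD (C.gen (n + 1) c) ∈ C.cobarDeg m) ∧
      (n = 0 → C.cobarD (C.gen (n + 1) c) = 0) := by
  have h2 : ∀ p q m (t : C.X p ⊗[k] C.X q), p + q = m + 2 → C.gen₂ p q t ∈ C.cobarDeg m := by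
    intro p q m t h
    obtain _ | p := p
    · simp [gen₂_zero_left]
    obtain _ | q := q
    · simp [gen₂_zero_right]
    induction t using TensorProduct.induction_on with
    | zero => simp
    | tmul a b =>
      exact C.mul_mem_cobarDeg (by omega) (C.gen_mem_cobarDeg p a) (C.gen_mem_cobarDeg q b)
    | add a b ha hb => rw [map_add]; exact add_mem ha hb
  rw [cobarD_gen, cobarDGen]
  simp only [LinearMap.add_apply, LinearMap.neg_apply, LinearMap.comp_apply, LinearMap.sum_apply,
    LinearMap.smul_apply]
  constructor
  · rintro m rfl
    refine add_mem (neg_mem (C.gen_mem_cobarDeg _ _)) (sum_mem fun pq h => ?_)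
    rw [Finset.HasAntidiagonal.mem_antidiagonal] at h
    exact Submodule.smul_mem _ _ (h2 _ _ _ _ h)
  · rintro rfl
    rw [Finset.sum_eq_zero]
    · simp [gen]
    · rintro ⟨p, q⟩ h
      rw [Finset.HasAntidiagonal.mem_antidiagonal] at h
      obtain rfl | rfl : p = 0 ∨ q = 0 := by dsimp at h; omega
      · simp [gen₂_zero_left]
      · simp [gen₂_zero_right]

/-- `D` has degree `-1`. -/
lemma cobarD_mem (m : ℕ) (x : C.Cobar) (hx : x ∈ C.cobarDeg (m + 1)) :
    C.cobarD x ∈ C.cobarDeg m := by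
  suffices h : ∀ l : List (Σ n, C.X (n + 1)),
      (∀ m, (l.map Sigma.fst).sum = m + 1 →
        C.cobarD (l.map fun s => C.gen (s.1 + 1) s.2).prod ∈ C.cobarDeg m) ∧
      ((l.map Sigma.fst).sum = 0 → C.cobarD (l.map fun s => C.gen (s.1 + 1) s.2).prod = 0) by
    refine (Submodule.span_le (p := (C.cobarDeg m).comap C.cobarD)).2 ?_ hx
    rintro _ ⟨l, hl, rfl⟩
    exact (h l).1 m hl
  intro l
  induction l with
  | nil => simp [cobarD_one]
  | cons s l ih =>
    obtain ⟨n, c⟩ := s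
    obtain ⟨hc1, hc0⟩ := C.cobarD_gen_mem n c
    have hl : (l.map fun s => C.gen (s.1 + 1) s.2).prod ∈ C.cobarDeg (l.map Sigma.fst).sum :=
      Submodule.subset_span ⟨l, rfl, rfl⟩
    simp only [List.map_cons, List.sum_cons, List.prod_cons, cobarD_mul, cobarSign_gen]
    constructor
    · intro m hm
      refine add_mem ?_ ?_
      · obtain _ | n := n
        · simp [hc0 rfl]
        · exact C.mul_mem_cobarDeg (by omega) (hc1 n rfl) hl
      · rw [smul_mul_assoc]
        refine Submodule.smul_mem _ _ ?_
        rcases h : (l.map Sigma.fst).sum with _ | b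
        · simp [ih.2 h]
        · exact C.mul_mem_cobarDeg (by omega) (C.gen_mem_cobarDeg n c) (ih.1 b h)
    · intro h
      rw [hc0 (by omega), ih.2 (by omega)]
      simp

/-- The underlying chain complex of the dg algebra `Ω C = (T(s⁻¹ C̃), D)`. -/
def cobarComplex : ChainComplex (ModuleCat.{max v w} k) ℕ :=
  ChainComplex.of (fun n => ModuleCat.of k (C.cobarDeg n))
    (fun n => ModuleCat.ofHom (C.cobarD.restrict (C.cobarD_mem n)))
    (fun n => by
      ext x
      exact C.cobarD_cobarD x.1)

lemma cobarComplex_d (n : ℕ) : C.cobarComplex.d (n + 1) n =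
    ModuleCat.ofHom (C.cobarD.restrict (C.cobarD_mem n)) :=
  ChainComplex.of_d (fun n => ModuleCat.of k (C.cobarDeg n))
    (fun n => ModuleCat.ofHom (C.cobarD.restrict (C.cobarD_mem n))) n

/-! ### Functoriality of the cobar construction -/

namespace Hom

variable {C} {C' : ConnDGCoalg.{v, w} k} (φ : Hom C C')

/-- The algebra map `Ω φ : Ω C → Ω C'`, `[c₁ | … | cᵣ] ↦ [φ c₁ | … | φ cᵣ]`. -/
def cobarMap : C.Cobar →ₐ[k] C'.Cobar :=
  TensorAlgebra.lift k (DirectSum.toModule k ℕ _ fun n => C'.gen (n + 1) ∘ₗ φ.f (n + 1))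

lemma cobarMap_gen (n : ℕ) (c : C.X n) : φ.cobarMap (C.gen n c) = C'.gen n (φ.f n c) := by
  cases n with
  | zero => simp [gen]
  | succ n => simp [cobarMap, gen_succ]

lemma cobarMap_gen₂ (p q : ℕ) (t : C.X p ⊗[k] C.X q) :
    φ.cobarMap (C.gen₂ p q t) = C'.gen₂ p q (TensorProduct.map (φ.f p) (φ.f q) t) := by
  induction t using TensorProduct.induction_on with
  | zero => simp
  | tmul a b => simp [gen₂, cobarMap_gen]
  | add a b ha hb => simp only [map_add, ha, hb]

lemma cobarMap_cobarSign (x : C.Cobar) :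
    φ.cobarMap (C.cobarSign x) = C'.cobarSign (φ.cobarMap x) := by
  induction x using C.cobar_induction with
  | one => simp
  | gen_mul n c x ih => simp [cobarSign_gen, cobarMap_gen, ih]
  | add x y hx hy => simp only [map_add, hx, hy]
  | smul r x hx => simp only [map_smul, hx]

/-- `Ω φ` is a chain map. -/
lemma cobarMap_cobarD (x : C.Cobar) : φ.cobarMap (C.cobarD x) = C'.cobarD (φ.cobarMap x) := by
  induction x using C.cobar_induction with
  | one => simp [cobarD_one]
  | gen_mul n c x ih =>
    have h : φ.cobarMap (C.cobarD (C.gen (n + 1) c)) = C'.cobarD (C'.gen (n + 1) (φ.f _ c)) := by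
      rw [cobarD_gen, cobarD_gen, cobarDGen, cobarDGen]
      simp only [LinearMap.add_apply, LinearMap.neg_apply, LinearMap.comp_apply,
        LinearMap.sum_apply, LinearMap.smul_apply, map_add, map_neg, map_sum, map_smul,
        cobarMap_gen, cobarMap_gen₂, φ.f_d, φ.f_Δ]
    rw [cobarD_mul, map_add, map_mul, map_mul, map_mul, h, ih, cobarMap_cobarSign, cobarMap_gen,
      cobarD_mul]
  | add x y hx hy => simp only [map_add, hx, hy]
  | smul r x hx => simp only [map_smul, hx]

lemma cobarMap_mem (m : ℕ) (x : C.Cobar) (hx : x ∈ C.cobarDeg m) :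
    φ.cobarMap x ∈ C'.cobarDeg m := by
  refine (Submodule.span_le (p := (C'.cobarDeg m).comap φ.cobarMap.toLinearMap)).2 ?_ hx
  rintro _ ⟨l, hl, rfl⟩
  refine Submodule.subset_span ⟨l.map fun s => ⟨s.1, φ.f _ s.2⟩, ?_, ?_⟩
  · rw [← hl, List.map_map]; rfl
  · rw [List.map_map, AlgHom.toLinearMap_apply, map_list_prod, List.map_map]
    congr 1
    refine List.map_congr_left fun s _ => ?_
    exact φ.cobarMap_gen _ _

/-- `Ω φ` as a morphism of chain complexes. -/
def cobarComplexMap : C.cobarComplex ⟶ C'.cobarComplex :=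
  ChainComplex.ofHom
    (fun n => ModuleCat.ofHom (φ.cobarMap.toLinearMap.restrict (φ.cobarMap_mem n)))
    (fun n => by
      rw [cobarComplex_d, cobarComplex_d]
      ext x
      exact Subtype.ext (φ.cobarMap_cobarD x.1).symm)

/-- `φ` is an `Ω`-quasi-isomorphism if `Ω φ` is a quasi-isomorphism. -/
def IsOmegaQuasiIso : Prop := QuasiIso φ.cobarComplexMap

end Hom

/-! ### Twisted tensor products -/

/-- The universal twisting cochain `τ : C → Ω C`, of degree `-1`. With the sign conventions of
`cobarD` the isomorphism `C̃ ≅ s⁻¹ C̃` entering `τ` has to be `c ↦ -s⁻¹ c` in order that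
`τ` satisfies the Maurer-Cartan equation, see `maurerCartan`. -/
def twist (n : ℕ) : C.X n →ₗ[k] C.Cobar := -C.gen n

/-- The Maurer-Cartan equation `D τ + τ ∂ + τ ⋆ τ = 0`. -/
lemma maurerCartan (n : ℕ) (c : C.X (n + 1)) :
    C.cobarD (C.twist (n + 1) c) + C.twist n (C.d n c) +
      ∑ pq ∈ antidiagonal (n + 1), (-1 : k) ^ pq.1 •
        LinearMap.mul' k C.Cobar (TensorProduct.map (C.twist pq.1) (C.twist pq.2)
          (C.Δ (n + 1) pq.1 pq.2 c)) = 0 := by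
  have h : ∀ p q, LinearMap.mul' k C.Cobar ∘ₗ TensorProduct.map (C.twist p) (C.twist q) =
      C.gen₂ p q := by
    intro p q
    ext a b
    simp [twist, gen₂]
  have h' : ∀ p q t, LinearMap.mul' k C.Cobar (TensorProduct.map (C.twist p) (C.twist q) t) =
      C.gen₂ p q t := fun p q t => LinearMap.congr_fun (h p q) t
  simp only [h']
  simp [twist, cobarD_gen, cobarDGen]

/-- A left dg `Ω C`-module structure on a module `M` regarded as a complex concentrated in
degree `0`: the elements of positive degree and the boundaries act by zero. -/
structure DegZeroAction (M : Type w') [AddCommGroup M] [Module k M] where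
  act : C.Cobar →ₐ[k] Module.End k M
  act_pos : ∀ n, ∀ x ∈ C.cobarDeg (n + 1), act x = 0
  act_D : ∀ x, act (C.cobarD x) = 0

variable {C} {M : Type w'} [AddCommGroup M] [Module k M]

namespace DegZeroAction

variable (ρ : C.DegZeroAction M)

/-- The map `m ∘ (τ ⊗ id) : C_n ⊗ M → M`; it is zero unless `n = 1`. -/
def tw (n : ℕ) : C.X n ⊗[k] M →ₗ[k] M :=
  TensorProduct.lift (ρ.act.toLinearMap ∘ₗ C.twist n)

/-- The differential
`∂ ⊗ id + (id ⊗ m) ∘ (id ⊗ τ ⊗ id) ∘ (Δ ⊗ id)` of the twisted tensor product `C ⊗_τ M`.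
As `M` sits in degree `0`, only the component of `Δ` in `C_n ⊗ C_1` contributes; `(-1) ^ n` is the
Koszul sign of `id ⊗ τ` on it. -/
def twistedD (n : ℕ) : C.X (n + 1) ⊗[k] M →ₗ[k] C.X n ⊗[k] M :=
  (C.d n).rTensor M + (-1 : k) ^ n • ((ρ.tw 1).lTensor (C.X n) ∘ₗ
    (TensorProduct.assoc k (C.X n) (C.X 1) M).toLinearMap ∘ₗ (C.Δ (n + 1) n 1).rTensor M)

/-- The map `u ↦ τ(u) m`. -/
def twAt (m : M) : C.X 1 →ₗ[k] M := ρ.tw 1 ∘ₗ (TensorProduct.mk k (C.X 1) M).flip m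

/-- The map `u ⊗ v ↦ τ(u) τ(v) m`. -/
def twAt₂ (m : M) : C.X 1 ⊗[k] C.X 1 →ₗ[k] M := ρ.tw 1 ∘ₗ (ρ.twAt m).lTensor (C.X 1)

lemma twistedD_tmul (n : ℕ) (c : C.X (n + 1)) (m : M) : ρ.twistedD n (c ⊗ₜ m) =
    C.d n c ⊗ₜ m + (-1 : k) ^ n • (ρ.twAt m).lTensor (C.X n) (C.Δ (n + 1) n 1 c) := by
  have h : ∀ t : C.X n ⊗[k] C.X 1, (ρ.tw 1).lTensor (C.X n)
      (TensorProduct.assoc k (C.X n) (C.X 1) M (t ⊗ₜ m)) = (ρ.twAt m).lTensor (C.X n) t := by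
    intro t
    induction t using TensorProduct.induction_on with
    | zero => simp
    | tmul a b => simp [twAt]
    | add a b ha hb => simp only [map_add, ha, hb, add_tmul]
  simp [twistedD, h]

lemma twAt_d (c : C.X 2) (m : M) : ρ.twAt m (C.d 1 c) = ρ.twAt₂ m (C.Δ 2 1 1 c) := by
  have h := ρ.act_D (C.gen 2 c)
  rw [cobarD_gen, cobarDGen, Finset.Nat.sum_antidiagonal_succ,
    Finset.Nat.sum_antidiagonal_succ] at h
  simp [gen₂_zero_left, gen₂_zero_right] at h
  have h2 : ∀ t : C.X 1 ⊗[k] C.X 1, ρ.act (C.gen₂ 1 1 t) m = ρ.twAt₂ m t := by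
    intro t
    induction t using TensorProduct.induction_on with
    | zero => simp
    | tmul a b => simp [twAt₂, twAt, tw, twist, gen₂]
    | add a b ha hb => simp only [map_add, LinearMap.add_apply, ha, hb]
  have h3 := LinearMap.congr_fun h m
  have h4 : ρ.twAt m (C.d 1 c) = -ρ.act (C.gen 1 (C.d 1 c)) m := by simp [twAt, tw, twist]
  rw [LinearMap.add_apply, LinearMap.neg_apply, LinearMap.neg_apply, LinearMap.zero_apply] at h3
  rw [← h2, h4]
  exact eq_of_sub_eq_zero (by rw [sub_eq_add_neg, h3])

lemma twistedD_lTensor (n : ℕ) (t : C.X (n + 1) ⊗[k] C.X 1) (m : M) :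
    ρ.twistedD n ((ρ.twAt m).lTensor (C.X (n + 1)) t) =
      (ρ.twAt m).lTensor (C.X n) ((C.d n).rTensor (C.X 1) t) +
        (-1 : k) ^ n • (ρ.twAt₂ m).lTensor (C.X n)
          (TensorProduct.assoc k (C.X n) (C.X 1) (C.X 1) ((C.Δ (n + 1) n 1).rTensor (C.X 1) t)) := by
  induction t using TensorProduct.induction_on with
  | zero => simp
  | add a b ha hb => simp only [map_add, ha, hb, smul_add]; abel
  | tmul u v =>
    have h : ∀ t : C.X n ⊗[k] C.X 1, (ρ.twAt (ρ.twAt m v)).lTensor (C.X n) t =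
        (ρ.twAt₂ m).lTensor (C.X n) (TensorProduct.assoc k (C.X n) (C.X 1) (C.X 1) (t ⊗ₜ v)) := by
      intro t
      induction t using TensorProduct.induction_on with
      | zero => simp
      | tmul a b => simp [twAt₂, twAt]
      | add a b ha hb => simp only [map_add, ha, hb, add_tmul]
    simp [twistedD_tmul, h]

/-- The differential of the twisted tensor product squares to zero. -/
lemma twistedD_twistedD (n : ℕ) (x : C.X (n + 2) ⊗[k] M) :
    ρ.twistedD n (ρ.twistedD (n + 1) x) = 0 := by
  induction x using TensorProduct.induction_on with
  | zero => simp
  | add a b ha hb => rw [map_add, map_add, ha, hb, add_zero]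
  | tmul c m =>
    have h1 := C.coassoc (n + 2) n 1 1 c
    have h2 : ∀ t : C.X n ⊗[k] C.X 2, (ρ.twAt₂ m).lTensor (C.X n) ((C.Δ 2 1 1).lTensor (C.X n) t) =
        (ρ.twAt m).lTensor (C.X n) ((C.d 1).lTensor (C.X n) t) := by
      intro t
      induction t using TensorProduct.induction_on with
      | zero => simp
      | tmul a b => simp [twAt_d]
      | add a b ha hb => simp only [map_add, ha, hb]
    have hs : (-1 : k) ^ n * (-1) ^ n = 1 := by rw [← mul_pow]; simp
    rw [twistedD_tmul, map_add, map_smul, twistedD_tmul, C.d_d, C.Δ_d, twistedD_lTensor, h1, h2,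
      map_add, map_smul, pow_succ]
    simp only [smul_add, smul_smul, zero_tmul, zero_add, mul_neg_one, neg_mul, hs, neg_smul,
      one_smul]
    abel

/-- The twisted tensor product `C ⊗_τ M`. -/
def twistedTensor : ChainComplex (ModuleCat.{max w w'} k) ℕ :=
  ChainComplex.of (fun n => ModuleCat.of k (C.X n ⊗[k] M)) (fun n => ModuleCat.ofHom (ρ.twistedD n))
    (fun n => ModuleCat.hom_ext (LinearMap.ext (ρ.twistedD_twistedD n)))

lemma twistedTensor_d (n : ℕ) : ρ.twistedTensor.d (n + 1) n = ModuleCat.ofHom (ρ.twistedD n) :=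
  ChainComplex.of_d (fun n => ModuleCat.of k (C.X n ⊗[k] M))
    (fun n => ModuleCat.ofHom (ρ.twistedD n)) n

end DegZeroAction

namespace Hom

variable {C' : ConnDGCoalg.{v, w} k} (φ : Hom C C')

lemma rTensor_twistedD (ρ : C.DegZeroAction M) (ρ' : C'.DegZeroAction M)
    (h : ∀ x, ρ.act x = ρ'.act (φ.cobarMap x)) (n : ℕ) (x : C.X (n + 1) ⊗[k] M) :
    (φ.f n).rTensor M (ρ.twistedD n x) = ρ'.twistedD n ((φ.f (n + 1)).rTensor M x) := by
  induction x using TensorProduct.induction_on with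
  | zero => simp
  | add a b ha hb => simp only [map_add, ha, hb]
  | tmul c m =>
    have h1 : ∀ t : C.X n ⊗[k] C.X 1, (φ.f n).rTensor M ((ρ.twAt m).lTensor (C.X n) t) =
        (ρ'.twAt m).lTensor (C'.X n) (TensorProduct.map (φ.f n) (φ.f 1) t) := by
      intro t
      induction t using TensorProduct.induction_on with
      | zero => simp
      | tmul a b =>
        simp [DegZeroAction.twAt, DegZeroAction.tw, twist, h, cobarMap_gen]
      | add a b ha hb => simp only [map_add, ha, hb]
    simp [DegZeroAction.twistedD_tmul, φ.f_d, φ.f_Δ, h1]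

/-- A morphism `φ : C → C'` induces the chain map `φ ⊗ id : C ⊗_τ M → C' ⊗_τ M`, where the `Ω C`-module
structure of `M` is the one restricted from `Ω C'` along `Ω φ`. -/
def twistedMap (ρ : C.DegZeroAction M) (ρ' : C'.DegZeroAction M)
    (h : ∀ x, ρ.act x = ρ'.act (φ.cobarMap x)) : ρ.twistedTensor ⟶ ρ'.twistedTensor :=
  ChainComplex.ofHom (fun n => ModuleCat.ofHom ((φ.f n).rTensor M))
    (fun n => by
      rw [DegZeroAction.twistedTensor_d, DegZeroAction.twistedTensor_d]
      exact ModuleCat.hom_ext <| LinearMap.ext fun x => (φ.rTensor_twistedD ρ ρ' h n x).symm)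

end Hom

end ConnDGCoalg

section ChainCoalgebra

open Simplicial Opposite

variable (k : Type v) [CommRing k] (S T : SSet.{u})

/-- The connected dg coalgebra of normalized chains of a simplicial set with one vertex. -/
def chainCoalg [Unique (S _⦋0⦌)] : ConnDGCoalg.{v, max u v} k where
  X := NChain k S
  d := NChain.boundary k S
  Δ := NChain.aw k S
  ε := NChain.counit k S
  d_d := NChain.boundary_boundary
  Δ_eq_zero n p q h := by simp [NChain.aw, h]
  Δ_d := NChain.aw_boundary
  coassoc := NChain.aw_coassoc
  ε_d := NChain.counit_boundary
  counit_left := NChain.aw_counit_left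
  counit_right := NChain.aw_counit_right
  ε_bijective := NChain.counit_bijective

variable {S T}

/-- The map on normalized chains induced by a map of simplicial sets. -/
def NChain.map (g : S ⟶ T) (n : ℕ) : NChain k S n →ₗ[k] NChain k T n :=
  NChain.lift (fun σ => NChain.cls k (g.app (op ⦋n⦌) σ)) fun σ hσ => by
    obtain ⟨m, hm, f, y, rfl⟩ := hσ
    refine NChain.cls_eq_zero k ⟨m, hm, f, g.app _ y, ?_⟩
    exact (NatTrans.naturality_apply g f.op y).symm

variable {k}

lemma NChain.map_cls (g : S ⟶ T) (n : ℕ) (σ : S _⦋n⦌) :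
    NChain.map k g n (NChain.cls k σ) = NChain.cls k (g.app (op ⦋n⦌) σ) := by
  simp [NChain.map]

variable (k)

/-- Functoriality of `chainCoalg`. -/
def chainCoalgMap [Unique (S _⦋0⦌)] [Unique (T _⦋0⦌)] (g : S ⟶ T) :
    ConnDGCoalg.Hom (chainCoalg k S) (chainCoalg k T) where
  f := NChain.map k g
  f_d n c := by
    suffices NChain.map k g n ∘ₗ NChain.boundary k S n =
      NChain.boundary k T n ∘ₗ NChain.map k g (n + 1) from LinearMap.congr_fun this c
    refine NChain.hom_ext fun σ => ?_
    simp only [LinearMap.comp_apply, NChain.boundary_cls, map_sum, map_smul, NChain.map_cls]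
    refine Finset.sum_congr rfl fun i _ => ?_
    congr 2
    exact NatTrans.naturality_apply g (SimplexCategory.δ i).op σ
  f_Δ n p q c := by
    by_cases h : p + q = n
    swap
    · change NChain.aw k T n p q _ = TensorProduct.map _ _ (NChain.aw k S n p q c)
      rw [NChain.aw, NChain.aw, dif_neg h, dif_neg h]
      exact (map_zero (TensorProduct.map (NChain.map k g p) (NChain.map k g q))).symm
    suffices NChain.aw k T n p q ∘ₗ NChain.map k g n =
      TensorProduct.map (NChain.map k g p) (NChain.map k g q) ∘ₗ NChain.aw k S n p q from
      LinearMap.congr_fun this c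
    refine NChain.hom_ext fun σ => ?_
    simp only [LinearMap.comp_apply, NChain.map_cls, NChain.aw_cls _ _ _ h, map_tmul]
    congr 2
    · exact (NatTrans.naturality_apply g (SimplexCategory.subinterval 0 p (by omega)).op σ).symm
    · exact (NatTrans.naturality_apply g (SimplexCategory.subinterval p q (by omega)).op σ).symm
  f_ε c := by
    suffices NChain.counit k T ∘ₗ NChain.map k g 0 = NChain.counit k S from
      LinearMap.congr_fun this c
    refine NChain.hom_ext fun σ => ?_
    simp [NChain.map_cls, NChain.counit]

end ChainCoalgebra

section Topology

open Simplicial Opposite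

variable {X Y : Type u} [TopologicalSpace X] [TopologicalSpace Y]

/-- The continuous map `Δⁿ → X` underlying a singular simplex. -/
def simplexMap (X : Type u) [TopologicalSpace X] {n : ℕ} (σ : (TopCat.toSSet.obj (TopCat.of X)) _⦋n⦌) :
    C(stdSimplex ℝ (Fin (n + 1)), X) :=
  TopCat.toSSetObjEquiv (TopCat.of X) (op ⦋n⦌) σ

lemma simplexMap_map {n m : ℕ} (f : ⦋n⦌ ⟶ ⦋m⦌) (σ : (TopCat.toSSet.obj (TopCat.of X)) _⦋m⦌)
    (t : stdSimplex ℝ (Fin (n + 1))) :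
    simplexMap X ((TopCat.toSSet.obj (TopCat.of X)).map f.op σ) t =
      simplexMap X σ (stdSimplex.map f.toOrderHom t) := rfl

lemma simplexMap_comp {n : ℕ} (f : C(X, Y)) (σ : (TopCat.toSSet.obj (TopCat.of X)) _⦋n⦌) :
    simplexMap Y ((TopCat.toSSet.map (TopCat.ofHom f)).app (op ⦋n⦌) σ) =
      f.comp (simplexMap X σ) := rfl

/-- `Sing⁰(X, x)`: the singular simplices all of whose vertices are at the base point. -/
def sing0 (x : X) : (TopCat.toSSet.obj (TopCat.of X)).Subcomplex where
  obj n := {σ | ∀ i, TopCat.toSSetObjEquiv (TopCat.of X) n σ (stdSimplex.vertex i) = x}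
  map {n m} f σ hσ i := by
    have := hσ (f.unop.toOrderHom i)
    rw [← stdSimplex.map_vertex] at this
    exact this

lemma mem_sing0 (x : X) {n : ℕ} (σ : (TopCat.toSSet.obj (TopCat.of X)) _⦋n⦌) :
    σ ∈ (sing0 x).obj (op ⦋n⦌) ↔ ∀ i, simplexMap X σ (stdSimplex.vertex i) = x := Iff.rfl

/-- The map `Sing⁰(X, x) → Sing⁰(Y, y)` induced by a pointed map. -/
def sing0Map (f : C(X, Y)) {x : X} {y : Y} (h : f x = y) :
    (sing0 x).toSSet ⟶ (sing0 y).toSSet :=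
  Subfunctor.lift ((sing0 x).ι ≫ TopCat.toSSet.map (TopCat.ofHom f)) (by
    rintro n _ ⟨σ, rfl⟩ i
    exact (congrArg f (σ.2 i)).trans h)

lemma sing0Map_app (f : C(X, Y)) {x : X} {y : Y} (h : f x = y) {n : ℕ}
    (σ : (sing0 x).toSSet _⦋n⦌) :
    simplexMap Y ((sing0Map f h).app (op ⦋n⦌) σ).1 = f.comp (simplexMap X σ.1) := rfl

instance (x : X) : Unique ((sing0 x).toSSet _⦋0⦌) where
  default := ⟨(TopCat.toSSetObjEquiv (TopCat.of X) (op ⦋0⦌)).symm (ContinuousMap.const _ x), by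
    intro i
    rw [Equiv.apply_symm_apply]
    rfl⟩
  uniq σ := by
    apply Subtype.ext
    apply (TopCat.toSSetObjEquiv (TopCat.of X) (op ⦋0⦌)).injective
    rw [Equiv.apply_symm_apply]
    ext t
    have ht : t = stdSimplex.vertex (S := ℝ) (0 : Fin 1) := Subsingleton.elim _ _
    rw [ht]
    exact σ.2 0

/-- The dg coalgebra `C⁰_*(X, x)` of normalized singular chains with vertices at `x`. -/
abbrev singCoalg (k : Type v) [CommRing k] (x : X) : ConnDGCoalg.{v, max u v} k :=
  chainCoalg k (sing0 x).toSSet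

/-- The morphism `C⁰_*(f) : C⁰_*(X, x) → C⁰_*(Y, y)` induced by a pointed map. -/
abbrev singCoalgMap (k : Type v) [CommRing k] (f : C(X, Y)) {x : X} {y : Y} (h : f x = y) :
    ConnDGCoalg.Hom (singCoalg k x) (singCoalg k y) :=
  chainCoalgMap k (sing0Map f h)

/-- The fundamental group, with the product `[α] [β]` the class of `α` followed by `β`
(`FundamentalGroup` has the opposite product). -/
abbrev Pi1 (X : Type u) [TopologicalSpace X] (x : X) : Type u := (FundamentalGroup X x)ᵐᵒᵖ

/-- The homomorphism of fundamental groups induced by a pointed map. -/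
def Pi1.map (f : C(X, Y)) {x : X} {y : Y} (h : f x = y) : Pi1 X x →* Pi1 Y y :=
  MonoidHom.op (FundamentalGroup.mapOfEq f h)

/-- The loop `t ↦ σ(1 - t, t)` given by a singular `1`-simplex with both vertices at `x`. -/
def edgeLoop {x : X} (σ : (sing0 x).toSSet _⦋1⦌) : Path x x where
  toFun t := simplexMap X σ.1 (stdSimplexHomeomorphUnitInterval.symm t)
  continuous_toFun := by fun_prop
  source' := by
    have : stdSimplexHomeomorphUnitInterval.symm 0 = stdSimplex.vertex (S := ℝ) (0 : Fin 2) := by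
      rw [Homeomorph.symm_apply_eq]; rfl
    rw [this]
    exact σ.2 0
  target' := by
    have : stdSimplexHomeomorphUnitInterval.symm 1 = stdSimplex.vertex (S := ℝ) (1 : Fin 2) := by
      rw [Homeomorph.symm_apply_eq]; rfl
    rw [this]
    exact σ.2 1

/-- The class in the fundamental group of a singular `1`-simplex with both vertices at `x`. -/
def edgeClass {x : X} (σ : (sing0 x).toSSet _⦋1⦌) : Pi1 X x :=
  MulOpposite.op (FundamentalGroup.fromPath (Path.Homotopic.Quotient.mk (edgeLoop σ)))

lemma edgeClass_degenerate {x : X} (σ : (sing0 x).toSSet _⦋1⦌)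
    (hσ : σ ∈ (sing0 x).toSSet.degenerate 1) : edgeClass σ = 1 := by
  obtain ⟨m, hm, f, y, rfl⟩ := hσ
  obtain rfl : m = 0 := by omega
  have : edgeLoop ((sing0 x).toSSet.map f.op y) = Path.refl x := by
    ext t
    have e : ∀ s : stdSimplex ℝ (Fin 2), stdSimplex.map f.toOrderHom s =
        stdSimplex.vertex (S := ℝ) (0 : Fin 1) :=
      fun s => Subsingleton.elim (α := stdSimplex ℝ (Fin 1)) _ _
    exact (congrArg (simplexMap X y.1) (e _)).trans (y.2 0)
  rw [edgeClass, this]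
  rfl

/-- A singular `2`-simplex is a homotopy between its edge `02` and the product of its edges
`01` and `12`. -/
lemma edgeClass_mul {x : X} (σ : (sing0 x).toSSet _⦋2⦌) :
    edgeClass ((sing0 x).toSSet.δ 2 σ) * edgeClass ((sing0 x).toSSet.δ 0 σ) =
      edgeClass ((sing0 x).toSSet.δ 1 σ) := by
  have : ContractibleSpace (stdSimplex ℝ (Fin 3)) :=
    (convex_stdSimplex ℝ (Fin 3)).contractibleSpace ⟨_, (stdSimplex.vertex (0 : Fin 3)).2⟩
  let e (i : Fin 3) : C(unitInterval, stdSimplex ℝ (Fin 3)) :=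
    (⟨stdSimplex.map (SimplexCategory.δ (n := 1) i).toOrderHom, stdSimplex.continuous_map _⟩ :
      C(stdSimplex ℝ (Fin 2), stdSimplex ℝ (Fin 3))).comp
      (stdSimplexHomeomorphUnitInterval.symm : C(unitInterval, stdSimplex ℝ (Fin 2)))
  have e0 : ∀ i, e i 0 = stdSimplex.vertex (Fin.succAbove i (0 : Fin 2)) := by
    intro i
    have : stdSimplexHomeomorphUnitInterval.symm 0 = stdSimplex.vertex (S := ℝ) (0 : Fin 2) := by
      rw [Homeomorph.symm_apply_eq]; rfl
    change stdSimplex.map _ (stdSimplexHomeomorphUnitInterval.symm 0) = _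
    rw [this, stdSimplex.map_vertex]
    rfl
  have e1 : ∀ i, e i 1 = stdSimplex.vertex (Fin.succAbove i (1 : Fin 2)) := by
    intro i
    have : stdSimplexHomeomorphUnitInterval.symm 1 = stdSimplex.vertex (S := ℝ) (1 : Fin 2) := by
      rw [Homeomorph.symm_apply_eq]; rfl
    change stdSimplex.map _ (stdSimplexHomeomorphUnitInterval.symm 1) = _
    rw [this, stdSimplex.map_vertex]
    rfl
  let p01 : Path (stdSimplex.vertex (S := ℝ) (0 : Fin 3)) (stdSimplex.vertex 1) :=
    ⟨e 2, e0 2, e1 2⟩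
  let p12 : Path (stdSimplex.vertex (S := ℝ) (1 : Fin 3)) (stdSimplex.vertex 2) :=
    ⟨e 0, e0 0, e1 0⟩
  let p02 : Path (stdSimplex.vertex (S := ℝ) (0 : Fin 3)) (stdSimplex.vertex 2) :=
    ⟨e 1, e0 1, e1 1⟩
  have h := (SimplyConnectedSpace.paths_homotopic (p01.trans p12) p02).map (simplexMap X σ.1)
  have h' := h.pathCast (σ.2 0).symm (σ.2 2).symm
  have a1 : edgeLoop ((sing0 x).toSSet.δ 1 σ) =
      (p02.map (simplexMap X σ.1).continuous).cast (σ.2 0).symm (σ.2 2).symm := by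
    ext t; rfl
  have a2 : (edgeLoop ((sing0 x).toSSet.δ 2 σ)).trans (edgeLoop ((sing0 x).toSSet.δ 0 σ)) =
      ((p01.trans p12).map (simplexMap X σ.1).continuous).cast (σ.2 0).symm (σ.2 2).symm := by
    ext t
    change _ = simplexMap X σ.1 ((p01.trans p12) t)
    rw [Path.trans_apply, Path.trans_apply]
    split_ifs <;> rfl
  rw [← a1, ← a2] at h'
  have h2 := Path.Homotopic.Quotient.eq.2 h'
  rw [Path.Homotopic.Quotient.mk_trans] at h2
  exact congrArg MulOpposite.op h2

lemma edgeClass_map (f : C(X, Y)) {x : X} {y : Y} (h : f x = y) (σ : (sing0 x).toSSet _⦋1⦌) :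
    edgeClass ((sing0Map f h).app (op ⦋1⦌) σ) = Pi1.map f h (edgeClass σ) := by
  have e : edgeLoop ((sing0Map f h).app (op ⦋1⦌) σ) =
      ((edgeLoop σ).map f.continuous).cast h.symm h.symm := by
    ext t; rfl
  refine congrArg MulOpposite.op ?_
  rw [e]
  exact (FundamentalGroup.mapOfEq_apply f h
    (FundamentalGroup.fromPath (Path.Homotopic.Quotient.mk (edgeLoop σ)))).symm

section Projection

variable (k : Type v) [CommRing k] (x : X)

/-- The values of the projection `q` on generators of degree `0`, `[σ] ↦ [σ] - e`. -/
def projGen₁ : NChain k (sing0 x).toSSet 1 →ₗ[k] MonoidAlgebra k (Pi1 X x) :=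
  NChain.lift (fun σ => MonoidAlgebra.single (edgeClass σ) 1 - 1) fun σ hσ => by
    rw [edgeClass_degenerate σ hσ, ← MonoidAlgebra.one_def, sub_self]

variable {k x}

lemma projGen₁_cls (σ : (sing0 x).toSSet _⦋1⦌) :
    projGen₁ k x (NChain.cls k σ) = MonoidAlgebra.single (edgeClass σ) 1 - 1 :=
  NChain.lift_cls _ _ _

lemma projGen₁_boundary (c : NChain k (sing0 x).toSSet 2) :
    projGen₁ k x (NChain.boundary k _ 1 c) + LinearMap.mul' k _
      (TensorProduct.map (projGen₁ k x) (projGen₁ k x) (NChain.aw k _ 2 1 1 c)) = 0 := by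
  suffices projGen₁ k x ∘ₗ NChain.boundary k _ 1 + LinearMap.mul' k _ ∘ₗ
      TensorProduct.map (projGen₁ k x) (projGen₁ k x) ∘ₗ NChain.aw k _ 2 1 1 = 0 from
    LinearMap.congr_fun this c
  refine NChain.hom_ext fun σ => ?_
  have s1 : (sing0 x).toSSet.seg 0 1 (by omega) σ = (sing0 x).toSSet.δ 2 σ := by
    have e : SimplexCategory.subinterval (n := 2) 0 1 (by omega) = SimplexCategory.δ 2 := by
      ext i : 3
      refine Fin.ext ?_
      rw [SSet.subinterval_val, SSet.δ_val]
      fin_cases i <;> rfl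
    rw [SSet.seg, e]
    rfl
  have s2 : (sing0 x).toSSet.seg 1 1 (by omega) σ = (sing0 x).toSSet.δ 0 σ := by
    have e : SimplexCategory.subinterval (n := 2) 1 1 (by omega) = SimplexCategory.δ 0 := by
      ext i : 3
      refine Fin.ext ?_
      rw [SSet.subinterval_val, SSet.δ_val]
      fin_cases i <;> rfl
    rw [SSet.seg, e]
    rfl
  have h : MonoidAlgebra.single (edgeClass ((sing0 x).toSSet.δ 2 σ)) (1 : k) *
      MonoidAlgebra.single (edgeClass ((sing0 x).toSSet.δ 0 σ)) 1 =
      MonoidAlgebra.single (edgeClass ((sing0 x).toSSet.δ 1 σ)) 1 := by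
    rw [MonoidAlgebra.single_mul_single, edgeClass_mul, mul_one]
  have hb : NChain.boundary k _ 1 (NChain.cls k σ) = NChain.cls k ((sing0 x).toSSet.δ 0 σ) -
      NChain.cls k ((sing0 x).toSSet.δ 1 σ) + NChain.cls k ((sing0 x).toSSet.δ 2 σ) := by
    rw [NChain.boundary_cls]
    refine (Fin.sum_univ_three _).trans ?_
    simp [sub_eq_add_neg]
  rw [LinearMap.add_apply, LinearMap.comp_apply, LinearMap.comp_apply, LinearMap.comp_apply, hb,
    NChain.aw_cls 2 1 1 rfl, s1, s2, map_tmul, LinearMap.mul'_apply, map_add, map_sub]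
  simp only [projGen₁_cls, LinearMap.zero_apply]
  rw [← h]
  noncomm_ring

lemma projGen₁_map (f : C(X, Y)) {y : Y} (h : f x = y) (c : NChain k (sing0 x).toSSet 1) :
    MonoidAlgebra.mapDomainAlgHom k k (Pi1.map f h) (projGen₁ k x c) =
      projGen₁ k y (NChain.map k (sing0Map f h) 1 c) := by
  suffices (MonoidAlgebra.mapDomainAlgHom k k (Pi1.map f h)).toLinearMap ∘ₗ projGen₁ k x =
    projGen₁ k y ∘ₗ NChain.map k (sing0Map f h) 1 from LinearMap.congr_fun this c
  refine NChain.hom_ext fun σ => ?_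
  rw [LinearMap.comp_apply, LinearMap.comp_apply, NChain.map_cls, projGen₁_cls, projGen₁_cls,
    edgeClass_map, AlgHom.toLinearMap_apply, map_sub, map_one]
  simp

variable (k x)

/-- The values of the projection `q` on generators: `[σ] ↦ [σ] - e` on `1`-simplices, and zero in
positive degrees. -/
def projGen (n : ℕ) : (singCoalg k x).X (n + 1) →ₗ[k] MonoidAlgebra k (Pi1 X x) :=
  match n with
  | 0 => (projGen₁ k x)
  | _ + 1 => 0

/-- The projection `q : Ω C⁰_*(X, x) → k[π₁(X, x)]`, the algebra map with `[σ] ↦ [σ] - e` for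
`1`-simplices `σ` and `[σ] ↦ 0` for simplices of higher dimension. -/
def proj : (singCoalg k x).Cobar →ₐ[k] MonoidAlgebra k (Pi1 X x) :=
  TensorAlgebra.lift k (DirectSum.toModule k ℕ _ (projGen k x))

variable {k x}

lemma proj_gen (n : ℕ) (c : (singCoalg k x).X (n + 1)) :
    proj k x ((singCoalg k x).gen (n + 1) c) = projGen k x n c := by
  simp [proj, ConnDGCoalg.gen_succ]

lemma proj_pos (n : ℕ) (z : (singCoalg k x).Cobar) (hz : z ∈ (singCoalg k x).cobarDeg (n + 1)) :
    proj k x z = 0 := by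
  refine (Submodule.span_le (p := LinearMap.ker (proj k x).toLinearMap)).2 ?_ hz
  rintro _ ⟨l, hl, rfl⟩
  rw [SetLike.mem_coe, LinearMap.mem_ker, AlgHom.toLinearMap_apply, map_list_prod]
  obtain ⟨s, hs, hs0⟩ : ∃ s ∈ l, s.1 ≠ 0 := by
    by_contra! h
    have : (l.map Sigma.fst).sum = 0 := List.sum_eq_zero (by
      simpa using fun n c hc => h ⟨n, c⟩ hc)
    omega
  refine List.prod_eq_zero ?_
  rw [List.map_map, List.mem_map]
  refine ⟨s, hs, ?_⟩
  obtain ⟨m, c⟩ := s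
  obtain ⟨m, rfl⟩ := Nat.exists_eq_succ_of_ne_zero hs0
  exact (proj_gen _ _).trans rfl

lemma proj_gen₂ (t : (singCoalg k x).X 1 ⊗[k] (singCoalg k x).X 1) :
    proj k x ((singCoalg k x).gen₂ 1 1 t) =
      LinearMap.mul' k _ (TensorProduct.map (projGen k x 0) (projGen k x 0) t) := by
  induction t using TensorProduct.induction_on with
  | zero => simp
  | tmul a b => simp [ConnDGCoalg.gen₂, proj_gen]
  | add a b ha hb => simp only [map_add, ha, hb]

lemma proj_cobarD_gen (n : ℕ) (c : (singCoalg k x).X (n + 1)) :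
    proj k x ((singCoalg k x).cobarD ((singCoalg k x).gen (n + 1) c)) = 0 := by
  obtain _ | _ | n := n
  · rw [((singCoalg k x).cobarD_gen_mem 0 c).2 rfl, map_zero]
  · rw [ConnDGCoalg.cobarD_gen, ConnDGCoalg.cobarDGen, Finset.Nat.sum_antidiagonal_succ,
      Finset.Nat.sum_antidiagonal_succ]
    simp [ConnDGCoalg.gen₂_zero_left, ConnDGCoalg.gen₂_zero_right]
    rw [proj_gen, proj_gen₂]
    rw [← neg_add]
    exact neg_eq_zero.2 (projGen₁_boundary c)
  · exact proj_pos n _ (((singCoalg k x).cobarD_gen_mem (n + 2) c).1 (n + 1) rfl)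

/-- `q` is a map of dg algebras, `k[π₁(X, x)]` having zero differential. -/
lemma proj_cobarD (z : (singCoalg k x).Cobar) :
    proj k x ((singCoalg k x).cobarD z) = 0 := by
  induction z using (singCoalg k x).cobar_induction with
  | one => rw [ConnDGCoalg.cobarD_one, map_zero]
  | gen_mul n c z ih =>
    rw [ConnDGCoalg.cobarD_mul, map_add, map_mul, map_mul, proj_cobarD_gen, ih, zero_mul, mul_zero,
      add_zero]
  | add a b ha hb => rw [map_add, map_add, ha, hb, add_zero]
  | smul r a ha => rw [map_smul, map_smul, ha, smul_zero]

lemma proj_naturality (f : C(X, Y)) {x : X} {y : Y} (h : f x = y) (z : (singCoalg k x).Cobar) :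
    MonoidAlgebra.mapDomainAlgHom k k (Pi1.map f h) (proj k x z) =
      proj k y ((singCoalgMap k f h).cobarMap z) := by
  induction z using (singCoalg k x).cobar_induction with
  | one => simp
  | gen_mul n c z ih =>
    rw [map_mul, map_mul, map_mul, map_mul, ih, ConnDGCoalg.Hom.cobarMap_gen, proj_gen, proj_gen]
    congr 1
    obtain _ | n := n
    · exact projGen₁_map f h c
    · simp [projGen]
  | add a b ha hb => simp only [map_add, ha, hb]
  | smul r a ha => simp only [map_smul, ha]

end Projection

section LocalCoefficients

variable {k : Type v} [CommRing k] {M : Type w} [AddCommGroup M] [Module k M]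

/-- A left `k[π₁(X, x)]`-module `M`, given by its structure map `A : k[π₁(X, x)] → End_k M`, as a
dg module over `Ω C⁰_*(X, x)` concentrated in degree `0`, via the projection `q`. -/
def localAction {x : X} (A : MonoidAlgebra k (Pi1 X x) →ₐ[k] Module.End k M) :
    (singCoalg k x).DegZeroAction M where
  act := A.comp (proj k x)
  act_pos n z hz := by rw [AlgHom.comp_apply, proj_pos n z hz, map_zero]
  act_D z := by rw [AlgHom.comp_apply, proj_cobarD, map_zero]

/-- The chains `C_*(X; M) = C⁰_*(X, x) ⊗_τ M` with local coefficients in the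
`k[π₁(X, x)]`-module `M` with structure map `A`. -/
def localChains {x : X} (A : MonoidAlgebra k (Pi1 X x) →ₐ[k] Module.End k M) :
    ChainComplex (ModuleCat.{max u v w} k) ℕ :=
  (localAction A).twistedTensor

/-- The restriction of a `k[π₁(Y, y)]`-module structure to `k[π₁(X, x)]` along `π₁(f)`. -/
def restrictAction (f : C(X, Y)) {x : X} {y : Y} (h : f x = y)
    (A : MonoidAlgebra k (Pi1 Y y) →ₐ[k] Module.End k M) :
    MonoidAlgebra k (Pi1 X x) →ₐ[k] Module.End k M :=
  A.comp (MonoidAlgebra.mapDomainAlgHom k k (Pi1.map f h))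

/-- The chain map `C_*(f) : C_*(X; M) → C_*(Y; M)`, `C⁰_*(f) ⊗ id`, for a
`k[π₁(Y, y)]`-module `M`, regarded as a `k[π₁(X, x)]`-module along `π₁(f)`. -/
def localChainsMap (f : C(X, Y)) {x : X} {y : Y} (h : f x = y)
    (A : MonoidAlgebra k (Pi1 Y y) →ₐ[k] Module.End k M) :
    localChains (restrictAction f h A) ⟶ localChains A :=
  (singCoalgMap k f h).twistedMap (localAction (restrictAction f h A)) (localAction A)
    (fun z => congrArg A (proj_naturality f h z))

end LocalCoefficients

end Topology

end

noncomputable section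

section QuasiIsomorphisms

variable {k : Type*} [CommRing k] {X Y Z : Type*} [AddCommGroup X] [AddCommGroup Y]
  [AddCommGroup Z] [Module k X] [Module k Y] [Module k Z]

/-- For maps `f` of differential modules, this is acyclicity of the mapping cone: `f` is
bijective on homology. -/
def IsQis (dX : X →ₗ[k] X) (dY : Y →ₗ[k] Y) (f : X →ₗ[k] Y) : Prop :=
  ∀ x y, dX x = 0 → f x = dY y → ∃ x' y', dX x' = x ∧ f x' - dY y' = y

lemma IsQis.comp {dX : X →ₗ[k] X} {dY : Y →ₗ[k] Y} {dZ : Z →ₗ[k] Z} {f : X →ₗ[k] Y}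
    {g : Y →ₗ[k] Z} (hf : IsQis dX dY f) (hg : IsQis dY dZ g)
    (hfd : ∀ x, f (dX x) = dY (f x)) (hgd : ∀ y, g (dY y) = dZ (g y)) :
    IsQis dX dZ (g ∘ₗ f) := by
  intro x z hx hz
  obtain ⟨y, z₁, h1, h2⟩ := hg (f x) z (by rw [← hfd, hx, map_zero]) hz
  obtain ⟨x₁, y₁, h3, h4⟩ := hf x y hx h1.symm
  refine ⟨x₁, g y₁ + z₁, h3, ?_⟩
  rw [LinearMap.comp_apply, eq_add_of_sub_eq h4, ← h2, map_add, map_add, hgd]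
  abel

lemma IsQis.of_comp {dX : X →ₗ[k] X} {dY : Y →ₗ[k] Y} {dZ : Z →ₗ[k] Z} {f : X →ₗ[k] Y}
    {g : Y →ₗ[k] Z} (hf : IsQis dX dY f) (hgf : IsQis dX dZ (g ∘ₗ f))
    (hfd : ∀ x, f (dX x) = dY (f x)) (hgd : ∀ y, g (dY y) = dZ (g y)) :
    IsQis dY dZ g := by
  intro y z hy hz
  obtain ⟨x, y₀, h1, h2⟩ := hf 0 y (map_zero _) (by rw [map_zero, hy])
  have h3 : g (f x) = dZ (z + g y₀) := by
    rw [eq_add_of_sub_eq h2, map_add, hz, hgd, map_add]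
  obtain ⟨x₁, z₁, h4, h5⟩ := hgf x (z + g y₀) h1 h3
  refine ⟨f x₁ - y₀, z₁, ?_, ?_⟩
  · rw [map_sub, ← hfd, h4, ← h2]
  · rw [LinearMap.comp_apply] at h5
    rw [map_sub, sub_right_comm, h5, add_sub_cancel_right]

lemma IsQis.lTensor (V : Type*) [AddCommGroup V] [Module k V] [Module.Flat k V]
    {dX : X →ₗ[k] X} {dY : Y →ₗ[k] Y} {f : X →ₗ[k] Y} (hf : IsQis dX dY f)
    (hX : ∀ x, dX (dX x) = 0) (hY : ∀ y, dY (dY y) = 0) (hfd : ∀ x, f (dX x) = dY (f x)) :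
    IsQis (dX.lTensor V) (dY.lTensor V) (f.lTensor V) := by
  let c : X × Y →ₗ[k] X × Y :=
    (dX ∘ₗ LinearMap.fst k X Y).prod (f ∘ₗ LinearMap.fst k X Y - dY ∘ₗ LinearMap.snd k X Y)
  have hc : Function.Exact c c := by
    rintro ⟨x, y⟩
    constructor
    · intro h
      obtain ⟨h1, h2⟩ := Prod.ext_iff.1 h
      obtain ⟨x', y', h3, h4⟩ := hf x y h1 (sub_eq_zero.1 h2)
      exact ⟨(x', y'), Prod.ext h3 h4⟩
    · rintro ⟨⟨x', y'⟩, h⟩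
      rw [← h]
      refine Prod.ext (hX _) ?_
      simp [c, hfd, hY]
  have hV := Module.Flat.lTensor_exact V hc
  let P := TensorProduct.prodRight k k V X Y
  have hP : ∀ t, P (c.lTensor V t) =
      (dX.lTensor V (P t).1, f.lTensor V (P t).1 - dY.lTensor V (P t).2) := by
    intro t
    induction t using TensorProduct.induction_on with
    | zero => simp only [map_zero, Prod.fst_zero, Prod.snd_zero, sub_zero, Prod.mk_zero_zero]
    | tmul v xy => simp [P, c, tmul_sub]
    | add a b ha hb =>
      rw [map_add, map_add, ha, hb]
      simp only [map_add, Prod.fst_add, Prod.snd_add, Prod.mk_add_mk]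
      congr 1
      abel
  intro x y hx hy
  have h0 : c.lTensor V (P.symm (x, y)) = 0 := by
    apply P.injective
    rw [hP, P.apply_symm_apply, map_zero]
    simp [hx, hy]
  obtain ⟨t, ht⟩ := (hV _).1 h0
  have h1 := hP t
  rw [ht, P.apply_symm_apply] at h1
  obtain ⟨h2, h3⟩ := Prod.ext_iff.1 h1
  exact ⟨_, _, h2.symm, h3.symm⟩

end QuasiIsomorphisms

section SemifreeModules

variable {k : Type*} [CommRing k]

/-- A dg algebra, with its `ℤ/2`-grading given by the projector `e` onto the even part. -/
structure DGAlg (k : Type*) [CommRing k] (A : Type*) [Ring A] [Algebra k A] where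
  D : A →ₗ[k] A
  e : A →ₗ[k] A
  D_D : ∀ a, D (D a) = 0
  e_one : e 1 = 1
  e_e : ∀ a, e (e a) = e a
  e_D : ∀ a, e (D a) = D (a - e a)
  e_mul : ∀ a b, e (a * b) = e a * e b + (a - e a) * (b - e b)
  D_mul : ∀ a b, D (a * b) = D a * b + (e a + e a - a) * D b

/-- The sign involution with even part given by the projector `e`. -/
def signOf {Z : Type*} [AddCommGroup Z] [Module k Z] (e : Z →ₗ[k] Z) : Z →ₗ[k] Z :=
  e + e - LinearMap.id

/-- The projector on the even part of a tensor product. -/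
def tensorEven {Y Z : Type*} [AddCommGroup Y] [Module k Y] [AddCommGroup Z] [Module k Z]
    (e : Y →ₗ[k] Y) (e' : Z →ₗ[k] Z) : Y ⊗[k] Z →ₗ[k] Y ⊗[k] Z :=
  TensorProduct.map e e' + TensorProduct.map (LinearMap.id - e) (LinearMap.id - e')

lemma tensorEven_tmul {Y Z : Type*} [AddCommGroup Y] [Module k Y] [AddCommGroup Z] [Module k Z]
    (e : Y →ₗ[k] Y) (e' : Z →ₗ[k] Z) (y : Y) (z : Z) :
    tensorEven e e' (y ⊗ₜ z) = e y ⊗ₜ e' z + (y - e y) ⊗ₜ (z - e' z) := by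
  simp [tensorEven]

lemma signOf_apply {Z : Type*} [AddCommGroup Z] [Module k Z] (e : Z →ₗ[k] Z) (z : Z) :
    signOf e z = e z + e z - z := rfl

lemma map_signOf {Y Z : Type*} [AddCommGroup Y] [Module k Y] [AddCommGroup Z] [Module k Z]
    (e : Y →ₗ[k] Y) (e' : Z →ₗ[k] Z) :
    TensorProduct.map (signOf e) (signOf e') = signOf (tensorEven e e') := by
  ext y z
  simp [signOf_apply, tensorEven_tmul, add_tmul, tmul_add, sub_tmul, tmul_sub]
  abel

variable {A : Type*} [Ring A] [Algebra k A]

/-- Left dg modules over a dg algebra. -/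
structure DGAlg.Mod (R : DGAlg k A) (B : Type*) [AddCommGroup B] [Module k B] where
  act : A →ₐ[k] Module.End k B
  d : B →ₗ[k] B
  d_d : ∀ b, d (d b) = 0
  d_act : ∀ a b, d (act a b) = act (R.D a) b + act (signOf R.e a) (d b)

lemma DGAlg.D_one (R : DGAlg k A) : R.D 1 = 0 := by
  have := R.D_mul 1 1
  simpa [R.e_one] using this

/-- The regular module. -/
def DGAlg.self (R : DGAlg k A) : R.Mod A where
  act := Algebra.lmul k A
  d := R.D
  d_d := R.D_D
  d_act := R.D_mul

namespace DGAlg.Mod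

variable {R : DGAlg k A} {B : Type*} [AddCommGroup B] [Module k B] (ρ : R.Mod B)
  {Y Z : Type*} [AddCommGroup Y] [Module k Y] [AddCommGroup Z] [Module k Z]

/-- The map `Z ⊗ A → Z ⊗ B`, `z ⊗ a ↦ z ⊗ a b`. -/
def dot (Z : Type*) [AddCommGroup Z] [Module k Z] (b : B) : Z ⊗[k] A →ₗ[k] Z ⊗[k] B :=
  (ρ.act.toLinearMap.flip b).lTensor Z

@[simp]
lemma dot_tmul (z : Z) (a : A) (b : B) : ρ.dot Z b (z ⊗ₜ a) = z ⊗ₜ ρ.act a b := rfl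

lemma dot_add (b b' : B) (x : Z ⊗[k] A) : ρ.dot Z (b + b') x = ρ.dot Z b x + ρ.dot Z b' x := by
  simp [dot, LinearMap.lTensor_add]

lemma dot_smul (r : k) (b : B) (x : Z ⊗[k] A) : ρ.dot Z (r • b) x = r • ρ.dot Z b x := by
  simp [dot, LinearMap.lTensor_smul]

lemma dot_sub (b b' : B) (x : Z ⊗[k] A) : ρ.dot Z (b - b') x = ρ.dot Z b x - ρ.dot Z b' x := by
  simp [dot, LinearMap.lTensor_sub]

lemma dot_act (a : A) (b : B) (x : Z ⊗[k] A) :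
    ρ.dot Z (ρ.act a b) x = ρ.dot Z b (R.self.dot Z a x) := by
  induction x using TensorProduct.induction_on with
  | zero => simp
  | tmul z c => simp [DGAlg.self]
  | add x y hx hy => simp only [map_add, hx, hy]

lemma dot_one (x : Z ⊗[k] A) : R.self.dot Z 1 x = x := by
  induction x using TensorProduct.induction_on with
  | zero => simp
  | tmul z c => simp [DGAlg.self]
  | add x y hx hy => simp only [map_add, hx, hy]

/-- The map `Y ⊗ B → Z ⊗ B`, `y ⊗ b ↦ g(y) b`, that comes from the extension of
`g : Y → Z ⊗ A` to an `A`-linear map `Y ⊗ A → Z ⊗ A`. -/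
def ext (g : Y →ₗ[k] Z ⊗[k] A) : Y ⊗[k] B →ₗ[k] Z ⊗[k] B :=
  TensorProduct.lift (LinearMap.mk₂ k (fun y b => ρ.dot Z b (g y)) (by simp) (by simp)
    (by simp [dot_add]) (by simp [dot_smul]))

@[simp]
lemma ext_tmul (g : Y →ₗ[k] Z ⊗[k] A) (y : Y) (b : B) :
    ρ.ext g (y ⊗ₜ b) = ρ.dot Z b (g y) := by
  simp [ext]

lemma ext_dot (g : Y →ₗ[k] Z ⊗[k] A) (b : B) (x : Y ⊗[k] A) :
    ρ.ext g (ρ.dot Y b x) = ρ.dot Z b (R.self.ext g x) := by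
  induction x using TensorProduct.induction_on with
  | zero => simp
  | tmul y c => simp [dot_act]
  | add x y hx hy => simp only [map_add, hx, hy]

lemma rTensor_dot (f : Y →ₗ[k] Z) (b : B) (x : Y ⊗[k] A) :
    f.rTensor B (ρ.dot Y b x) = ρ.dot Z b (f.rTensor A x) := by
  induction x using TensorProduct.induction_on with
  | zero => simp
  | tmul y c => simp
  | add x y hx hy => simp only [map_add, hx, hy]

lemma tensorEven_dot (e : Z →ₗ[k] Z) (a : A) (x : Z ⊗[k] A) :
    tensorEven e R.e (R.self.dot Z a x) = R.self.dot Z (R.e a) (tensorEven e R.e x) +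
      R.self.dot Z (a - R.e a) (x - tensorEven e R.e x) := by
  induction x using TensorProduct.induction_on with
  | zero => simp
  | tmul z c =>
    simp [DGAlg.self, tensorEven_tmul, R.e_mul, tmul_sub, sub_tmul, tmul_add, mul_sub, sub_mul]
    abel
  | add x y hx hy =>
    simp only [map_add, hx, hy, add_sub_add_comm]
    abel

/-- The `A`-linear extension of an odd map is odd. -/
lemma tensorEven_ext (e : Z →ₗ[k] Z) (g : Z →ₗ[k] Z ⊗[k] A)
    (hg : ∀ z, tensorEven e R.e (g z) = g (z - e z)) (x : Z ⊗[k] A) :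
    tensorEven e R.e (R.self.ext g x) = R.self.ext g (x - tensorEven e R.e x) := by
  induction x using TensorProduct.induction_on with
  | zero => simp
  | tmul z a =>
    rw [ext_tmul, tensorEven_dot, hg, tensorEven_tmul]
    simp only [map_sub, map_add, ext_tmul, dot_sub]
    abel
  | add x y hx hy =>
    simp only [map_add, hx, hy, add_sub_add_comm]

end DGAlg.Mod

/-- The differential of `Z ⊗ B` given by `z ⊗ b ↦ δ(z) b ± z ⊗ d b`. -/
def DGAlg.Mod.twD {R : DGAlg k A} {B : Type*} [AddCommGroup B] [Module k B] (ρ : R.Mod B)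
    {Z : Type*} [AddCommGroup Z] [Module k Z] (e : Z →ₗ[k] Z) (δ : Z →ₗ[k] Z ⊗[k] A) :
    Z ⊗[k] B →ₗ[k] Z ⊗[k] B :=
  ρ.ext δ + TensorProduct.map (signOf e) ρ.d

namespace DGAlg.Mod

variable {R : DGAlg k A} {B : Type*} [AddCommGroup B] [Module k B] (ρ : R.Mod B)
  {Z : Type*} [AddCommGroup Z] [Module k Z] (e : Z →ₗ[k] Z) (δ : Z →ₗ[k] Z ⊗[k] A)

lemma twD_tmul (z : Z) (b : B) :
    ρ.twD e δ (z ⊗ₜ b) = ρ.dot Z b (δ z) + signOf e z ⊗ₜ ρ.d b := by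
  simp [twD]

lemma twD_dot (b : B) (x : Z ⊗[k] A) :
    ρ.twD e δ (ρ.dot Z b x) = ρ.dot Z b (R.self.twD e δ x) +
      ρ.dot Z (ρ.d b) (signOf (tensorEven e R.e) x) := by
  rw [← map_signOf]
  induction x using TensorProduct.induction_on with
  | zero => simp
  | tmul z a =>
    simp only [dot_tmul, twD_tmul, ρ.d_act, map_add, map_tmul, dot_act, tmul_add]
    rw [add_assoc]
    rfl
  | add x y hx hy =>
    simp only [map_add, hx, hy]
    abel

end DGAlg.Mod

end SemifreeModules

end

noncomputable section

section SemifreeModules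

variable {k : Type*} [CommRing k]

/-- A grading of `Z` by the natural numbers, given by the projectors `q i` on the homogeneous
components; `e` is the projector on the even part. -/
structure ProjGrading (k : Type*) [CommRing k] (Z : Type*) [AddCommGroup Z] [Module k Z] where
  q : ℕ → Z →ₗ[k] Z
  e : Z →ₗ[k] Z
  q_self : ∀ i z, q i (q i z) = q i z
  q_ne : ∀ i j z, i ≠ j → q i (q j z) = 0
  e_q : ∀ i z, e (q i z) = if Even i then q i z else 0
  exists_sum : ∀ z, ∃ n, z = ∑ i ∈ Finset.range n, q i z

namespace ProjGrading

variable {Z : Type*} [AddCommGroup Z] [Module k Z] (G : ProjGrading k Z)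

lemma q_e (i : ℕ) (z : Z) : G.q i (G.e z) = if Even i then G.q i z else 0 := by
  obtain ⟨n, hn⟩ := G.exists_sum z
  have h : ∀ j, G.q i (G.e (G.q j z)) = if Even i then G.q i (G.q j z) else 0 := by
    intro j
    rw [G.e_q]
    by_cases hij : i = j
    · subst hij
      split_ifs <;> simp
    · split_ifs <;> simp [G.q_ne i j z hij]
  rw [hn]
  simp only [map_sum, h]
  split_ifs <;> simp

lemma e_e (z : Z) : G.e (G.e z) = G.e z := by
  obtain ⟨n, hn⟩ := G.exists_sum (G.e z)
  rw [hn, map_sum]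
  refine Finset.sum_congr rfl fun i _ => ?_
  rw [G.e_q, G.q_e]
  split_ifs <;> rfl

variable {B : Type*} [AddCommGroup B] [Module k B]

lemma rTensor_self (i : ℕ) (x : Z ⊗[k] B) :
    (G.q i).rTensor B ((G.q i).rTensor B x) = (G.q i).rTensor B x := by
  rw [← LinearMap.rTensor_comp_apply]
  congr 2
  ext z
  exact G.q_self i z

lemma rTensor_ne (i j : ℕ) (h : i ≠ j) (x : Z ⊗[k] B) :
    (G.q i).rTensor B ((G.q j).rTensor B x) = 0 := by
  rw [← LinearMap.rTensor_comp_apply, show G.q i ∘ₗ G.q j = 0 from LinearMap.ext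
    fun z => G.q_ne i j z h]
  simp

lemma exists_forall_q_eq_zero (z : Z) : ∃ n, ∀ i ≥ n, G.q i z = 0 := by
  obtain ⟨n, hn⟩ := G.exists_sum z
  refine ⟨n, fun i hi => ?_⟩
  rw [hn, map_sum]
  refine Finset.sum_eq_zero fun j hj => G.q_ne i j z ?_
  rw [Finset.mem_range] at hj
  omega

lemma exists_forall_rTensor_eq_zero (x : Z ⊗[k] B) : ∃ n, ∀ i ≥ n, (G.q i).rTensor B x = 0 := by
  induction x using TensorProduct.induction_on with
  | zero => exact ⟨0, by simp⟩
  | tmul z b =>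
    obtain ⟨n, hn⟩ := G.exists_forall_q_eq_zero z
    exact ⟨n, fun i hi => by rw [LinearMap.rTensor_tmul, hn i hi, zero_tmul]⟩
  | add x y hx hy =>
    obtain ⟨n, hn⟩ := hx
    obtain ⟨m, hm⟩ := hy
    refine ⟨max n m, fun i hi => ?_⟩
    rw [map_add, hn i (le_of_max_le_left hi), hm i (le_of_max_le_right hi), add_zero]

lemma eq_sum (z : Z) (n : ℕ) (h : ∀ i ≥ n, G.q i z = 0) : z = ∑ i ∈ Finset.range n, G.q i z := by
  obtain ⟨m, hm⟩ := G.exists_sum z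
  have h1 : ∀ i ≥ m, G.q i z = 0 := by
    intro i hi
    rw [hm, map_sum]
    refine Finset.sum_eq_zero fun j hj => G.q_ne i j z ?_
    rw [Finset.mem_range] at hj
    omega
  rw [Finset.sum_subset (Finset.range_mono (le_max_right m n))
      (fun i _ hi => h i (by simpa using hi)),
    ← Finset.sum_subset (Finset.range_mono (le_max_left m n))
      (fun i _ hi => h1 i (by simpa using hi))]
  exact hm

lemma eq_sum_rTensor (x : Z ⊗[k] B) (n : ℕ) (h : ∀ i ≥ n, (G.q i).rTensor B x = 0) :
    x = ∑ i ∈ Finset.range n, (G.q i).rTensor B x := by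
  have h1 : ∀ x : Z ⊗[k] B, ∃ n, ∀ m ≥ n, x = ∑ i ∈ Finset.range m, (G.q i).rTensor B x := by
    intro x
    induction x using TensorProduct.induction_on with
    | zero => exact ⟨0, by simp⟩
    | tmul z b =>
      obtain ⟨n, hn⟩ := G.exists_forall_q_eq_zero z
      refine ⟨n, fun m hm => ?_⟩
      simp only [LinearMap.rTensor_tmul]
      rw [← sum_tmul, ← G.eq_sum z m fun i hi => hn i (hm.trans hi)]
    | add x y hx hy =>
      obtain ⟨n, hn⟩ := hx
      obtain ⟨m, hm⟩ := hy
      refine ⟨max n m, fun i hi => ?_⟩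
      simp only [map_add, Finset.sum_add_distrib]
      rw [← hn i (le_of_max_le_left hi), ← hm i (le_of_max_le_right hi)]
  obtain ⟨m, hm⟩ := h1 x
  have h2 := hm (max m n) (le_max_left m n)
  rw [← Finset.sum_subset (Finset.range_mono (le_max_right m n))] at h2
  · exact h2
  · exact fun i _ hi => h i (by simpa using hi)

end ProjGrading

variable {A : Type*} [Ring A] [Algebra k A]

/-- A twisted differential on `Z ⊗ A` for a graded module `Z`, given by the values
`δ z = d (z ⊗ 1)`; the differential lowers the filtration by degree in `Z` (up to the
differential of `A`). -/
structure DGAlg.Twisted (R : DGAlg k A) (Z : Type*) [AddCommGroup Z] [Module k Z] extends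
    ProjGrading k Z where
  δ : Z →ₗ[k] Z ⊗[k] A
  δ_e : ∀ z, tensorEven e R.e (δ z) = δ (z - e z)
  δ_lower : ∀ i j z, i ≤ j → (q j).rTensor A (δ (q i z)) = 0
  mc : ∀ z, R.self.twD e δ (δ z) = 0

namespace DGAlg.Twisted

variable {R : DGAlg k A} {Z : Type*} [AddCommGroup Z] [Module k Z] (T : R.Twisted Z)
  {B B' : Type*} [AddCommGroup B] [Module k B] [AddCommGroup B'] [Module k B'] (ρ : R.Mod B)
  (ρ' : R.Mod B')

/-- The differential of `Z ⊗ B`. -/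
abbrev d (ρ : R.Mod B) : Z ⊗[k] B →ₗ[k] Z ⊗[k] B := ρ.twD T.e T.δ

lemma signOf_odd {g : Z →ₗ[k] Z ⊗[k] A} (hg : ∀ z, tensorEven T.e R.e (g z) = g (z - T.e z))
    (z : Z) : signOf (tensorEven T.e R.e) (g z) = -g (signOf T.e z) := by
  simp only [signOf_apply, hg, map_sub, map_add]
  abel

lemma d_d (x : Z ⊗[k] B) : T.d ρ (T.d ρ x) = 0 := by
  induction x using TensorProduct.induction_on with
  | zero => simp
  | tmul z b =>
    rw [d, ρ.twD_tmul, map_add, ρ.twD_dot, T.mc, ρ.twD_tmul, ρ.d_d, T.signOf_odd T.δ_e]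
    simp
  | add x y hx hy => rw [map_add, map_add, hx, hy, add_zero]

lemma d_tmul_one (z : Z) : T.d R.self (z ⊗ₜ 1) = T.δ z := by
  rw [d, R.self.twD_tmul, DGAlg.Mod.dot_one]
  simp [DGAlg.self, R.D_one]

lemma tensorEven_d (x : Z ⊗[k] A) :
    tensorEven T.e R.e (T.d R.self x) = T.d R.self (x - tensorEven T.e R.e x) := by
  have h : ∀ x : Z ⊗[k] A, tensorEven T.e R.e (TensorProduct.map (signOf T.e) R.D x) =
      TensorProduct.map (signOf T.e) R.D (x - tensorEven T.e R.e x) := by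
    intro x
    induction x using TensorProduct.induction_on with
    | zero => simp
    | tmul z a =>
      simp [tensorEven_tmul, R.e_D, signOf_apply, tmul_sub, sub_tmul, add_tmul, T.e_e]
      abel
    | add x y hx hy => simp only [map_add, hx, hy, add_sub_add_comm]
  rw [d, DGAlg.Mod.twD, LinearMap.add_apply, map_add, DGAlg.Mod.tensorEven_ext _ _ T.δ_e,
    LinearMap.add_apply]
  congr 1
  exact h x

lemma tensorEven_tensorEven (x : Z ⊗[k] A) :
    tensorEven T.e R.e (tensorEven T.e R.e x) = tensorEven T.e R.e x := by
  induction x using TensorProduct.induction_on with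
  | zero => simp
  | tmul z a => simp [tensorEven_tmul, R.e_e, T.e_e]
  | add x y hx hy => simp only [map_add, hx, hy]

lemma rTensor_ext_δ_rTensor (i j : ℕ) (h : i ≤ j) (x : Z ⊗[k] B) :
    (T.q j).rTensor B (ρ.ext T.δ ((T.q i).rTensor B x)) = 0 := by
  induction x using TensorProduct.induction_on with
  | zero => simp
  | tmul z b => simp [DGAlg.Mod.rTensor_dot, T.δ_lower i j z h]
  | add x y hx hy => simp only [map_add, hx, hy, add_zero]

lemma rTensor_ext_δ (n : ℕ) (x : Z ⊗[k] B) (hx : ∀ i ≥ n + 1, (T.q i).rTensor B x = 0) (j : ℕ)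
    (hj : n ≤ j) : (T.q j).rTensor B (ρ.ext T.δ x) = 0 := by
  rw [T.eq_sum_rTensor x (n + 1) hx, map_sum, map_sum]
  refine Finset.sum_eq_zero fun i hi => T.rTensor_ext_δ_rTensor ρ i j ?_ x
  rw [Finset.mem_range] at hi
  omega

lemma rTensor_δ (n : ℕ) (z : Z) (hz : ∀ i ≥ n + 1, T.q i z = 0) (j : ℕ)
    (hj : n ≤ j) : (T.q j).rTensor A (T.δ z) = 0 := by
  rw [T.eq_sum z (n + 1) hz, map_sum, map_sum]
  refine Finset.sum_eq_zero fun i hi => T.δ_lower i j z ?_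
  rw [Finset.mem_range] at hi
  omega

lemma homotopy_apply (n : ℕ) (h : Z →ₗ[k] Z ⊗[k] A)
    (h_odd : ∀ z, tensorEven T.e R.e (h z) = h (z - T.e z))
    (hn : ∀ z, (∀ i ≥ n, T.q i z = 0) → T.d R.self (h z) + R.self.ext h (T.δ z) = z ⊗ₜ 1)
    (x : Z ⊗[k] B) (hx : ∀ i ≥ n, (T.q i).rTensor B x = 0) :
    T.d ρ (ρ.ext h x) + ρ.ext h (T.d ρ x) = x := by
  have key : ∀ i < n, ∀ x : Z ⊗[k] B, T.d ρ (ρ.ext h ((T.q i).rTensor B x)) +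
      ρ.ext h (T.d ρ ((T.q i).rTensor B x)) = (T.q i).rTensor B x := by
    intro i hi x
    induction x using TensorProduct.induction_on with
    | zero => simp
    | tmul z b =>
      have h1 := hn (T.q i z) (fun j hj => T.q_ne j i z (by omega))
      rw [LinearMap.rTensor_tmul, d, ρ.ext_tmul, ρ.twD_dot, ρ.twD_tmul, map_add, ρ.ext_dot,
        ρ.ext_tmul, T.signOf_odd h_odd, eq_sub_of_add_eq h1, map_sub,
        map_neg, DGAlg.Mod.dot_tmul, map_one, Module.End.one_apply]
      abel
    | add x y hx hy =>
      simp only [map_add]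
      rw [add_add_add_comm, hx, hy]
  conv_rhs => rw [T.eq_sum_rTensor x n hx]
  rw [T.eq_sum_rTensor x n hx, map_sum, map_sum, map_sum, map_sum, ← Finset.sum_add_distrib]
  refine Finset.sum_congr rfl fun i hi => ?_
  rw [← T.eq_sum_rTensor x n hx]
  exact key i (Finset.mem_range.1 hi) x

/-- An acyclic semifree dg module has a contracting homotopy on each step of the filtration. -/
lemma exists_homotopy [Module.Projective k Z]
    (hT : ∀ x, T.d R.self x = 0 → ∃ y, T.d R.self y = x) (n : ℕ) :
    ∃ h : Z →ₗ[k] Z ⊗[k] A, (∀ z, tensorEven T.e R.e (h z) = h (z - T.e z)) ∧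
      ∀ z, (∀ i ≥ n, T.q i z = 0) → T.d R.self (h z) + R.self.ext h (T.δ z) = z ⊗ₜ 1 := by
  induction n with
  | zero =>
    refine ⟨0, by simp, fun z hz => ?_⟩
    obtain rfl : z = 0 := by simpa using T.eq_sum z 0 hz
    simp
  | succ n ih =>
    obtain ⟨h, h_odd, hn⟩ := ih
    let c : Z →ₗ[k] Z ⊗[k] A := (TensorProduct.mk k Z A).flip 1 - R.self.ext h ∘ₗ T.δ
    have hc : ∀ z, c z = z ⊗ₜ 1 - R.self.ext h (T.δ z) := fun z => rfl
    have hqq : ∀ z, ∀ i ≥ n + 1, T.q i (T.q n z) = 0 := fun z i hi => T.q_ne i n z (by omega)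
    have hdc : ∀ z, T.d R.self (c (T.q n z)) = 0 := by
      intro z
      have h1 := T.homotopy_apply R.self n h h_odd hn (T.δ (T.q n z))
        (T.rTensor_δ n _ (hqq z))
      rw [show T.d R.self (T.δ (T.q n z)) = 0 from T.mc _, map_zero, add_zero] at h1
      rw [hc, map_sub, T.d_tmul_one, h1, sub_self]
    have hec : ∀ z, tensorEven T.e R.e (c z) = c (T.e z) := by
      intro z
      rw [hc, hc, map_sub, tensorEven_tmul, R.e_one, sub_self, tmul_zero, add_zero,
        DGAlg.Mod.tensorEven_ext _ _ h_odd, T.δ_e, map_sub, map_sub, map_sub,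
        sub_sub_cancel]
    obtain ⟨w, hw⟩ := Module.projective_lifting_property (T.d R.self).rangeRestrict
      ((c ∘ₗ T.q n).codRestrict (LinearMap.range (T.d R.self)) fun z => hT _ (hdc z))
      (T.d R.self).surjective_rangeRestrict
    have hw' : ∀ z, T.d R.self (w z) = c (T.q n z) :=
      fun z => congrArg Subtype.val (LinearMap.congr_fun hw z)
    let E := tensorEven T.e R.e
    have hdE : ∀ x, T.d R.self (E x) = T.d R.self x - E (T.d R.self x) := by
      intro x
      have := T.tensorEven_d x
      rw [map_sub] at this
      rw [show E (T.d R.self x) = _ from this]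
      abel
    have hEE : ∀ x, E (E x) = E x := T.tensorEven_tensorEven
    let w₁ : Z →ₗ[k] Z ⊗[k] A := if Even n then w - E ∘ₗ w else E ∘ₗ w
    have hw₁ : ∀ z, T.d R.self (w₁ (T.q n z)) = c (T.q n z) := by
      intro z
      have h2 := hec (T.q n z)
      rw [T.e_q] at h2
      by_cases hn : Even n
      · simp only [w₁, if_pos hn, LinearMap.sub_apply, LinearMap.comp_apply, map_sub]
        rw [if_pos hn] at h2
        rw [hdE, hw', T.q_self, sub_sub_cancel]
        exact h2
      · simp only [w₁, if_neg hn, LinearMap.comp_apply]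
        rw [if_neg hn, map_zero] at h2
        rw [hdE, hw', T.q_self]
        exact (congrArg _ h2).trans (sub_zero _)
    have hw₂ : ∀ z, E (w₁ (T.q n z)) = w₁ (T.q n (z - T.e z)) := by
      intro z
      rw [map_sub, T.q_e]
      by_cases hn : Even n
      · simp [w₁, if_pos hn, hEE]
      · simp [w₁, if_neg hn, hEE]
    have hext : ∀ x : Z ⊗[k] A, (T.q n).rTensor A x = 0 →
        R.self.ext (h - h ∘ₗ T.q n + w₁ ∘ₗ T.q n) x = R.self.ext h x := by
      intro x hx
      have e1 : ∀ x : Z ⊗[k] A, R.self.ext (h - h ∘ₗ T.q n + w₁ ∘ₗ T.q n) x = R.self.ext h x -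
          R.self.ext h ((T.q n).rTensor A x) + R.self.ext w₁ ((T.q n).rTensor A x) := by
        intro x
        induction x using TensorProduct.induction_on with
        | zero => simp
        | tmul z a => simp
        | add x y hx hy =>
          simp only [map_add, hx, hy]
          abel
      rw [e1, hx]
      simp
    refine ⟨h - h ∘ₗ T.q n + w₁ ∘ₗ T.q n, fun z => ?_, fun z hz => ?_⟩
    · have e2 : T.e (T.q n z) = T.q n (T.e z) := by rw [T.e_q, T.q_e]
      have e3 := hw₂ z
      simp only [LinearMap.add_apply, LinearMap.sub_apply, LinearMap.comp_apply, map_add,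
        map_sub, h_odd] at e3 ⊢
      rw [show tensorEven T.e R.e (w₁ (T.q n z)) = _ from e3, e2]
      abel
    · have hz' : ∀ i ≥ n, T.q i (z - T.q n z) = 0 := by
        intro i hi
        rw [map_sub]
        obtain rfl | hi := hi.eq_or_lt
        · rw [T.q_self, sub_self]
        · rw [hz i hi, T.q_ne i n z (by omega), sub_zero]
      have e1 := hn _ hz'
      have e2 := hw₁ z
      rw [hext _ (T.rTensor_δ n z hz n le_rfl)]
      rw [map_sub, map_sub, map_sub, map_sub, sub_tmul] at e1
      rw [hc] at e2
      simp only [LinearMap.add_apply, LinearMap.sub_apply, LinearMap.comp_apply, map_add, map_sub,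
        e2]
      rw [← sub_eq_zero] at e1 ⊢
      rw [← e1]
      abel

/-- If a semifree right dg module `Z ⊗ A` over `A` is acyclic, then so is
`Z ⊗ B = (Z ⊗ A) ⊗_A B` for all left dg modules `B`. -/
theorem acyclic_of_self [Module.Projective k Z]
    (hT : ∀ x, T.d R.self x = 0 → ∃ y, T.d R.self y = x) (x : Z ⊗[k] B) (hx : T.d ρ x = 0) :
    ∃ y, T.d ρ y = x := by
  obtain ⟨n, hn⟩ := T.exists_forall_rTensor_eq_zero x
  obtain ⟨h, h_odd, hh⟩ := T.exists_homotopy hT n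
  refine ⟨ρ.ext h x, ?_⟩
  have := T.homotopy_apply ρ n h h_odd hh x hn
  rwa [hx, map_zero, add_zero] at this

end DGAlg.Twisted

end SemifreeModules

end

noncomputable section

section SemifreeModules

variable {k : Type*} [CommRing k] {A : Type*} [Ring A] [Algebra k A]

namespace DGAlg.Twisted

variable {R : DGAlg k A} {Z : Type*} [AddCommGroup Z] [Module k Z] (T : R.Twisted Z)
  {B B' : Type*} [AddCommGroup B] [Module k B] [AddCommGroup B'] [Module k B'] (ρ : R.Mod B)
  (ρ' : R.Mod B')

lemma q_signOf (i : ℕ) (z : Z) : T.q i (signOf T.e z) = (-1 : k) ^ i • T.q i z := by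
  rw [signOf_apply, map_sub, map_add, T.q_e]
  split_ifs with h
  · simp [h.neg_one_pow]
  · simp [(Nat.not_even_iff_odd.1 h).neg_one_pow]

lemma rTensor_d (n : ℕ) (x : Z ⊗[k] B) (hx : ∀ i ≥ n + 1, (T.q i).rTensor B x = 0) (j : ℕ)
    (hj : n ≤ j) : (T.q j).rTensor B (T.d ρ x) =
      (-1 : k) ^ j • ρ.d.lTensor Z ((T.q j).rTensor B x) := by
  rw [d, DGAlg.Mod.twD, LinearMap.add_apply, map_add, T.rTensor_ext_δ ρ n x hx j hj, zero_add]
  clear hx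
  induction x using TensorProduct.induction_on with
  | zero => simp
  | tmul z b => simp [T.q_signOf, smul_tmul']
  | add x y hx hy => simp only [map_add, hx, hy, smul_add]

lemma lTensor_d {g : B →ₗ[k] B'} (hact : ∀ a b, g (ρ.act a b) = ρ'.act a (g b))
    (hd : ∀ b, g (ρ.d b) = ρ'.d (g b)) (x : Z ⊗[k] B) :
    g.lTensor Z (T.d ρ x) = T.d ρ' (g.lTensor Z x) := by
  have h : ∀ b (x : Z ⊗[k] A), g.lTensor Z (ρ.dot Z b x) = ρ'.dot Z (g b) x := by
    intro b x
    induction x using TensorProduct.induction_on with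
    | zero => simp
    | tmul z a => simp [hact]
    | add x y hx hy => simp only [map_add, hx, hy]
  induction x using TensorProduct.induction_on with
  | zero => simp
  | tmul z b => simp [d, DGAlg.Mod.twD_tmul, h, hd]
  | add x y hx hy => simp only [map_add, hx, hy]

lemma lTensor_rTensor (f : Z →ₗ[k] Z) (g : B →ₗ[k] B') (x : Z ⊗[k] B) :
    g.lTensor Z (f.rTensor B x) = f.rTensor B' (g.lTensor Z x) := by
  rw [← LinearMap.comp_apply, LinearMap.lTensor_comp_rTensor, ← LinearMap.rTensor_comp_lTensor,
    LinearMap.comp_apply]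

/-- Semifree right dg modules preserve quasi-isomorphisms of left dg modules. -/
theorem isQis_lTensor [Module.Flat k Z] {g : B →ₗ[k] B'}
    (hact : ∀ a b, g (ρ.act a b) = ρ'.act a (g b))
    (hd : ∀ b, g (ρ.d b) = ρ'.d (g b)) (hg : IsQis ρ.d ρ'.d g) :
    IsQis (T.d ρ) (T.d ρ') (g.lTensor Z) := by
  have hgZ := hg.lTensor Z ρ.d_d ρ'.d_d hd
  have key : ∀ n (x : Z ⊗[k] B) (y : Z ⊗[k] B'), (∀ i ≥ n, (T.q i).rTensor B x = 0) →
      (∀ i ≥ n, (T.q i).rTensor B' y = 0) → T.d ρ x = 0 → g.lTensor Z x = T.d ρ' y →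
      ∃ x' y', T.d ρ x' = x ∧ g.lTensor Z x' - T.d ρ' y' = y := by
    intro n
    induction n with
    | zero =>
      intro x y hx hy _ _
      refine ⟨0, 0, ?_, ?_⟩
      · simpa using (T.eq_sum_rTensor x 0 hx).symm
      · simpa using (T.eq_sum_rTensor y 0 hy).symm
    | succ n ih =>
      intro x y hx hy hdx hgx
      have hs : ∀ v : Z ⊗[k] B, (-1 : k) ^ n • (-1 : k) ^ n • v = v := by
        simp [smul_smul, ← mul_pow]
      have hs' : ∀ v : Z ⊗[k] B', (-1 : k) ^ n • (-1 : k) ^ n • v = v := by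
        simp [smul_smul, ← mul_pow]
      have h1 := T.rTensor_d ρ n x hx n le_rfl
      have h2 := T.rTensor_d ρ' n y hy n le_rfl
      rw [hdx, map_zero] at h1
      rw [← hgx, ← lTensor_rTensor, ← map_smul] at h2
      obtain ⟨x₁, y₁, h3, h4⟩ := hgZ _ _ (by rw [← hs (ρ.d.lTensor Z _), ← h1, smul_zero]) h2
      let x₂ := (-1 : k) ^ n • (T.q n).rTensor B x₁
      let y₂ := (T.q n).rTensor B' y₁
      have hx₂ : ∀ i ≥ n + 1, (T.q i).rTensor B x₂ = 0 := fun i hi => by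
        rw [map_smul, T.rTensor_ne i n (by omega), smul_zero]
      have hy₂ : ∀ i ≥ n + 1, (T.q i).rTensor B' y₂ = 0 := fun i hi =>
        T.rTensor_ne i n (by omega) _
      have h5 : ∀ i ≥ n, (T.q i).rTensor B (x - T.d ρ x₂) = 0 := by
        intro i hi
        rw [map_sub, T.rTensor_d ρ n x₂ hx₂ i hi]
        obtain rfl | hi := hi.eq_or_lt
        · rw [map_smul, T.rTensor_self, map_smul, hs, lTensor_rTensor, h3, T.rTensor_self,
            sub_self]
        · rw [hx i hi, hx₂ i hi, map_zero, smul_zero, sub_zero]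
      have h6 : ∀ i ≥ n, (T.q i).rTensor B' (y - (g.lTensor Z x₂ - T.d ρ' y₂)) = 0 := by
        intro i hi
        rw [map_sub, map_sub, T.rTensor_d ρ' n y₂ hy₂ i hi, ← lTensor_rTensor]
        obtain rfl | hi := hi.eq_or_lt
        · rw [map_smul, T.rTensor_self, T.rTensor_self, map_smul, lTensor_rTensor,
            lTensor_rTensor, ← smul_sub, ← map_sub, h4, map_smul, hs', T.rTensor_self, sub_self]
        · rw [hy i hi, hx₂ i hi, hy₂ i hi, map_zero, map_zero, smul_zero, sub_zero, sub_zero]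
      obtain ⟨x₃, y₃, h7, h8⟩ := ih _ _ h5 h6 (by rw [map_sub, hdx, T.d_d, sub_zero]) (by
        rw [map_sub, map_sub, map_sub, T.lTensor_d ρ ρ' hact hd, T.d_d, sub_zero, hgx])
      refine ⟨x₃ + x₂, y₃ + y₂, ?_, ?_⟩
      · rw [map_add, h7, sub_add_cancel]
      · rw [map_add, map_add, add_sub_add_comm, h8, sub_add_cancel]
  intro x y hx hy
  obtain ⟨n, hn⟩ := T.exists_forall_rTensor_eq_zero x
  obtain ⟨m, hm⟩ := T.exists_forall_rTensor_eq_zero y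
  exact key (max n m) x y (fun i hi => hn i (le_of_max_le_left hi))
    (fun i hi => hm i (le_of_max_le_right hi)) hx hy

section Cone

variable {Z' : Type*} [AddCommGroup Z'] [Module k Z'] (T' : R.Twisted Z') (f : Z →ₗ[k] Z')

variable (A) in
/-- The twisted differential of the mapping cone on generators. -/
def coneδ (δ : Z →ₗ[k] Z ⊗[k] A) (δ' : Z' →ₗ[k] Z' ⊗[k] A) : Z × Z' →ₗ[k] (Z × Z') ⊗[k] A :=
  LinearMap.coprod
    ((LinearMap.inr k Z Z').rTensor A ∘ₗ (TensorProduct.mk k Z' A).flip 1 ∘ₗ f -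
      (LinearMap.inl k Z Z').rTensor A ∘ₗ δ)
    ((LinearMap.inr k Z Z').rTensor A ∘ₗ δ')

/-- The parity projector of the mapping cone. -/
def coneE (e : Z →ₗ[k] Z) (e' : Z' →ₗ[k] Z') : Z × Z' →ₗ[k] Z × Z' :=
  LinearMap.prodMap (LinearMap.id - e) e'

lemma twD_cone_inl (e : Z →ₗ[k] Z) (e' : Z' →ₗ[k] Z') (δ : Z →ₗ[k] Z ⊗[k] A)
    (δ' : Z' →ₗ[k] Z' ⊗[k] A) (x : Z ⊗[k] B) :
    ρ.twD (coneE e e') (coneδ A f δ δ') ((LinearMap.inl k Z Z').rTensor B x) =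
      (LinearMap.inr k Z Z').rTensor B (f.rTensor B x) -
        (LinearMap.inl k Z Z').rTensor B (ρ.twD e δ x) := by
  induction x using TensorProduct.induction_on with
  | zero => simp
  | tmul z b =>
    have h : signOf (coneE e e') (z, 0) = -(LinearMap.inl k Z Z' (signOf e z)) := by
      simp [signOf_apply, coneE]
      abel
    simp only [LinearMap.rTensor_tmul, DGAlg.Mod.twD_tmul, LinearMap.inl_apply, h, neg_tmul]
    simp [coneδ, DGAlg.Mod.rTensor_dot]
    abel
  | add x y hx hy =>
    simp only [map_add, hx, hy]
    abel

lemma twD_cone_inr (e : Z →ₗ[k] Z) (e' : Z' →ₗ[k] Z') (δ : Z →ₗ[k] Z ⊗[k] A)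
    (δ' : Z' →ₗ[k] Z' ⊗[k] A) (x : Z' ⊗[k] B) :
    ρ.twD (coneE e e') (coneδ A f δ δ') ((LinearMap.inr k Z Z').rTensor B x) =
      (LinearMap.inr k Z Z').rTensor B (ρ.twD e' δ' x) := by
  induction x using TensorProduct.induction_on with
  | zero => simp
  | tmul z b =>
    have h : signOf (coneE e e') (0, z) = LinearMap.inr k Z Z' (signOf e' z) := by
      simp [signOf_apply, coneE]
    simp only [LinearMap.rTensor_tmul, DGAlg.Mod.twD_tmul, LinearMap.inr_apply, h]
    simp [coneδ, DGAlg.Mod.rTensor_dot]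
  | add x y hx hy => simp only [map_add, hx, hy]

lemma tensorEven_rTensor_inl (e : Z →ₗ[k] Z) (e' : Z' →ₗ[k] Z') (x : Z ⊗[k] A) :
    tensorEven (coneE e e') R.e ((LinearMap.inl k Z Z').rTensor A x) =
      (LinearMap.inl k Z Z').rTensor A (x - tensorEven e R.e x) := by
  induction x using TensorProduct.induction_on with
  | zero => simp
  | tmul z a =>
    have h1 : coneE e e' (z, 0) = LinearMap.inl k Z Z' (z - e z) := by simp [coneE]
    have h2 : ((z, 0) - (LinearMap.inl k Z Z' (z - e z))) = LinearMap.inl k Z Z' (e z) := by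
      simp
    rw [LinearMap.rTensor_tmul, tensorEven_tmul, tensorEven_tmul, LinearMap.inl_apply, h1, h2]
    simp only [map_sub, map_add, LinearMap.rTensor_tmul, sub_tmul, tmul_sub, LinearMap.inl_apply]
    abel
  | add x y hx hy => simp only [map_add, hx, hy, add_sub_add_comm]

lemma tensorEven_rTensor_inr (e : Z →ₗ[k] Z) (e' : Z' →ₗ[k] Z') (x : Z' ⊗[k] A) :
    tensorEven (coneE e e') R.e ((LinearMap.inr k Z Z').rTensor A x) =
      (LinearMap.inr k Z Z').rTensor A (tensorEven e' R.e x) := by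
  induction x using TensorProduct.induction_on with
  | zero => simp
  | tmul z a => simp [tensorEven_tmul, coneE]
  | add x y hx hy => simp only [map_add, hx, hy]

variable (hq : ∀ i z, f (T.q i z) = T'.q i (f z)) (hδ : ∀ z, f.rTensor A (T.δ z) = T'.δ (f z))

include hq in
lemma map_e (z : Z) : f (T.e z) = T'.e (f z) := by
  obtain ⟨n, hn⟩ := T.exists_sum z
  rw [hn]
  simp only [map_sum]
  refine Finset.sum_congr rfl fun i _ => ?_
  rw [T.e_q, hq, T'.e_q]
  split_ifs
  · exact hq i z
  · simp

/-- The homogeneous components of the mapping cone. -/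
def coneQ (q : ℕ → Z →ₗ[k] Z) (q' : ℕ → Z' →ₗ[k] Z') : ℕ → Z × Z' →ₗ[k] Z × Z'
  | 0 => LinearMap.prodMap 0 (q' 0)
  | i + 1 => LinearMap.prodMap (q i) (q' (i + 1))

include hq hδ in
lemma map_d (x : Z ⊗[k] B) : f.rTensor B (T.d ρ x) = T'.d ρ (f.rTensor B x) := by
  induction x using TensorProduct.induction_on with
  | zero => simp
  | tmul z b =>
    simp [d, DGAlg.Mod.twD_tmul, DGAlg.Mod.rTensor_dot, hδ, signOf_apply, map_e T T' f hq]
  | add x y hx hy => simp only [map_add, hx, hy]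

/-- The mapping cone of a map of semifree modules given by a map on generators. -/
def cone : R.Twisted (Z × Z') where
  q := coneQ T.q T'.q
  e := coneE T.e T'.e
  q_self i z := by
    obtain _ | i := i
    · simp [coneQ, T'.q_self]
    · simp [coneQ, T.q_self, T'.q_self]
  q_ne i j z h := by
    obtain _ | i := i <;> obtain _ | j := j
    · exact absurd rfl h
    · simp [coneQ, T'.q_ne 0 (j + 1) _ h]
    · simp [coneQ, T'.q_ne (i + 1) 0 _ h]
    · simp [coneQ, T'.q_ne (i + 1) (j + 1) _ h, T.q_ne i j _ (by omega)]
  e_q i z := by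
    obtain _ | i := i
    · simp [coneQ, coneE, T'.e_q]
    · simp only [coneQ, coneE, LinearMap.prodMap_apply, LinearMap.sub_apply, LinearMap.id_apply,
        T.e_q, T'.e_q, Nat.even_add_one]
      split_ifs <;> simp
  exists_sum z := by
    obtain ⟨n, hn⟩ := T.exists_forall_q_eq_zero z.1
    obtain ⟨m, hm⟩ := T'.exists_forall_q_eq_zero z.2
    refine ⟨max n m + 1, ?_⟩
    have h1 := T.eq_sum z.1 (max n m) fun i hi => hn i (le_of_max_le_left hi)
    have h2 := T'.eq_sum z.2 (max n m + 1) fun i hi => hm i (by omega)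
    rw [Finset.sum_range_succ'] at h2 ⊢
    refine Prod.ext ?_ ?_
    · rw [Prod.fst_add, Prod.fst_sum]
      simpa [coneQ] using h1
    · rw [Prod.snd_add, Prod.snd_sum]
      exact h2
  δ := coneδ A f T.δ T'.δ
  δ_e z := by
    have h1 : z - coneE T.e T'.e z = (T.e z.1, z.2 - T'.e z.2) := by
      ext <;> simp [coneE]
    have h2 : ∀ y, tensorEven T'.e R.e (y ⊗ₜ[k] 1) = T'.e y ⊗ₜ 1 := fun y => by
      simp [tensorEven_tmul, R.e_one]
    rw [h1]
    simp only [coneδ, LinearMap.coprod_apply, LinearMap.sub_apply, LinearMap.comp_apply,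
      LinearMap.flip_apply, TensorProduct.mk_apply, map_add, map_sub, tensorEven_rTensor_inl,
      tensorEven_rTensor_inr, T.δ_e, T'.δ_e, h2, map_e T T' f hq]
    abel
  δ_lower i j z hij := by
    have hinl : ∀ (g : Z →ₗ[k] Z) (g' : Z' →ₗ[k] Z') (x : Z ⊗[k] A),
        (LinearMap.prodMap g g').rTensor A ((LinearMap.inl k Z Z').rTensor A x) =
          (LinearMap.inl k Z Z').rTensor A (g.rTensor A x) := by
      intro g g' x
      rw [← LinearMap.rTensor_comp_apply, ← LinearMap.rTensor_comp_apply]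
      congr 2
      ext <;> simp
    have hinr : ∀ (g : Z →ₗ[k] Z) (g' : Z' →ₗ[k] Z') (x : Z' ⊗[k] A),
        (LinearMap.prodMap g g').rTensor A ((LinearMap.inr k Z Z').rTensor A x) =
          (LinearMap.inr k Z Z').rTensor A (g'.rTensor A x) := by
      intro g g' x
      rw [← LinearMap.rTensor_comp_apply, ← LinearMap.rTensor_comp_apply]
      congr 2
      ext <;> simp
    obtain _ | j := j <;> obtain _ | i := i
    · simp [coneδ, coneQ, hinr, T'.δ_lower 0 0 _ le_rfl]
    · omega
    · simp [coneδ, coneQ, hinr, T'.δ_lower 0 (j + 1) _ (by omega)]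
    · have h1 : T'.q (j + 1) (f (T.q i z.1)) = 0 := by
        rw [← hq, T.q_ne _ _ _ (by omega), map_zero]
      simp [coneδ, coneQ, hinr, hinl, T'.δ_lower (i + 1) (j + 1) _ hij,
        T.δ_lower i j _ (by omega), h1, ← Prod.zero_eq_mk]
  mc z := by
    have h1 := T'.d_tmul_one (f z.1)
    simp only [coneδ, LinearMap.coprod_apply, LinearMap.sub_apply, LinearMap.comp_apply,
      LinearMap.flip_apply, TensorProduct.mk_apply, map_add, map_sub]
    rw [← coneδ, twD_cone_inr, twD_cone_inr, twD_cone_inl, T.mc, T'.mc, h1, hδ]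
    simp

lemma rTensor_inl_fst_add (t : (Z × Z') ⊗[k] B) :
    (LinearMap.inl k Z Z').rTensor B ((LinearMap.fst k Z Z').rTensor B t) +
      (LinearMap.inr k Z Z').rTensor B ((LinearMap.snd k Z Z').rTensor B t) = t := by
  induction t using TensorProduct.induction_on with
  | zero => simp
  | tmul z b => simp [← add_tmul]
  | add x y hx hy =>
    conv_rhs => rw [← hx, ← hy]
    simp only [map_add]
    abel

lemma rTensor_inl_add_inj {x x' : Z ⊗[k] B} {y y' : Z' ⊗[k] B}
    (h : (LinearMap.inl k Z Z').rTensor B x + (LinearMap.inr k Z Z').rTensor B y =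
      (LinearMap.inl k Z Z').rTensor B x' + (LinearMap.inr k Z Z').rTensor B y') :
    x = x' ∧ y = y' := by
  constructor
  · have := congrArg ((LinearMap.fst k Z Z').rTensor B) h
    simp only [map_add, ← LinearMap.rTensor_comp_apply, LinearMap.fst_comp_inl,
      LinearMap.fst_comp_inr] at this
    simpa using this
  · have := congrArg ((LinearMap.snd k Z Z').rTensor B) h
    simp only [map_add, ← LinearMap.rTensor_comp_apply, LinearMap.snd_comp_inl,
      LinearMap.snd_comp_inr] at this
    simpa using this

lemma cone_d (x : Z ⊗[k] B) (y : Z' ⊗[k] B) :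
    (cone T T' f hq hδ).d ρ ((LinearMap.inl k Z Z').rTensor B x +
      (LinearMap.inr k Z Z').rTensor B y) = (LinearMap.inl k Z Z').rTensor B (-T.d ρ x) +
      (LinearMap.inr k Z Z').rTensor B (f.rTensor B x + T'.d ρ y) := by
  refine (map_add _ _ _).trans ?_
  rw [show (cone T T' f hq hδ).d ρ ((LinearMap.inl k Z Z').rTensor B x) = _ from
      twD_cone_inl ρ f _ _ _ _ x,
    show (cone T T' f hq hδ).d ρ ((LinearMap.inr k Z Z').rTensor B y) = _ from
      twD_cone_inr ρ f _ _ _ _ y, map_neg, map_add]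
  abel

variable {f} in
include hq hδ in
/-- A map of semifree right dg modules over `A` that is a quasi-isomorphism induces
quasi-isomorphisms after tensoring with left dg modules. -/
theorem isQis_rTensor_of_self [Module.Projective k Z] [Module.Projective k Z']
    (hf : IsQis (T.d R.self) (T'.d R.self) (f.rTensor A)) :
    IsQis (T.d ρ) (T'.d ρ) (f.rTensor B) := by
  have hK : ∀ t, (cone T T' f hq hδ).d R.self t = 0 →
      ∃ s, (cone T T' f hq hδ).d R.self s = t := by
    intro t ht
    rw [← rTensor_inl_fst_add t, cone_d] at ht
    obtain ⟨h1, h2⟩ := rTensor_inl_add_inj (x' := 0) (y' := 0) (ht.trans (by simp))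
    obtain ⟨x', y', h3, h4⟩ := hf ((LinearMap.fst k Z Z').rTensor A t)
      (-(LinearMap.snd k Z Z').rTensor A t) (neg_eq_zero.1 h1)
      (by rw [map_neg]; exact eq_neg_of_add_eq_zero_left h2)
    refine ⟨(LinearMap.inl k Z Z').rTensor A (-x') + (LinearMap.inr k Z Z').rTensor A y', ?_⟩
    have h5 : f.rTensor A (-x') + T'.d R.self y' = (LinearMap.snd k Z Z').rTensor A t := by
      rw [← neg_neg ((LinearMap.snd k Z Z').rTensor A t), ← h4, map_neg]
      abel
    have h6 : -T.d R.self (-x') = (LinearMap.fst k Z Z').rTensor A t := by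
      rw [map_neg, neg_neg, h3]
    rw [cone_d, h5, h6, rTensor_inl_fst_add]
  intro x y hx hy
  obtain ⟨t, ht⟩ := (cone T T' f hq hδ).acyclic_of_self ρ hK
    ((LinearMap.inl k Z Z').rTensor B x + (LinearMap.inr k Z Z').rTensor B (-y)) (by
      rw [cone_d, hx, hy]
      simp)
  rw [← rTensor_inl_fst_add t, cone_d] at ht
  obtain ⟨h1, h2⟩ := rTensor_inl_add_inj ht
  refine ⟨-(LinearMap.fst k Z Z').rTensor B t, (LinearMap.snd k Z Z').rTensor B t, ?_, ?_⟩
  · rw [map_neg, h1]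
  · rw [← neg_eq_iff_eq_neg.2 h2, map_neg]
    abel

end Cone

section BaseChange

variable {A' : Type*} [Ring A'] [Algebra k A'] {R' : DGAlg k A'} (ψ : A →ₐ[k] A')

variable (hD : ∀ a, ψ (R.D a) = R'.D (ψ a)) (he : ∀ a, ψ (R.e a) = R'.e (ψ a))

/-- Restriction of a dg module along a map of dg algebras. -/
def _root_.DGAlg.Mod.restrict (ρ : R'.Mod B) : R.Mod B where
  act := ρ.act.comp ψ
  d := ρ.d
  d_d := ρ.d_d
  d_act a b := by simp [ρ.d_act, hD, he, signOf_apply]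

lemma lTensor_twD (e : Z →ₗ[k] Z) (δ : Z →ₗ[k] Z ⊗[k] A) (x : Z ⊗[k] B) (ρ : R'.Mod B) :
    ρ.twD e (ψ.toLinearMap.lTensor Z ∘ₗ δ) x = (ρ.restrict ψ hD he).twD e δ x := by
  have h : ∀ b (x : Z ⊗[k] A), ρ.dot Z b (ψ.toLinearMap.lTensor Z x) =
      (ρ.restrict ψ hD he).dot Z b x := by
    intro b x
    induction x using TensorProduct.induction_on with
    | zero => simp
    | tmul z a => simp [DGAlg.Mod.restrict]
    | add x y hx hy => simp only [map_add, hx, hy]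
  induction x using TensorProduct.induction_on with
  | zero => simp
  | tmul z b => simp [DGAlg.Mod.twD_tmul, h]; rfl
  | add x y hx hy => simp only [map_add, hx, hy]

/-- Extension of scalars of a semifree module along a map of dg algebras. -/
def map : R'.Twisted Z where
  toProjGrading := T.toProjGrading
  δ := ψ.toLinearMap.lTensor Z ∘ₗ T.δ
  δ_e z := by
    have h : ∀ x : Z ⊗[k] A, tensorEven T.e R'.e (ψ.toLinearMap.lTensor Z x) =
        ψ.toLinearMap.lTensor Z (tensorEven T.e R.e x) := by
      intro x
      induction x using TensorProduct.induction_on with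
      | zero => simp
      | tmul z a => simp [tensorEven_tmul, he]
      | add x y hx hy => simp only [map_add, hx, hy]
    rw [LinearMap.comp_apply, h, T.δ_e, LinearMap.comp_apply]
  δ_lower i j z hij := by
    rw [LinearMap.comp_apply, ← lTensor_rTensor, T.δ_lower i j z hij, map_zero]
  mc z := by
    rw [lTensor_twD ψ hD he, LinearMap.comp_apply]
    refine (T.lTensor_d R.self _ (fun a b => ?_) (fun b => ?_) (T.δ z)).symm.trans ?_
    · simp [DGAlg.self, DGAlg.Mod.restrict]
    · exact hD b
    · rw [show T.d R.self (T.δ z) = 0 from T.mc z, map_zero]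

end BaseChange

end DGAlg.Twisted

end SemifreeModules

end

noncomputable section

namespace ConnDGCoalg

variable {k : Type v} [CommRing k] (C : ConnDGCoalg.{v, w} k)

/-! ### Homogeneous components in the cobar construction -/

theorem cobar_homogeneous_induction {P : C.Cobar → Prop} (zero : P 0)
    (add : ∀ x y, P x → P y → P (x + y)) (mem : ∀ n, ∀ x ∈ C.cobarDeg n, P x) (x : C.Cobar) :
    P x := by
  have h : x ∈ ⨆ n, C.cobarDeg n := by
    induction x using C.cobar_induction with
    | one => exact Submodule.mem_iSup_of_mem 0 C.one_mem_cobarDeg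
    | gen_mul n c x ih =>
      refine Submodule.iSup_induction _ (motive := fun x => C.gen (n + 1) c * x ∈
        ⨆ n, C.cobarDeg n) ih (fun i x hx => ?_) (by simp) fun x y hx hy => ?_
      · exact Submodule.mem_iSup_of_mem (n + i)
          (C.mul_mem_cobarDeg rfl (C.gen_mem_cobarDeg n c) hx)
      · rw [mul_add]
        exact add_mem hx hy
    | add x y hx hy => exact add_mem hx hy
    | smul r x hx => exact Submodule.smul_mem _ r hx
  exact Submodule.iSup_induction _ (motive := P) h mem zero add

/-- The algebra map `x ↦ x X ^ |x|`. -/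
def cobarPoly : C.Cobar →ₐ[k] Polynomial C.Cobar :=
  TensorAlgebra.lift k (DirectSum.toModule k ℕ _ fun n =>
    ((Polynomial.monomial (R := C.Cobar) n).restrictScalars k) ∘ₗ C.gen (n + 1))

lemma cobarPoly_gen (n : ℕ) (c : C.X (n + 1)) :
    C.cobarPoly (C.gen (n + 1) c) = Polynomial.monomial n (C.gen (n + 1) c) := by
  simp [cobarPoly, gen_succ]

lemma cobarPoly_of_mem {n : ℕ} {x : C.Cobar} (hx : x ∈ C.cobarDeg n) :
    C.cobarPoly x = Polynomial.monomial n x := by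
  refine (Submodule.span_le (p := LinearMap.eqLocus C.cobarPoly.toLinearMap
    ((Polynomial.monomial (R := C.Cobar) n).restrictScalars k))).2 ?_ hx
  rintro _ ⟨l, rfl, rfl⟩
  clear hx
  change C.cobarPoly _ = Polynomial.monomial _ _
  induction l with
  | nil => simp
  | cons s l ih =>
    simp only [List.map_cons, List.prod_cons, List.sum_cons, map_mul, cobarPoly_gen, ih,
      Polynomial.monomial_mul_monomial]

/-- The projection of the cobar construction to its component of degree `i`. -/
def cobarQ (i : ℕ) : C.Cobar →ₗ[k] C.Cobar :=
  (Polynomial.lcoeff C.Cobar i).restrictScalars k ∘ₗ C.cobarPoly.toLinearMap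

/-- The projection of the cobar construction to its even part. -/
def cobarE : C.Cobar →ₗ[k] C.Cobar :=
  Polynomial.lsum (fun i => if Even i then LinearMap.id else 0) ∘ₗ C.cobarPoly.toLinearMap

lemma cobarQ_of_mem {n : ℕ} {x : C.Cobar} (hx : x ∈ C.cobarDeg n) (i : ℕ) :
    C.cobarQ i x = if n = i then x else 0 := by
  simp [cobarQ, C.cobarPoly_of_mem hx, Polynomial.coeff_monomial]

lemma cobarE_of_mem {n : ℕ} {x : C.Cobar} (hx : x ∈ C.cobarDeg n) :
    C.cobarE x = if Even n then x else 0 := by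
  simp only [cobarE, LinearMap.comp_apply, AlgHom.toLinearMap_apply, C.cobarPoly_of_mem hx,
    Polynomial.lsum_apply]
  rw [Polynomial.sum_monomial_index _ _ (by simp)]
  split_ifs <;> rfl

lemma cobarSign_of_mem {n : ℕ} {x : C.Cobar} (hx : x ∈ C.cobarDeg n) :
    C.cobarSign x = (-1 : k) ^ n • x := by
  refine (Submodule.span_le (p := LinearMap.eqLocus C.cobarSign.toLinearMap
    ((-1 : k) ^ n • LinearMap.id))).2 ?_ hx
  rintro _ ⟨l, rfl, rfl⟩
  clear hx
  change C.cobarSign _ = (-1 : k) ^ _ • List.prod _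
  induction l with
  | nil => simp
  | cons s l ih =>
    simp only [List.map_cons, List.prod_cons, List.sum_cons, map_mul, cobarSign_gen, ih, pow_add,
      smul_mul_smul_comm]

lemma cobarD_of_mem_zero {x : C.Cobar} (hx : x ∈ C.cobarDeg 0) : C.cobarD x = 0 := by
  refine (Submodule.span_le (p := LinearMap.ker C.cobarD)).2 ?_ hx
  rintro _ ⟨l, hl, rfl⟩
  change C.cobarD _ = 0
  induction l with
  | nil => simp [cobarD_one]
  | cons s l ih =>
    obtain ⟨n, c⟩ := s
    simp only [List.map_cons, List.sum_cons] at hl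
    simp only [List.map_cons, List.prod_cons, cobarD_mul]
    rw [(C.cobarD_gen_mem n c).2 (by omega), ih (by omega), zero_mul, mul_zero, add_zero]

lemma signOf_cobarE (x : C.Cobar) : signOf C.cobarE x = C.cobarSign x := by
  induction x using C.cobar_homogeneous_induction with
  | zero => simp
  | add x y hx hy => rw [map_add, map_add, hx, hy]
  | mem n x hx =>
    rw [signOf_apply, C.cobarE_of_mem hx, C.cobarSign_of_mem hx]
    split_ifs with h
    · simp [h.neg_one_pow]
    · simp [(Nat.not_even_iff_odd.1 h).neg_one_pow]

/-- The cobar construction as a dg algebra. -/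
def cobarDG : DGAlg k C.Cobar where
  D := C.cobarD
  e := C.cobarE
  D_D := C.cobarD_cobarD
  e_one := by rw [C.cobarE_of_mem C.one_mem_cobarDeg, if_pos Even.zero]
  e_e x := by
    induction x using C.cobar_homogeneous_induction with
    | zero => simp
    | add x y hx hy => simp only [map_add, hx, hy]
    | mem n x hx =>
      rw [C.cobarE_of_mem hx]
      split_ifs with h
      · rw [C.cobarE_of_mem hx, if_pos h]
      · simp
  e_D x := by
    induction x using C.cobar_homogeneous_induction with
    | zero => simp
    | add x y hx hy =>
      simp only [map_add, map_sub] at hx hy ⊢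
      rw [hx, hy]
      abel
    | mem n x hx =>
      rw [C.cobarE_of_mem hx]
      obtain _ | n := n
      · simp [C.cobarD_of_mem_zero hx]
      · rw [C.cobarE_of_mem (C.cobarD_mem n x hx)]
        simp only [Nat.even_add_one]
        split_ifs <;> simp
  e_mul x y := by
    induction x using C.cobar_homogeneous_induction with
    | zero => simp
    | add x x' hx hx' =>
      simp only [map_add, add_mul, hx, hx', add_sub_add_comm]
      abel
    | mem n x hx =>
      induction y using C.cobar_homogeneous_induction with
      | zero => simp
      | add y y' hy hy' =>
        simp only [map_add, mul_add, hy, hy', add_sub_add_comm]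
        abel
      | mem m y hy =>
        rw [C.cobarE_of_mem hx, C.cobarE_of_mem hy, C.cobarE_of_mem (C.mul_mem_cobarDeg rfl hx hy)]
        by_cases h : Even n <;> by_cases h' : Even m <;> simp [Nat.even_add, h, h']
  D_mul x y := by
    rw [cobarD_mul, ← signOf_apply, signOf_cobarE]

lemma cobarQ_mem (i : ℕ) (x : C.Cobar) : C.cobarQ i x ∈ C.cobarDeg i := by
  induction x using C.cobar_homogeneous_induction with
  | zero => simp
  | add x y hx hy => rw [map_add]; exact add_mem hx hy
  | mem n x hx =>
    rw [C.cobarQ_of_mem hx]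
    split_ifs with h
    · exact h ▸ hx
    · exact zero_mem _

lemma cobarD_cobarQ_succ (i : ℕ) (x : C.Cobar) :
    C.cobarD (C.cobarQ (i + 1) x) = C.cobarQ i (C.cobarD x) := by
  induction x using C.cobar_homogeneous_induction with
  | zero => simp
  | add x y hx hy => simp only [map_add, hx, hy]
  | mem n x hx =>
    rw [C.cobarQ_of_mem hx]
    obtain _ | n := n
    · simp [C.cobarD_of_mem_zero hx]
    · rw [C.cobarQ_of_mem (C.cobarD_mem n x hx)]
      simp only [Nat.add_right_cancel_iff]
      split_ifs <;> simp

lemma exists_cobar_eq_sum (x : C.Cobar) :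
    ∃ n, ∀ m ≥ n, x = ∑ i ∈ Finset.range m, C.cobarQ i x := by
  induction x using C.cobar_homogeneous_induction with
  | zero => exact ⟨0, by simp⟩
  | add x y hx hy =>
    obtain ⟨n, hn⟩ := hx
    obtain ⟨m, hm⟩ := hy
    refine ⟨max n m, fun i hi => ?_⟩
    simp only [map_add, Finset.sum_add_distrib]
    rw [← hn i (le_of_max_le_left hi), ← hm i (le_of_max_le_right hi)]
  | mem n x hx =>
    refine ⟨n + 1, fun m hm => ?_⟩
    simp only [C.cobarQ_of_mem hx]
    rw [Finset.sum_ite_eq, if_pos (Finset.mem_range.2 hm)]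

namespace Hom

variable {C} {C' : ConnDGCoalg.{v, w} k} (φ : Hom C C')

lemma cobarMap_cobarQ (i : ℕ) (x : C.Cobar) :
    φ.cobarMap (C.cobarQ i x) = C'.cobarQ i (φ.cobarMap x) := by
  induction x using C.cobar_homogeneous_induction with
  | zero => simp
  | add x y hx hy => simp only [map_add, hx, hy]
  | mem n x hx =>
    rw [C.cobarQ_of_mem hx, C'.cobarQ_of_mem (φ.cobarMap_mem n x hx)]
    split_ifs <;> simp

lemma cobarMap_cobarE (x : C.Cobar) :
    φ.cobarMap (C.cobarE x) = C'.cobarE (φ.cobarMap x) := by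
  induction x using C.cobar_homogeneous_induction with
  | zero => simp
  | add x y hx hy => simp only [map_add, hx, hy]
  | mem n x hx =>
    rw [C.cobarE_of_mem hx, C'.cobarE_of_mem (φ.cobarMap_mem n x hx)]
    split_ifs <;> simp

end Hom

/-! ### The total coalgebra -/

/-- The underlying module of `C`. -/
abbrev Tot : Type w := DirectSum ℕ C.X

/-- The inclusion of the component of degree `n`. -/
abbrev incl (n : ℕ) : C.X n →ₗ[k] C.Tot := DirectSum.lof k ℕ C.X n

/-- The grading of `C`. -/
def totGrading : ProjGrading k C.Tot where
  q i := C.incl i ∘ₗ DirectSum.component k ℕ C.X i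
  e := DirectSum.toModule k ℕ _ fun n => if Even n then C.incl n else 0
  q_self i z := by simp [incl, DirectSum.component.lof_self]
  q_ne i j z h := by simp [incl, DirectSum.component.of, h.symm]
  e_q i z := by
    simp only [LinearMap.comp_apply, incl, DirectSum.toModule_lof]
    split_ifs <;> rfl
  exists_sum z := by
    have h : ∃ n, ∀ m ≥ n, z = ∑ i ∈ Finset.range m,
        (C.incl i ∘ₗ DirectSum.component k ℕ C.X i) z := by
      induction z using DirectSum.induction_on with
      | zero => exact ⟨0, by simp⟩
      | add x y hx hy =>
        obtain ⟨n, hn⟩ := hx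
        obtain ⟨m, hm⟩ := hy
        refine ⟨max n m, fun i hi => ?_⟩
        simp only [map_add, Finset.sum_add_distrib]
        rw [← hn i (le_of_max_le_left hi), ← hm i (le_of_max_le_right hi)]
      | of n c =>
        refine ⟨n + 1, fun m hm => ?_⟩
        rw [Finset.sum_eq_single n]
        · exact (congrArg (C.incl n) (DirectSum.component.lof_self k n c)).symm
        · intro i _ hi
          change C.incl i (DirectSum.component k ℕ C.X i (DirectSum.lof k ℕ C.X n c)) = 0
          rw [DirectSum.component.of, dif_neg hi.symm, map_zero]
        · exact fun h => (h (Finset.mem_range.2 hm)).elim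
    obtain ⟨n, hn⟩ := h
    exact ⟨n, hn n le_rfl⟩

/-- The parity projector of `C`. -/
abbrev totE : C.Tot →ₗ[k] C.Tot := C.totGrading.e

lemma totE_incl (n : ℕ) (c : C.X n) :
    C.totE (C.incl n c) = if Even n then C.incl n c else 0 := by
  simp only [totE, totGrading, incl, DirectSum.toModule_lof]
  split_ifs <;> rfl

lemma signOf_totE_incl (n : ℕ) (c : C.X n) :
    signOf C.totE (C.incl n c) = (-1 : k) ^ n • C.incl n c := by
  rw [signOf_apply, totE_incl]
  split_ifs with h
  · simp [h.neg_one_pow]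
  · simp [(Nat.not_even_iff_odd.1 h).neg_one_pow]

/-- The differential of `C`. -/
def totD : C.Tot →ₗ[k] C.Tot :=
  DirectSum.toModule k ℕ _ fun
    | 0 => 0
    | n + 1 => C.incl n ∘ₗ C.d n

lemma totD_incl_zero (c : C.X 0) : C.totD (C.incl 0 c) = 0 := by
  simp [totD, incl]

lemma totD_incl_succ (n : ℕ) (c : C.X (n + 1)) :
    C.totD (C.incl (n + 1) c) = C.incl n (C.d n c) := by
  simp [totD, incl]

/-- The coproduct of `C`. -/
def totΔ : C.Tot →ₗ[k] C.Tot ⊗[k] C.Tot :=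
  DirectSum.toModule k ℕ _ fun n => ∑ pq ∈ antidiagonal n,
    TensorProduct.map (C.incl pq.1) (C.incl pq.2) ∘ₗ C.Δ n pq.1 pq.2

lemma totΔ_incl (n : ℕ) (c : C.X n) : C.totΔ (C.incl n c) = ∑ pq ∈ antidiagonal n,
    TensorProduct.map (C.incl pq.1) (C.incl pq.2) (C.Δ n pq.1 pq.2 c) := by
  simp [totΔ, incl]

lemma totΔ_comp_incl (n : ℕ) : C.totΔ ∘ₗ C.incl n = ∑ pq ∈ antidiagonal n,
    TensorProduct.map (C.incl pq.1) (C.incl pq.2) ∘ₗ C.Δ n pq.1 pq.2 := by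
  ext c
  simp [totΔ_incl]

/-- The universal twisting cochain. -/
def totτ : C.Tot →ₗ[k] C.Cobar := DirectSum.toModule k ℕ _ C.twist

lemma totτ_incl (n : ℕ) (c : C.X n) : C.totτ (C.incl n c) = C.twist n c := by
  simp [totτ, incl]

theorem tot_induction {P : C.Tot → Prop} (incl : ∀ n c, P (C.incl n c))
    (add : ∀ x y, P x → P y → P (x + y)) (z : C.Tot) : P z := by
  induction z using DirectSum.induction_on with
  | zero => simpa using incl 0 0
  | add x y hx hy => exact add x y hx hy
  | of n c => exact incl n c

lemma totD_totD (z : C.Tot) : C.totD (C.totD z) = 0 := by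
  induction z using C.tot_induction with
  | add x y hx hy => rw [map_add, map_add, hx, hy, add_zero]
  | incl n c =>
    obtain _ | _ | n := n
    · simp [totD_incl_zero]
    · simp [totD_incl_zero, totD_incl_succ]
    · simp [totD_incl_succ, C.d_d]

lemma totE_totD (z : C.Tot) : C.totE (C.totD z) = C.totD (z - C.totE z) := by
  induction z using C.tot_induction with
  | add x y hx hy => simp only [map_add, hx, hy, add_sub_add_comm]
  | incl n c =>
    rw [totE_incl]
    obtain _ | n := n
    · simp [totD_incl_zero]
    · rw [totD_incl_succ, totE_incl, map_sub, totD_incl_succ]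
      simp only [Nat.even_add_one]
      split_ifs <;> simp [totD_incl_succ]

lemma cobarE_totτ (z : C.Tot) : C.cobarE (C.totτ z) = C.totτ (z - C.totE z) := by
  induction z using C.tot_induction with
  | add x y hx hy => simp only [map_add, hx, hy, add_sub_add_comm]
  | incl n c =>
    rw [totE_incl]
    obtain _ | n := n
    · simp [totτ_incl, twist, gen]
    · rw [totτ_incl, C.cobarE_of_mem (show C.twist (n + 1) c ∈ C.cobarDeg n from
        neg_mem (C.gen_mem_cobarDeg n c)), map_sub,
        totτ_incl]
      simp only [Nat.even_add_one]
      split_ifs <;> simp [totτ_incl]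

lemma totΔ_totE (z : C.Tot) : C.totΔ (C.totE z) = tensorEven C.totE C.totE (C.totΔ z) := by
  induction z using C.tot_induction with
  | add x y hx hy => simp only [map_add, hx, hy]
  | incl n c =>
    have h : ∀ p q, p + q = n → ∀ t : C.X p ⊗[k] C.X q,
        tensorEven C.totE C.totE (TensorProduct.map (C.incl p) (C.incl q) t) =
        if Even n then TensorProduct.map (C.incl p) (C.incl q) t else 0 := by
      rintro p q rfl t
      induction t using TensorProduct.induction_on with
      | zero => simp
      | add x y hx hy =>
        simp only [map_add, hx, hy]
        split_ifs <;> simp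
      | tmul x y =>
        rw [map_tmul, tensorEven_tmul, totE_incl, totE_incl]
        by_cases h : Even p <;> by_cases h' : Even q <;> simp [Nat.even_add, h, h']
    have h' : tensorEven C.totE C.totE (C.totΔ (C.incl n c)) =
        if Even n then C.totΔ (C.incl n c) else 0 := by
      rw [totΔ_incl, map_sum, Finset.sum_congr rfl fun pq hpq => h _ _
        (Finset.HasAntidiagonal.mem_antidiagonal.1 hpq) _]
      split_ifs <;> simp
    rw [h', totE_incl]
    split_ifs <;> simp

lemma totΔ_signOf (z : C.Tot) : C.totΔ (signOf C.totE z) =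
    TensorProduct.map (signOf C.totE) (signOf C.totE) (C.totΔ z) := by
  rw [map_signOf]
  simp only [signOf_apply, map_sub, map_add, totΔ_totE]

lemma totΔ_totD (z : C.Tot) : C.totΔ (C.totD z) = C.totD.rTensor C.Tot (C.totΔ z) +
    TensorProduct.map (signOf C.totE) C.totD (C.totΔ z) := by
  induction z using C.tot_induction with
  | add x y hx hy =>
    simp only [map_add, hx, hy]
    abel
  | incl n c =>
    have h1 : ∀ p q (t : C.X (p + 1) ⊗[k] C.X q), C.totD.rTensor C.Tot
        (TensorProduct.map (C.incl (p + 1)) (C.incl q) t) =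
        TensorProduct.map (C.incl p) (C.incl q) ((C.d p).rTensor _ t) := by
      intro p q t
      induction t using TensorProduct.induction_on with
      | zero => simp
      | add x y hx hy => simp only [map_add, hx, hy]
      | tmul x y => simp [totD_incl_succ]
    have h1' : ∀ q (t : C.X 0 ⊗[k] C.X q), C.totD.rTensor C.Tot
        (TensorProduct.map (C.incl 0) (C.incl q) t) = 0 := by
      intro q t
      induction t using TensorProduct.induction_on with
      | zero => simp
      | add x y hx hy => simp only [map_add, hx, hy, add_zero]
      | tmul x y => simp [totD_incl_zero]
    have h2 : ∀ p q (t : C.X p ⊗[k] C.X (q + 1)), TensorProduct.map (signOf C.totE) C.totD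
        (TensorProduct.map (C.incl p) (C.incl (q + 1)) t) = (-1 : k) ^ p •
        TensorProduct.map (C.incl p) (C.incl q) ((C.d q).lTensor _ t) := by
      intro p q t
      induction t using TensorProduct.induction_on with
      | zero => simp
      | add x y hx hy => simp only [map_add, hx, hy, smul_add]
      | tmul x y => simp [totD_incl_succ, signOf_totE_incl, smul_tmul']
    have h2' : ∀ p (t : C.X p ⊗[k] C.X 0), TensorProduct.map (signOf C.totE) C.totD
        (TensorProduct.map (C.incl p) (C.incl 0) t) = 0 := by
      intro q t
      induction t using TensorProduct.induction_on with
      | zero => simp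
      | add x y hx hy => simp only [map_add, hx, hy, add_zero]
      | tmul x y => simp [totD_incl_zero]
    obtain _ | n := n
    · simp [totΔ_incl, totD_incl_zero, h1', h2']
    · rw [totD_incl_succ, totΔ_incl, totΔ_incl, map_sum, map_sum,
        Finset.Nat.sum_antidiagonal_succ, Finset.Nat.sum_antidiagonal_succ', h1', h2', zero_add,
        zero_add, ← Finset.sum_add_distrib]
      refine Finset.sum_congr rfl fun pq _ => ?_
      rw [h1, h2, C.Δ_d, map_add, map_smul]

lemma totΔ_coassoc (z : C.Tot) :
    TensorProduct.assoc k C.Tot C.Tot C.Tot (C.totΔ.rTensor C.Tot (C.totΔ z)) =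
      C.totΔ.lTensor C.Tot (C.totΔ z) := by
  induction z using C.tot_induction with
  | add x y hx hy => simp only [map_add, hx, hy]
  | incl n c =>
    let F : ∀ p q r, C.Tot ⊗[k] (C.Tot ⊗[k] C.Tot) := fun p q r =>
      TensorProduct.map (C.incl p) (TensorProduct.map (C.incl q) (C.incl r))
        ((C.Δ (q + r) q r).lTensor (C.X p) (C.Δ n p (q + r) c))
    have h1 : ∀ p q r (t : C.X (p + q) ⊗[k] C.X r), TensorProduct.assoc k C.Tot C.Tot C.Tot
        (TensorProduct.map (TensorProduct.map (C.incl p) (C.incl q) ∘ₗ C.Δ (p + q) p q)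
          (C.incl r) t) =
        TensorProduct.map (C.incl p) (TensorProduct.map (C.incl q) (C.incl r))
          (TensorProduct.assoc k _ _ _ ((C.Δ (p + q) p q).rTensor (C.X r) t)) := by
      intro p q r t
      induction t using TensorProduct.induction_on with
      | zero => simp
      | add x y hx hy => simp only [map_add, hx, hy]
      | tmul x y =>
        simp only [map_tmul, LinearMap.comp_apply, LinearMap.rTensor_tmul]
        induction C.Δ (p + q) p q x using TensorProduct.induction_on with
        | zero => simp
        | add a b ha hb => simp only [map_add, add_tmul, ha, hb]
        | tmul a b => simp
    have h2 : ∀ p q r (t : C.X p ⊗[k] C.X (q + r)),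
        TensorProduct.map (C.incl p)
          (TensorProduct.map (C.incl q) (C.incl r) ∘ₗ C.Δ (q + r) q r) t =
        TensorProduct.map (C.incl p) (TensorProduct.map (C.incl q) (C.incl r))
          ((C.Δ (q + r) q r).lTensor (C.X p) t) := by
      intro p q r t
      induction t using TensorProduct.induction_on with
      | zero => simp
      | add x y hx hy => simp only [map_add, hx, hy]
      | tmul x y => simp
    have h3 : ∀ pq ∈ antidiagonal n, TensorProduct.assoc k C.Tot C.Tot C.Tot
        (C.totΔ.rTensor C.Tot (TensorProduct.map (C.incl pq.1) (C.incl pq.2)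
          (C.Δ n pq.1 pq.2 c))) = ∑ b ∈ antidiagonal pq.1, F b.1 b.2 pq.2 := by
      rintro ⟨s, r⟩ -
      rw [← LinearMap.comp_apply, LinearMap.rTensor_comp_map, totΔ_comp_incl, map_sum_left, map_sum]
      refine Finset.sum_congr rfl ?_
      rintro ⟨p, q⟩ h
      rw [Finset.HasAntidiagonal.mem_antidiagonal] at h
      dsimp only at h ⊢
      subst h
      rw [h1, C.coassoc]
    have h4 : ∀ pq ∈ antidiagonal n,
        C.totΔ.lTensor C.Tot (TensorProduct.map (C.incl pq.1) (C.incl pq.2)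
          (C.Δ n pq.1 pq.2 c)) = ∑ b ∈ antidiagonal pq.2, F pq.1 b.1 b.2 := by
      rintro ⟨p, s⟩ -
      rw [← LinearMap.comp_apply, LinearMap.lTensor_comp_map, totΔ_comp_incl, map_sum_right]
      refine Finset.sum_congr rfl ?_
      rintro ⟨q, r⟩ h
      rw [Finset.HasAntidiagonal.mem_antidiagonal] at h
      dsimp only at h ⊢
      subst h
      rw [h2]
    rw [totΔ_incl]
    simp only [map_sum]
    rw [Finset.sum_congr rfl h3, Finset.sum_congr rfl h4]
    exact antidiagonal_triple_sum n F

lemma tot_maurerCartan (z : C.Tot) : C.cobarD (C.totτ z) + C.totτ (C.totD z) +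
    LinearMap.mul' k C.Cobar
      (TensorProduct.map (C.totτ ∘ₗ signOf C.totE) C.totτ (C.totΔ z)) = 0 := by
  induction z using C.tot_induction with
  | add x y hx hy =>
    simp only [map_add]
    rw [add_add_add_comm (C.cobarD _), add_add_add_comm, hx, hy, add_zero]
  | incl n c =>
    have h : ∀ p q (t : C.X p ⊗[k] C.X q), TensorProduct.map (C.totτ ∘ₗ signOf C.totE) C.totτ
        (TensorProduct.map (C.incl p) (C.incl q) t) =
        (-1 : k) ^ p • TensorProduct.map (C.twist p) (C.twist q) t := by
      intro p q t
      induction t using TensorProduct.induction_on with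
      | zero => simp
      | add x y hx hy => simp only [map_add, hx, hy, smul_add]
      | tmul x y => simp [signOf_totE_incl, totτ_incl, smul_tmul']
    have h0 : C.twist 0 = 0 := by simp [twist, gen]
    obtain _ | n := n
    · rw [totτ_incl, totD_incl_zero, totΔ_incl, map_sum, Finset.sum_congr rfl fun _ _ => h _ _ _]
      simp [h0]
    · rw [totτ_incl, totD_incl_succ, totΔ_incl, map_sum, Finset.sum_congr rfl fun _ _ => h _ _ _,
        totτ_incl, map_sum]
      simp only [map_smul]
      exact C.maurerCartan n c

/-- The twisted differential of `C ⊗_τ Ω C` on generators. -/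
def totδ : C.Tot →ₗ[k] C.Tot ⊗[k] C.Cobar :=
  (TensorProduct.mk k C.Tot C.Cobar).flip 1 ∘ₗ C.totD +
    TensorProduct.map (signOf C.totE) C.totτ ∘ₗ C.totΔ

lemma totδ_apply (z : C.Tot) : C.totδ z = C.totD z ⊗ₜ 1 +
    TensorProduct.map (signOf C.totE) C.totτ (C.totΔ z) := rfl

lemma signOf_totE_totD (z : C.Tot) : signOf C.totE (C.totD z) = -C.totD (signOf C.totE z) := by
  simp only [signOf_apply, totE_totD, map_sub, map_add]
  abel

lemma signOf_signOf_totE (z : C.Tot) : signOf C.totE (signOf C.totE z) = z := by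
  simp only [signOf_apply, map_sub, map_add, ProjGrading.e_e]
  abel

lemma twD_totδ (t : C.Tot ⊗[k] C.Tot) : C.cobarDG.self.twD C.totE C.totδ
      (TensorProduct.map (signOf C.totE) C.totτ t) =
    -TensorProduct.map (signOf C.totE) C.totτ (C.totD.rTensor C.Tot t) +
      (LinearMap.mul' k C.Cobar ∘ₗ TensorProduct.map (C.totτ ∘ₗ signOf C.totE) C.totτ).lTensor
        C.Tot (TensorProduct.assoc k C.Tot C.Tot C.Tot (C.totΔ.rTensor C.Tot t)) +
      (C.cobarD ∘ₗ C.totτ).lTensor C.Tot t := by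
  induction t using TensorProduct.induction_on with
  | zero => simp
  | add x y hx hy =>
    simp only [map_add, hx, hy]
    abel
  | tmul x y =>
    rw [map_tmul, DGAlg.Mod.twD_tmul, totδ_apply, signOf_signOf_totE, totΔ_signOf, map_add,
      DGAlg.Mod.dot_tmul, LinearMap.rTensor_tmul, LinearMap.rTensor_tmul, LinearMap.lTensor_tmul,
      map_tmul, signOf_totE_totD]
    congr 2
    · simp [neg_tmul]
    · generalize C.totΔ x = s
      induction s using TensorProduct.induction_on with
      | zero => simp
      | add x y hx hy => simp only [map_add, add_tmul, hx, hy]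
      | tmul a b => simp [signOf_signOf_totE, DGAlg.self]

/-- `C` as a semifree module `C ⊗_τ Ω C` over its cobar construction. -/
def twisted : C.cobarDG.Twisted C.Tot where
  toProjGrading := C.totGrading
  δ := C.totδ
  δ_e z := by
    have h : ∀ t, tensorEven C.totE C.cobarE (TensorProduct.map (signOf C.totE) C.totτ t) =
        TensorProduct.map (signOf C.totE) C.totτ (t - tensorEven C.totE C.totE t) := by
      intro t
      induction t using TensorProduct.induction_on with
      | zero => simp
      | add x y hx hy => simp only [map_add, hx, hy, add_sub_add_comm]
      | tmul x y =>
        simp only [tensorEven_tmul, map_tmul, cobarE_totτ, signOf_apply, map_sub, map_add,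
          tmul_sub, sub_tmul, add_tmul, ProjGrading.e_e]
        abel
    have h1 : tensorEven C.totE C.cobarE (C.totD z ⊗ₜ 1) = C.totE (C.totD z) ⊗ₜ 1 := by
      rw [tensorEven_tmul, show C.cobarE 1 = 1 from C.cobarDG.e_one]
      simp
    refine (congrArg (tensorEven C.totE C.cobarE) (C.totδ_apply z)).trans ?_
    rw [map_add, h, h1, totE_totD, totδ_apply]
    congr 2
    change _ = C.totΔ (z - C.totE z)
    rw [map_sub, totΔ_totE]
  δ_lower i j z hij := by
    have hq : ∀ n c, n ≠ j → C.totGrading.q j (C.incl n c) = 0 := fun n c hn => by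
      simp [totGrading, incl, DirectSum.component.of, hn]
    have h : ∀ p q, p + q = i → ∀ t : C.X p ⊗[k] C.X q, (C.totGrading.q j).rTensor C.Cobar
        (TensorProduct.map (signOf C.totE) C.totτ
          (TensorProduct.map (C.incl p) (C.incl q) t)) = 0 := by
      intro p q hpq t
      induction t using TensorProduct.induction_on with
      | zero => simp
      | add x y hx hy => simp only [map_add, hx, hy, add_zero]
      | tmul x y =>
        rw [map_tmul, map_tmul, signOf_totE_incl, LinearMap.rTensor_tmul, map_smul, totτ_incl]
        obtain _ | q := q
        · simp [twist, gen]
        · rw [hq p x (by omega), smul_zero, zero_tmul]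
    change (C.totGrading.q j).rTensor C.Cobar (C.totδ (C.incl i (DirectSum.component k ℕ C.X i z)))
      = 0
    generalize DirectSum.component k ℕ C.X i z = c
    rw [totδ_apply, map_add, totΔ_incl, map_sum, map_sum, Finset.sum_eq_zero fun pq hpq => h _ _
      (Finset.HasAntidiagonal.mem_antidiagonal.1 hpq) _, add_zero, LinearMap.rTensor_tmul]
    obtain _ | i := i
    · rw [totD_incl_zero, map_zero, zero_tmul]
    · rw [totD_incl_succ, hq _ _ (by omega), zero_tmul]
  mc z := by
    change C.cobarDG.self.twD C.totE C.totδ (C.totδ z) = 0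
    have h1 : C.cobarDG.self.twD C.totE C.totδ (C.totD z ⊗ₜ 1) = C.totδ (C.totD z) := by
      rw [DGAlg.Mod.twD_tmul, DGAlg.Mod.dot_one]
      simp [DGAlg.self, C.cobarDG.D_one]
    have h2 : ∀ t, TensorProduct.map (signOf C.totE) C.totτ
        (TensorProduct.map (signOf C.totE) C.totD t) = (C.totτ ∘ₗ C.totD).lTensor C.Tot t := by
      intro t
      induction t using TensorProduct.induction_on with
      | zero => simp
      | add x y hx hy => simp only [map_add, hx, hy]
      | tmul x y => simp [signOf_signOf_totE]
    have h3 := C.tot_maurerCartan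
    have h4 : (C.cobarD ∘ₗ C.totτ + C.totτ ∘ₗ C.totD + (LinearMap.mul' k C.Cobar ∘ₗ
      TensorProduct.map (C.totτ ∘ₗ signOf C.totE) C.totτ) ∘ₗ C.totΔ) = 0 := LinearMap.ext h3
    have h5 := congrArg (fun g => g.lTensor C.Tot (C.totΔ z)) h4
    simp only [LinearMap.lTensor_add, LinearMap.add_apply, LinearMap.lTensor_zero,
      LinearMap.zero_apply, LinearMap.lTensor_comp_apply] at h5
    rw [totδ_apply, map_add, h1, totδ_apply, totD_totD, zero_tmul, zero_add, twD_totδ, totΔ_totD, map_add, h2,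
      totΔ_coassoc]
    simp only [LinearMap.lTensor_comp_apply]
    rw [← h5]
    abel

end ConnDGCoalg

end

noncomputable section

namespace ConnDGCoalg

variable {k : Type v} [CommRing k] (C : ConnDGCoalg.{v, w} k)

/-! ### The contraction of `C ⊗_τ Ω C` -/

/-- The inclusion of the positive degree part. -/
def inclPos : C.Desusp →ₗ[k] C.Tot := DirectSum.toModule k ℕ _ fun n => C.incl (n + 1)

/-- The projection to the positive degree part. -/
def projPos : C.Tot →ₗ[k] C.Desusp :=
  DirectSum.toModule k ℕ _ fun
    | 0 => 0
    | n + 1 => DirectSum.lof k ℕ (fun n => C.X (n + 1)) n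

/-- The counit. -/
def totε : C.Tot →ₗ[k] k :=
  DirectSum.toModule k ℕ _ fun
    | 0 => C.ε
    | _ + 1 => 0

/-- The coaugmentation. -/
def totη : C.Tot := C.incl 0 ((LinearEquiv.ofBijective C.ε C.ε_bijective).symm 1)

lemma totε_incl_zero (c : C.X 0) : C.totε (C.incl 0 c) = C.ε c := by
  simp [totε, incl]

lemma totε_incl_succ (n : ℕ) (c : C.X (n + 1)) : C.totε (C.incl (n + 1) c) = 0 := by
  simp [totε, incl]

lemma totε_totη : C.totε C.totη = 1 := by
  rw [totη, totε_incl_zero]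
  exact (LinearEquiv.ofBijective C.ε C.ε_bijective).apply_symm_apply 1

lemma inclPos_projPos (z : C.Tot) : C.inclPos (C.projPos z) = z - C.totε z • C.totη := by
  induction z using C.tot_induction with
  | add x y hx hy =>
    simp only [map_add, hx, hy, add_smul]
    abel
  | incl n c =>
    obtain _ | n := n
    · have h : C.ε c • (LinearEquiv.ofBijective C.ε C.ε_bijective).symm 1 = c := by
        apply C.ε_bijective.1
        rw [map_smul, show C.ε ((LinearEquiv.ofBijective C.ε C.ε_bijective).symm 1) = 1 from
          (LinearEquiv.ofBijective C.ε C.ε_bijective).apply_symm_apply 1]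
        simp
      rw [totε_incl_zero, totη, ← map_smul, h, sub_self]
      simp [projPos, incl]
    · rw [totε_incl_succ]
      simp [projPos, inclPos, incl]

lemma totτ_eq (z : C.Tot) : C.totτ z = -TensorAlgebra.ι k (C.projPos z) := by
  induction z using C.tot_induction with
  | add x y hx hy =>
    simp only [map_add, hx, hy]
    abel
  | incl n c =>
    rw [totτ_incl]
    obtain _ | n := n
    · simp [twist, gen, projPos, incl]
    · simp [twist, gen, projPos, incl]

lemma totε_totD (z : C.Tot) : C.totε (C.totD z) = 0 := by
  induction z using C.tot_induction with
  | add x y hx hy => rw [map_add, map_add, hx, hy, add_zero]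
  | incl n c =>
    obtain _ | _ | n := n
    · simp [totD_incl_zero]
    · rw [totD_incl_succ, totε_incl_zero, C.ε_d]
    · rw [totD_incl_succ, totε_incl_succ]

lemma totε_signOf (z : C.Tot) : C.totε (signOf C.totE z) = C.totε z := by
  induction z using C.tot_induction with
  | add x y hx hy => rw [map_add, map_add, map_add, hx, hy]
  | incl n c =>
    rw [signOf_totE_incl, map_smul]
    obtain _ | n := n
    · simp
    · simp [totε_incl_succ]

lemma tot_counit {B : Type*} [AddCommGroup B] [Module k B] (g : C.Tot →ₗ[k] B) (z : C.Tot) :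
    TensorProduct.lid k B (TensorProduct.map C.totε g (C.totΔ z)) = g z := by
  induction z using C.tot_induction with
  | add x y hx hy => rw [map_add, map_add, map_add, map_add, hx, hy]
  | incl n c =>
    have h0 : ∀ t : C.X 0 ⊗[k] C.X n, TensorProduct.lid k B (TensorProduct.map C.totε g
        (TensorProduct.map (C.incl 0) (C.incl n) t)) =
        g (C.incl n (TensorProduct.lid k (C.X n) (C.ε.rTensor (C.X n) t))) := by
      intro t
      induction t using TensorProduct.induction_on with
      | zero => simp
      | add x y hx hy => simp only [map_add, hx, hy]
      | tmul x y => simp [totε_incl_zero]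
    have h1 : ∀ p q (t : C.X (p + 1) ⊗[k] C.X q), TensorProduct.map C.totε g
        (TensorProduct.map (C.incl (p + 1)) (C.incl q) t) = 0 := by
      intro p q t
      induction t using TensorProduct.induction_on with
      | zero => simp
      | add x y hx hy => simp only [map_add, hx, hy, add_zero]
      | tmul x y => simp [totε_incl_succ]
    rw [totΔ_incl, map_sum, map_sum, Finset.sum_eq_single (0, n)]
    · rw [h0, C.counit_left]
    · rintro ⟨p, q⟩ hpq hne
      rw [Finset.HasAntidiagonal.mem_antidiagonal] at hpq
      obtain _ | p := p
      · dsimp only at hpq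
        obtain rfl : q = n := by omega
        exact (hne rfl).elim
      · rw [h1, map_zero]
    · intro h
      exact (h (by simp)).elim

/-- Left multiplication by generators on `Ω C ⊕ s⁻¹ C̃ ⊗ Ω C`, keeping track of the first
letter. -/
def peelAlg : C.Cobar →ₐ[k] Module.End k (C.Cobar × C.Desusp ⊗[k] C.Cobar) :=
  TensorAlgebra.lift k
    { toFun := fun x => (LinearMap.mulLeft k (TensorAlgebra.ι k x) ∘ₗ LinearMap.fst k _ _).prod
        (TensorProduct.mk k _ _ x ∘ₗ LinearMap.fst k _ _)
      map_add' := fun x y => by ext <;> simp [add_mul]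
      map_smul' := fun r x => by ext <;> simp [smul_tmul'] }

/-- The map `[c₁ | … | cᵣ] ↦ c₁ ⊗ [c₂ | … | cᵣ]`. -/
def peel : C.Cobar →ₗ[k] C.Tot ⊗[k] C.Cobar :=
  C.inclPos.rTensor C.Cobar ∘ₗ LinearMap.snd k _ _ ∘ₗ
    LinearMap.applyₗ (1, 0) ∘ₗ C.peelAlg.toLinearMap

lemma peelAlg_fst (a : C.Cobar) : (C.peelAlg a (1, 0)).1 = a := by
  induction a using C.cobar_induction with
  | one => simp
  | gen_mul n c x ih =>
    rw [map_mul, Module.End.mul_apply]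
    simp only [peelAlg, gen_succ, TensorAlgebra.lift_ι_apply] at ih ⊢
    simp [ih]
  | add x y hx hy => rw [map_add, LinearMap.add_apply, Prod.fst_add, hx, hy]
  | smul r x hx => rw [map_smul, LinearMap.smul_apply, Prod.smul_fst, hx]

lemma peel_one : C.peel 1 = 0 := by
  simp [peel]

lemma peel_totτ_mul (z : C.Tot) (a : C.Cobar) :
    C.peel (C.totτ z * a) = C.totε z • C.totη ⊗ₜ a - z ⊗ₜ a := by
  have h : C.peel (TensorAlgebra.ι k (C.projPos z) * a) = C.inclPos (C.projPos z) ⊗ₜ a := by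
    have h1 := C.peelAlg_fst a
    simp only [peel, LinearMap.comp_apply, AlgHom.toLinearMap_apply, map_mul,
      LinearMap.applyₗ_apply_apply, Module.End.mul_apply]
    generalize C.peelAlg a (1, 0) = p at h1
    simp [peelAlg, h1]
  rw [totτ_eq, neg_mul, map_neg, h, inclPos_projPos, sub_tmul, smul_tmul', neg_sub]

lemma signOf_totτ (z : C.Tot) : signOf C.cobarE (C.totτ z) = -C.totτ (signOf C.totE z) := by
  simp only [signOf_apply, cobarE_totτ, map_sub, map_add]
  abel

lemma peel_mul'_mul (t : C.Tot ⊗[k] C.Tot) (a : C.Cobar) :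
    C.peel (LinearMap.mul' k C.Cobar (TensorProduct.map (C.totτ ∘ₗ signOf C.totE) C.totτ t) * a) =
      C.totη ⊗ₜ (TensorProduct.lid k C.Cobar (TensorProduct.map C.totε C.totτ t) * a) -
      C.cobarDG.self.dot C.Tot a (TensorProduct.map (signOf C.totE) C.totτ t) := by
  induction t using TensorProduct.induction_on with
  | zero => simp
  | add x y hx hy =>
    simp only [map_add, add_mul, hx, hy, tmul_add]
    abel
  | tmul x y => simp [mul_assoc, peel_totτ_mul, totε_signOf, DGAlg.self]

/-- The augmentation of the cobar construction. -/
abbrev cobarε : C.Cobar →ₐ[k] k := TensorAlgebra.algebraMapInv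

lemma peel_homotopy (a : C.Cobar) :
    C.peel (C.cobarD a) + C.twisted.d C.cobarDG.self (C.peel a) =
      C.cobarε a • C.totη ⊗ₜ 1 - C.totη ⊗ₜ a := by
  induction a using C.cobar_induction with
  | one => simp [cobarD_one, peel_one]
  | add x y hx hy =>
    simp only [map_add, add_smul, tmul_add]
    rw [add_add_add_comm, hx, hy]
    abel
  | smul r x hx =>
    rw [map_smul, map_smul, map_smul, map_smul, map_smul, ← smul_add, hx, smul_sub, tmul_smul,
      smul_assoc]
  | gen_mul n c x ih =>
    clear ih
    have hc : C.gen (n + 1) c = -C.totτ (C.incl (n + 1) c) := by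
      rw [totτ_incl, twist, LinearMap.neg_apply, neg_neg]
    have hε : C.totε (C.incl (n + 1) c) = 0 := C.totε_incl_succ n c
    rw [hc]
    generalize C.incl (n + 1) c = z at hε
    have h1 : C.cobarε (C.totτ z * x) = 0 := by
      rw [totτ_eq, map_mul, map_neg]
      simp [cobarε, TensorAlgebra.algebraMapInv]
    have h2 := C.tot_maurerCartan z
    have h3 : C.cobarD (C.totτ z) = -C.totτ (C.totD z) -
        LinearMap.mul' k C.Cobar (TensorProduct.map (C.totτ ∘ₗ signOf C.totE) C.totτ
          (C.totΔ z)) := by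
      rw [← sub_eq_zero, ← h2]
      abel
    have h4 : C.twisted.d C.cobarDG.self (z ⊗ₜ x) =
        C.cobarDG.self.dot C.Tot x (C.totδ z) + signOf C.totE z ⊗ₜ C.cobarD x :=
      DGAlg.Mod.twD_tmul _ _ _ _ _
    rw [neg_mul, map_neg, map_neg, map_neg, map_neg, map_neg, h1, neg_zero, zero_smul, tmul_neg,
      cobarD_mul,
      h3, ← signOf_cobarE, signOf_totτ, peel_totτ_mul, sub_mul, neg_mul, neg_mul, map_add, map_sub,
      map_neg, map_neg, peel_totτ_mul, peel_totτ_mul, peel_mul'_mul, tot_counit, totε_totD,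
      totε_signOf, hε, map_sub, h4, totδ_apply, map_add, DGAlg.Mod.dot_tmul]
    simp [DGAlg.self]
    abel

/-- The map `c ⊗ a ↦ ε(c) a`. -/
def counitTensor : C.Tot ⊗[k] C.Cobar →ₗ[k] C.Cobar :=
  (TensorProduct.lid k C.Cobar).toLinearMap ∘ₗ C.totε.rTensor C.Cobar

lemma counitTensor_tmul (z : C.Tot) (a : C.Cobar) : C.counitTensor (z ⊗ₜ a) = C.totε z • a := by
  simp [counitTensor]

lemma counitTensor_twD_tmul (z : C.Tot) (a : C.Cobar) :
    C.counitTensor (C.twisted.d C.cobarDG.self (z ⊗ₜ a)) =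
      C.totτ z * a + C.totε z • C.cobarD a := by
  have h4 : C.twisted.d C.cobarDG.self (z ⊗ₜ a) =
      C.cobarDG.self.dot C.Tot a (C.totδ z) + signOf C.totE z ⊗ₜ C.cobarD a :=
    DGAlg.Mod.twD_tmul _ _ _ _ _
  have h5 : ∀ t, C.counitTensor (C.cobarDG.self.dot C.Tot a
      (TensorProduct.map (signOf C.totE) C.totτ t)) =
      TensorProduct.lid k C.Cobar (TensorProduct.map C.totε C.totτ t) * a := by
    intro t
    induction t using TensorProduct.induction_on with
    | zero => simp
    | add x y hx hy => simp only [map_add, add_mul, hx, hy]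
    | tmul x y => simp [counitTensor_tmul, totε_signOf, DGAlg.self]
  rw [h4, totδ_apply, map_add, map_add, map_add, h5, tot_counit, DGAlg.Mod.dot_tmul,
    counitTensor_tmul, counitTensor_tmul, totε_totD, totε_signOf, zero_smul, zero_add]

lemma counit_homotopy (y : C.Tot ⊗[k] C.Cobar) :
    C.twisted.d C.cobarDG.self (-C.peel (C.counitTensor y)) -
      C.peel (C.counitTensor (C.twisted.d C.cobarDG.self y)) =
    y - C.cobarε (C.counitTensor y) • C.totη ⊗ₜ 1 := by
  induction y using TensorProduct.induction_on with
  | zero => simp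
  | add x y hx hy =>
    simp only [map_add, map_neg, add_smul] at hx hy ⊢
    rw [neg_add, add_sub_add_comm, hx, hy]
    abel
  | tmul z a =>
    have h := C.peel_homotopy a
    rw [counitTensor_twD_tmul, map_add, peel_totτ_mul, counitTensor_tmul, map_neg, map_smul,
      map_smul, map_smul, map_smul, eq_sub_of_add_eq' h]
    simp only [smul_sub, smul_assoc]
    abel

lemma d_totη : C.twisted.d C.cobarDG.self (C.totη ⊗ₜ 1) = 0 := by
  rw [DGAlg.Twisted.d_tmul_one]
  change C.totδ (C.incl 0 _) = 0
  generalize (LinearEquiv.ofBijective C.ε C.ε_bijective).symm 1 = c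
  have h : ∀ t, TensorProduct.map (signOf C.totE) C.totτ
      (TensorProduct.map (C.incl 0) (C.incl 0) t) = 0 := by
    intro t
    induction t using TensorProduct.induction_on with
    | zero => simp
    | add x y hx hy => simp only [map_add, hx, hy, add_zero]
    | tmul x y => simp [totτ_incl, twist, gen]
  rw [totδ_apply, totD_incl_zero, totΔ_incl]
  simp [h]

/-- The inclusion of `k` in `C ⊗_τ Ω C`. -/
def twistedUnit : k →ₗ[k] C.Tot ⊗[k] C.Cobar := LinearMap.toSpanSingleton k _ (C.totη ⊗ₜ 1)

/-- The complex `C ⊗_τ Ω C` is a resolution of `k`. -/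
theorem isQis_twistedUnit :
    IsQis (0 : k →ₗ[k] k) (C.twisted.d C.cobarDG.self) C.twistedUnit := by
  have hp : C.cobarε (C.counitTensor (C.totη ⊗ₜ 1)) = 1 := by
    simp [counitTensor_tmul, totε_totη]
  have hpd : ∀ y, C.cobarε (C.counitTensor (C.twisted.d C.cobarDG.self y)) = 0 := by
    intro y
    have h1 := C.counit_homotopy (C.twisted.d C.cobarDG.self y)
    have h2 := congrArg (C.twisted.d C.cobarDG.self) (C.counit_homotopy y)
    rw [map_sub, map_sub, C.twisted.d_d, map_smul, C.d_totη, smul_zero, sub_zero, zero_sub] at h2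
    rw [C.twisted.d_d, map_zero, map_zero, sub_zero, map_neg, h2] at h1
    have h3 := congrArg (fun t => C.cobarε (C.counitTensor t)) (sub_eq_self.1 h1.symm)
    simpa [hp] using h3
  intro r y _ hy
  refine ⟨C.cobarε (C.counitTensor y), C.peel (C.counitTensor y), ?_, ?_⟩
  · have h := congrArg (fun t => C.cobarε (C.counitTensor t)) hy
    simp only [twistedUnit, LinearMap.toSpanSingleton_apply, map_smul, hp, hpd] at h
    simpa using h.symm
  · have h := C.counit_homotopy y
    rw [← hy] at h
    have h' : C.peel (C.counitTensor (C.twistedUnit r)) = 0 := by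
      simp [twistedUnit, counitTensor_tmul, peel_one]
    rw [h', sub_zero, map_neg] at h
    rw [twistedUnit, LinearMap.toSpanSingleton_apply, sub_eq_add_neg, h]
    abel

/-! ### Functoriality -/

namespace Hom

variable {C} {C' : ConnDGCoalg.{v, w} k} (φ : Hom C C')

/-- The map of total coalgebras. -/
def tot : C.Tot →ₗ[k] C'.Tot := DirectSum.toModule k ℕ _ fun n => C'.incl n ∘ₗ φ.f n

lemma tot_incl (n : ℕ) (c : C.X n) : φ.tot (C.incl n c) = C'.incl n (φ.f n c) := by
  simp [tot, incl]

lemma tot_q (i : ℕ) (z : C.Tot) : φ.tot (C.totGrading.q i z) = C'.totGrading.q i (φ.tot z) := by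
  induction z using C.tot_induction with
  | add x y hx hy => simp only [map_add, hx, hy]
  | incl n c =>
    rw [tot_incl]
    simp only [totGrading, LinearMap.comp_apply, incl, DirectSum.component.of]
    split_ifs with h
    · subst h
      exact φ.tot_incl n c
    · simp

lemma tot_totE (z : C.Tot) : φ.tot (C.totE z) = C'.totE (φ.tot z) := by
  induction z using C.tot_induction with
  | add x y hx hy => simp only [map_add, hx, hy]
  | incl n c =>
    rw [tot_incl, totE_incl, totE_incl]
    split_ifs <;> simp [tot_incl]

lemma tot_totD (z : C.Tot) : φ.tot (C.totD z) = C'.totD (φ.tot z) := by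
  induction z using C.tot_induction with
  | add x y hx hy => simp only [map_add, hx, hy]
  | incl n c =>
    rw [tot_incl]
    obtain _ | n := n
    · simp [totD_incl_zero]
    · rw [totD_incl_succ, totD_incl_succ, tot_incl, φ.f_d]

lemma totΔ_tot (z : C.Tot) : C'.totΔ (φ.tot z) = TensorProduct.map φ.tot φ.tot (C.totΔ z) := by
  induction z using C.tot_induction with
  | add x y hx hy => simp only [map_add, hx, hy]
  | incl n c =>
    have h : ∀ p q (t : C.X p ⊗[k] C.X q), TensorProduct.map φ.tot φ.tot
        (TensorProduct.map (C.incl p) (C.incl q) t) =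
        TensorProduct.map (C'.incl p) (C'.incl q) (TensorProduct.map (φ.f p) (φ.f q) t) := by
      intro p q t
      induction t using TensorProduct.induction_on with
      | zero => simp
      | add x y hx hy => simp only [map_add, hx, hy]
      | tmul x y => simp [tot_incl]
    simp only [tot_incl, totΔ_incl, map_sum, h, φ.f_Δ]

lemma totτ_tot (z : C.Tot) : C'.totτ (φ.tot z) = φ.cobarMap (C.totτ z) := by
  induction z using C.tot_induction with
  | add x y hx hy => simp only [map_add, hx, hy]
  | incl n c => simp [tot_incl, totτ_incl, twist, cobarMap_gen]

lemma tot_totη : φ.tot C.totη = C'.totη := by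
  rw [totη, tot_incl, totη]
  congr 1
  apply C'.ε_bijective.1
  rw [φ.f_ε]
  exact ((LinearEquiv.ofBijective C.ε C.ε_bijective).apply_symm_apply 1).trans
    ((LinearEquiv.ofBijective C'.ε C'.ε_bijective).apply_symm_apply 1).symm

lemma rTensor_totδ (z : C.Tot) : φ.tot.rTensor C'.Cobar
    (φ.cobarMap.toLinearMap.lTensor C.Tot (C.totδ z)) = C'.totδ (φ.tot z) := by
  have h : ∀ t, φ.tot.rTensor C'.Cobar (φ.cobarMap.toLinearMap.lTensor C.Tot
      (TensorProduct.map (signOf C.totE) C.totτ t)) =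
      TensorProduct.map (signOf C'.totE) C'.totτ (TensorProduct.map φ.tot φ.tot t) := by
    intro t
    induction t using TensorProduct.induction_on with
    | zero => simp
    | add x y hx hy => simp only [map_add, hx, hy]
    | tmul x y => simp [totτ_tot, signOf_apply, tot_totE]
  rw [totδ_apply, totδ_apply, map_add, map_add, h, totΔ_tot]
  simp [tot_totD]

/-- The semifree module `C ⊗_τ Ω C'`. -/
def twisted : C'.cobarDG.Twisted C.Tot :=
  C.twisted.map φ.cobarMap φ.cobarMap_cobarD φ.cobarMap_cobarE

lemma twisted_d {B : Type*} [AddCommGroup B] [Module k B] (ρ : C'.cobarDG.Mod B) :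
    φ.twisted.d ρ = C.twisted.d (ρ.restrict (R := C.cobarDG) (R' := C'.cobarDG) φ.cobarMap
      φ.cobarMap_cobarD φ.cobarMap_cobarE) :=
  LinearMap.ext fun x => DGAlg.Twisted.lTensor_twD φ.cobarMap φ.cobarMap_cobarD
    φ.cobarMap_cobarE C.totE C.totδ x ρ

/-- If `Ω φ` is a quasi-isomorphism, then so is `C ⊗_τ B → C' ⊗_τ B` for every left dg module `B`
over `Ω C'`. -/
theorem isQis_rTensor_tot [∀ n, Module.Projective k (C.X n)] [∀ n, Module.Projective k (C'.X n)]
    (hφ : IsQis C.cobarD C'.cobarD φ.cobarMap.toLinearMap)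
    {B : Type*} [AddCommGroup B] [Module k B] (ρ : C'.cobarDG.Mod B) :
    IsQis (φ.twisted.d ρ) (C'.twisted.d ρ) (φ.tot.rTensor B) := by
  have hq : ∀ i z, φ.tot (φ.twisted.q i z) = C'.twisted.q i (φ.tot z) := φ.tot_q
  have hδ : ∀ z, φ.tot.rTensor C'.Cobar (φ.twisted.δ z) = C'.twisted.δ (φ.tot z) :=
    φ.rTensor_totδ
  refine DGAlg.Twisted.isQis_rTensor_of_self φ.twisted ρ C'.twisted hq hδ ?_
  let ρ' := C'.cobarDG.self.restrict (R := C.cobarDG) (R' := C'.cobarDG) φ.cobarMap φ.cobarMap_cobarD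
    φ.cobarMap_cobarE
  have hact : ∀ a b, φ.cobarMap.toLinearMap (C.cobarDG.self.act a b) =
      ρ'.act a (φ.cobarMap.toLinearMap b) := fun a b => map_mul φ.cobarMap a b
  have h1 : IsQis (C.twisted.d C.cobarDG.self) (φ.twisted.d C'.cobarDG.self)
      (φ.cobarMap.toLinearMap.lTensor C.Tot) := by
    rw [twisted_d]
    exact C.twisted.isQis_lTensor C.cobarDG.self ρ' hact φ.cobarMap_cobarD hφ
  have h1d : ∀ x, φ.cobarMap.toLinearMap.lTensor C.Tot (C.twisted.d C.cobarDG.self x) =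
      φ.twisted.d C'.cobarDG.self (φ.cobarMap.toLinearMap.lTensor C.Tot x) := by
    rw [twisted_d]
    exact C.twisted.lTensor_d C.cobarDG.self ρ' hact φ.cobarMap_cobarD
  have hu : ∀ r, C.twistedUnit ((0 : k →ₗ[k] k) r) =
      C.twisted.d C.cobarDG.self (C.twistedUnit r) := by
    intro r
    simp only [LinearMap.zero_apply, map_zero, twistedUnit, LinearMap.toSpanSingleton_apply,
      map_smul, C.d_totη, smul_zero]
  have h2 := C.isQis_twistedUnit.comp h1 hu h1d
  refine h2.of_comp ?_ ?_ fun y => ?_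
  · have h3 : φ.tot.rTensor C'.Cobar ∘ₗ φ.cobarMap.toLinearMap.lTensor C.Tot ∘ₗ C.twistedUnit =
        C'.twistedUnit := by
      ext
      simp [twistedUnit, tot_totη]
    rw [h3]
    exact C'.isQis_twistedUnit
  · intro r
    rw [LinearMap.comp_apply, hu, h1d]
    rfl
  · exact DGAlg.Twisted.map_d φ.twisted C'.cobarDG.self C'.twisted φ.tot hq hδ y

end Hom

end ConnDGCoalg

end

noncomputable section

section ElementwiseQuasiIso

variable {k : Type v} [CommRing k]

lemma shortComplex_quasiIso_iff {S₁ S₂ : ShortComplex (ModuleCat.{w} k)} (φ : S₁ ⟶ S₂) :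
    ShortComplex.QuasiIso φ ↔
      (∀ x y, S₁.g x = 0 → φ.τ₂ x = S₂.f y → ∃ x', S₁.f x' = x) ∧
      (∀ y, S₂.g y = 0 → ∃ x z, S₁.g x = 0 ∧ φ.τ₂ x - S₂.f z = y) := by
  let γ : ShortComplex.LeftHomologyMapData φ S₁.moduleCatLeftHomologyData
    S₂.moduleCatLeftHomologyData := default
  rw [γ.quasiIso_iff, ConcreteCategory.isIso_iff_bijective]
  have hK : ∀ x : LinearMap.ker S₁.g.hom, (γ.φK x : LinearMap.ker S₂.g.hom).1 = φ.τ₂ x.1 :=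
    fun x => LinearMap.congr_fun (congrArg ModuleCat.Hom.hom γ.commi) x
  have hH : ∀ x : LinearMap.ker S₁.g.hom,
      γ.φH ((LinearMap.range S₁.moduleCatToCycles).mkQ x) =
        (LinearMap.range S₂.moduleCatToCycles).mkQ (γ.φK x : LinearMap.ker S₂.g.hom) :=
    fun x => ConcreteCategory.congr_hom γ.commπ x
  constructor
  · rintro ⟨hi, hs⟩
    constructor
    · intro x y hx hy
      have h : (LinearMap.range S₁.moduleCatToCycles).mkQ ⟨x, hx⟩ = 0 := by
        apply hi
        refine ((hH ⟨x, hx⟩).trans ?_).trans (map_zero γ.φH.hom).symm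
        exact (Submodule.Quotient.mk_eq_zero _).2
          ⟨y, Subtype.ext (hy.symm.trans (hK ⟨x, hx⟩).symm)⟩
      obtain ⟨x', hx'⟩ := (Submodule.Quotient.mk_eq_zero _).1 h
      exact ⟨x', congrArg Subtype.val hx'⟩
    · intro y hy
      obtain ⟨t, ht⟩ := hs ((LinearMap.range S₂.moduleCatToCycles).mkQ ⟨y, hy⟩)
      obtain ⟨x, rfl⟩ := Submodule.mkQ_surjective _ t
      have h := (hH x).symm.trans ht
      obtain ⟨z, hz⟩ := (Submodule.Quotient.eq _).1 h
      refine ⟨x.1, z, x.2, ?_⟩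
      have hz' : S₂.f z = (γ.φK x : LinearMap.ker S₂.g.hom).1 - y := congrArg Subtype.val hz
      rw [hz', hK, sub_sub_cancel]
  · rintro ⟨hi, hs⟩
    constructor
    · refine (injective_iff_map_eq_zero γ.φH.hom).2 fun t ht => ?_
      obtain ⟨x, rfl⟩ := Submodule.mkQ_surjective _ t
      obtain ⟨y, hy⟩ := (Submodule.Quotient.mk_eq_zero _).1 ((hH x).symm.trans ht)
      obtain ⟨x', hx'⟩ := hi x.1 y x.2 ((hK x).symm.trans (congrArg Subtype.val hy).symm)
      exact (Submodule.Quotient.mk_eq_zero _).2 ⟨x', Subtype.ext hx'⟩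
    · intro t
      obtain ⟨y, rfl⟩ := Submodule.mkQ_surjective _ t
      obtain ⟨x, z, hx, hz⟩ := hs y.1 y.2
      refine ⟨(LinearMap.range S₁.moduleCatToCycles).mkQ ⟨x, hx⟩, (hH ⟨x, hx⟩).trans ?_⟩
      refine (Submodule.Quotient.eq _).2 ⟨z, Subtype.ext ?_⟩
      change S₂.f z = (γ.φK ⟨x, hx⟩ : LinearMap.ker S₂.g.hom).1 - y.1
      rw [hK, ← hz, sub_sub_cancel]

/-- A map of nonnegatively graded chain complexes of modules is a quasi-isomorphism if and only if
its mapping cone is acyclic. -/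
lemma chainComplex_quasiIso_iff {K L : ChainComplex (ModuleCat.{w} k) ℕ} (f : K ⟶ L) :
    QuasiIso f ↔ (∀ y : L.X 0, ∃ (x' : K.X 0) (y' : L.X 1), f.f 0 x' - L.d 1 0 y' = y) ∧
      ∀ n (x : K.X n) (y : L.X (n + 1)), K.d n (n - 1) x = 0 → f.f n x = L.d (n + 1) n y →
        ∃ (x' : K.X (n + 1)) (y' : L.X (n + 2)), K.d (n + 1) n x' = x ∧
          f.f (n + 1) x' - L.d (n + 2) (n + 1) y' = y := by
  have hcomm : ∀ n (x : K.X (n + 1)), f.f n (K.d (n + 1) n x) = L.d (n + 1) n (f.f (n + 1) x) :=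
    fun n x => (ConcreteCategory.congr_hom (f.comm (n + 1) n) x).symm
  have hdd : ∀ n (x : K.X (n + 2)), K.d (n + 1) n (K.d (n + 2) (n + 1) x) = 0 :=
    fun n x => ConcreteCategory.congr_hom (K.d_comp_d (n + 2) (n + 1) n) x
  have h : QuasiIso f ↔ ∀ n,
      (∀ (x : K.X n) (y : L.X (n + 1)), K.d n (n - 1) x = 0 → f.f n x = L.d (n + 1) n y →
        ∃ x', K.d (n + 1) n x' = x) ∧
      (∀ y : L.X n, L.d n (n - 1) y = 0 → ∃ (x : K.X n) (z : L.X (n + 1)), K.d n (n - 1) x = 0 ∧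
        f.f n x - L.d (n + 1) n z = y) := by
    rw [quasiIso_iff]
    refine forall_congr' fun n => ?_
    rw [quasiIsoAt_iff' f (n + 1) n (n - 1) (by simp) (by cases n <;> simp),
      shortComplex_quasiIso_iff]
    rfl
  have hL0 : ∀ y : L.X 0, L.d 0 (0 - 1) y = 0 := fun y =>
    ConcreteCategory.congr_hom (L.shape 0 (0 - 1) (by simp)) y
  have hK0 : ∀ y : K.X 0, K.d 0 (0 - 1) y = 0 := fun y =>
    ConcreteCategory.congr_hom (K.shape 0 (0 - 1) (by simp)) y
  rw [h]
  constructor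
  · intro h
    constructor
    · intro y
      obtain ⟨x, z, -, hz⟩ := (h 0).2 y (hL0 y)
      exact ⟨x, z, hz⟩
    · intro n x y hx hy
      obtain ⟨x₀, hx₀⟩ := (h n).1 x y hx hy
      obtain ⟨x₁, z, hx₁, hz⟩ := (h (n + 1)).2 (f.f (n + 1) x₀ - y) (by
        change L.d (n + 1) n _ = 0
        rw [map_sub, ← hcomm, hx₀, hy, sub_self])
      refine ⟨x₀ - x₁, -z, ?_, ?_⟩
      · rw [map_sub, hx₀, show K.d (n + 1) n x₁ = 0 from hx₁, sub_zero]
      · rw [map_sub, map_neg, sub_neg_eq_add, ← sub_eq_zero, ← sub_self y, ← sub_eq_zero]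
        rw [sub_eq_iff_eq_add] at hz
        rw [hz]
        abel
  · rintro ⟨h0, h⟩ n
    constructor
    · intro x y hx hy
      obtain ⟨x', -, hx', -⟩ := h n x y hx hy
      exact ⟨x', hx'⟩
    · intro y hy
      obtain _ | n := n
      · obtain ⟨x, z, hz⟩ := h0 y
        exact ⟨x, z, hK0 x, hz⟩
      · obtain ⟨x, z, hx, hz⟩ := h n 0 y (map_zero _) (by rw [map_zero]; exact hy.symm)
        exact ⟨x, z, hx, hz⟩

end ElementwiseQuasiIso

namespace ConnDGCoalg

variable {k : Type v} [CommRing k]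

namespace Hom

variable {C C' : ConnDGCoalg.{v, w} k} (φ : Hom C C')

lemma isQis_cobarMap (hφ : φ.IsOmegaQuasiIso) :
    IsQis C.cobarD C'.cobarD φ.cobarMap.toLinearMap := by
  obtain ⟨h0, h⟩ := (chainComplex_quasiIso_iff _).1 hφ
  intro x y hx hy
  obtain ⟨x₀, y₀, h1⟩ := h0 ⟨C'.cobarQ 0 y, C'.cobarQ_mem 0 y⟩
  have h1' : φ.cobarMap x₀.1 - C'.cobarD y₀.1 = C'.cobarQ 0 y := by
    rw [cobarComplex_d] at h1
    exact congrArg Subtype.val h1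
  have h2 : ∀ n, ∃ (x' : C.cobarDeg (n + 1)) (y' : C'.cobarDeg (n + 2)),
      C.cobarD x'.1 = C.cobarQ n x ∧ φ.cobarMap x'.1 - C'.cobarD y'.1 = C'.cobarQ (n + 1) y := by
    intro n
    obtain ⟨x', y', h3, h4⟩ := h n ⟨C.cobarQ n x, C.cobarQ_mem n x⟩
      ⟨C'.cobarQ (n + 1) y, C'.cobarQ_mem (n + 1) y⟩ (by
        obtain _ | n := n
        · exact ConcreteCategory.congr_hom (C.cobarComplex.shape 0 (0 - 1) (by simp)) _
        · change C.cobarComplex.d (n + 1) n _ = 0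
          rw [cobarComplex_d]
          refine Subtype.ext ?_
          change C.cobarD (C.cobarQ (n + 1) x) = 0
          rw [cobarD_cobarQ_succ, hx, map_zero]) (by
        rw [cobarComplex_d]
        refine Subtype.ext ?_
        change φ.cobarMap (C.cobarQ n x) = C'.cobarD (C'.cobarQ (n + 1) y)
        rw [cobarD_cobarQ_succ, cobarMap_cobarQ, ← hy]
        rfl)
    rw [cobarComplex_d] at h3 h4
    exact ⟨x', y', congrArg Subtype.val h3, congrArg Subtype.val h4⟩
  choose x' y' h3 h4 using h2
  obtain ⟨n, hn⟩ := C.exists_cobar_eq_sum x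
  obtain ⟨m, hm⟩ := C'.exists_cobar_eq_sum y
  have h0' : C.cobarD x₀.1 = 0 := C.cobarD_of_mem_zero x₀.2
  refine ⟨∑ i ∈ Finset.range (max n m), (x' i).1 + x₀.1,
    ∑ i ∈ Finset.range (max n m), (y' i).1 + y₀.1, ?_, ?_⟩
  · rw [map_add, map_sum, h0', add_zero, Finset.sum_congr rfl fun i _ => h3 i]
    exact (hn _ (le_max_left n m)).symm
  · rw [map_add, map_add, map_sum, map_sum, add_sub_add_comm, ← Finset.sum_sub_distrib]
    change ∑ i ∈ Finset.range (max n m), (φ.cobarMap (x' i).1 - C'.cobarD (y' i).1) +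
      (φ.cobarMap x₀.1 - C'.cobarD y₀.1) = y
    rw [h1', Finset.sum_congr rfl fun i _ => h4 i]
    exact (Finset.sum_range_succ' (fun i => C'.cobarQ i y) _).symm.trans
      (hm _ ((le_max_right n m).trans (Nat.le_succ _))).symm

end Hom

variable {C : ConnDGCoalg.{v, w} k} {M : Type w'} [AddCommGroup M] [Module k M]

/-- A module in degree `0` as a dg module. -/
def DegZeroAction.toMod (ρ : C.DegZeroAction M) : C.cobarDG.Mod M where
  act := ρ.act
  d := 0
  d_d b := rfl
  d_act a b := by
    rw [show ρ.act (C.cobarDG.D a) = 0 from ρ.act_D a]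
    simp

lemma DegZeroAction.act_totτ (ρ : C.DegZeroAction M) (n : ℕ) (hn : n ≠ 1) (c : C.X n) :
    ρ.act (C.totτ (C.incl n c)) = 0 := by
  rw [totτ_incl]
  obtain _ | _ | n := n
  · simp [twist, gen]
  · exact absurd rfl hn
  · exact ρ.act_pos n _ (neg_mem (C.gen_mem_cobarDeg (n + 1) c))

lemma DegZeroAction.twisted_d_incl_zero (ρ : C.DegZeroAction M) (x : C.X 0 ⊗[k] M) :
    C.twisted.d ρ.toMod ((C.incl 0).rTensor M x) = 0 := by
  induction x using TensorProduct.induction_on with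
  | zero => simp
  | add x y hx hy => rw [map_add, map_add, hx, hy, add_zero]
  | tmul c m =>
    have h : ∀ t, ρ.toMod.dot C.Tot m (TensorProduct.map (signOf C.totE) C.totτ
        (TensorProduct.map (C.incl 0) (C.incl 0) t)) = 0 := by
      intro t
      induction t using TensorProduct.induction_on with
      | zero => simp
      | add x y hx hy => simp only [map_add, hx, hy, add_zero]
      | tmul x y => simp [toMod, ρ.act_totτ 0]
    refine (DGAlg.Mod.twD_tmul _ _ _ _ _).trans ?_
    change ρ.toMod.dot C.Tot m (C.totδ (C.incl 0 c)) + _ ⊗ₜ 0 = 0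
    rw [totδ_apply, totD_incl_zero, totΔ_incl]
    simp [h]

lemma DegZeroAction.twisted_d_incl_succ (ρ : C.DegZeroAction M) (n : ℕ)
    (x : C.X (n + 1) ⊗[k] M) : C.twisted.d ρ.toMod ((C.incl (n + 1)).rTensor M x) =
      (C.incl n).rTensor M (ρ.twistedD n x) := by
  induction x using TensorProduct.induction_on with
  | zero => simp
  | add x y hx hy => simp only [map_add, hx, hy]
  | tmul c m =>
    have h : ∀ p q, q ≠ 1 → ∀ t, ρ.toMod.dot C.Tot m
        (TensorProduct.map (signOf C.totE) C.totτ
          (TensorProduct.map (C.incl p) (C.incl q) t)) = 0 := by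
      intro p q hq t
      induction t using TensorProduct.induction_on with
      | zero => simp
      | add x y hx hy => simp only [map_add, hx, hy, add_zero]
      | tmul x y => simp [toMod, ρ.act_totτ q hq]
    have h' : ∀ t : C.X n ⊗[k] C.X 1, ρ.toMod.dot C.Tot m
        (TensorProduct.map (signOf C.totE) C.totτ
          (TensorProduct.map (C.incl n) (C.incl 1) t)) =
        (C.incl n).rTensor M ((-1 : k) ^ n • (ρ.twAt m).lTensor (C.X n) t) := by
      intro t
      induction t using TensorProduct.induction_on with
      | zero => simp
      | add x y hx hy => simp only [map_add, hx, hy, smul_add]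
      | tmul x y =>
        simp [signOf_totE_incl, totτ_incl, toMod, twAt, tw, smul_tmul']
    refine (DGAlg.Mod.twD_tmul _ _ _ _ _).trans ?_
    change ρ.toMod.dot C.Tot m (C.totδ (C.incl (n + 1) c)) + _ ⊗ₜ 0 = _
    rw [totδ_apply, totD_incl_succ, totΔ_incl, twistedD_tmul, tmul_zero, add_zero, map_add,
      map_add, map_sum, map_sum, Finset.sum_eq_single (n, 1), h', DGAlg.Mod.dot_tmul, map_one,
      Module.End.one_apply, LinearMap.rTensor_tmul]
    · rintro ⟨p, q⟩ hpq hne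
      rw [Finset.HasAntidiagonal.mem_antidiagonal] at hpq
      dsimp only at hpq
      refine h p q ?_ _
      rintro rfl
      exact hne (by rw [show p = n by omega])
    · intro h
      exact (h (by simp)).elim

/-- If `Ω φ` is a quasi-isomorphism, then so is `C ⊗_τ M → C' ⊗_τ M`. -/
theorem Hom.quasiIso_twistedMap {C' : ConnDGCoalg.{v, w} k} [∀ n, Module.Projective k (C.X n)]
    [∀ n, Module.Projective k (C'.X n)] (φ : Hom C C') (hφ : φ.IsOmegaQuasiIso)
    (ρ : C.DegZeroAction M) (ρ' : C'.DegZeroAction M)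
    (h : ∀ x, ρ.act x = ρ'.act (φ.cobarMap x)) : QuasiIso (φ.twistedMap ρ ρ' h) := by
  have key := φ.isQis_rTensor_tot (φ.isQis_cobarMap hφ) ρ'.toMod
  have hρ : ρ'.toMod.restrict (R := C.cobarDG) (R' := C'.cobarDG) φ.cobarMap φ.cobarMap_cobarD
      φ.cobarMap_cobarE = ρ.toMod := by
    have : ρ'.act.comp φ.cobarMap = ρ.act := AlgHom.ext fun x => (h x).symm
    simp only [DGAlg.Mod.restrict, DegZeroAction.toMod, this]
  rw [twisted_d, hρ] at key
  have hφincl : ∀ n (x : C.X n ⊗[k] M), φ.tot.rTensor M ((C.incl n).rTensor M x) =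
      (C'.incl n).rTensor M ((φ.f n).rTensor M x) := by
    intro n x
    rw [← LinearMap.rTensor_comp_apply, ← LinearMap.rTensor_comp_apply]
    congr 2
    exact LinearMap.ext fun c => φ.tot_incl n c
  have hcomp : ∀ (C : ConnDGCoalg.{v, w} k) n (x : C.X n ⊗[k] M),
      (DirectSum.component k ℕ C.X n).rTensor M ((C.incl n).rTensor M x) = x := by
    intro C n x
    rw [← LinearMap.rTensor_comp_apply, show DirectSum.component k ℕ C.X n ∘ₗ C.incl n =
      LinearMap.id from LinearMap.ext fun c => DirectSum.component.lof_self k n c]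
    simp
  have hcomp' : ∀ (C : ConnDGCoalg.{v, w} k) n m (_ : n ≠ m) (x : C.X n ⊗[k] M),
      (DirectSum.component k ℕ C.X m).rTensor M ((C.incl n).rTensor M x) = 0 := by
    intro C n m hnm x
    rw [← LinearMap.rTensor_comp_apply, show DirectSum.component k ℕ C.X m ∘ₗ C.incl n =
      0 from LinearMap.ext fun c => by simp [incl, DirectSum.component.of, hnm]]
    simp
  have hind : ∀ (C : ConnDGCoalg.{v, w} k) {P : C.Tot ⊗[k] M → Prop}
      (_ : ∀ n x, P ((C.incl n).rTensor M x)) (_ : ∀ x y, P x → P y → P (x + y)) z, P z := by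
    intro C P h1 h2 z
    induction z using TensorProduct.induction_on with
    | zero => simpa using h1 0 0
    | add x y hx hy => exact h2 x y hx hy
    | tmul z m =>
      induction z using C.tot_induction with
      | incl n c => exact h1 n (c ⊗ₜ m)
      | add x y hx hy => rw [add_tmul]; exact h2 _ _ hx hy
  have hd : ∀ (C : ConnDGCoalg.{v, w} k) (ρ : C.DegZeroAction M) n (z : C.Tot ⊗[k] M),
      (DirectSum.component k ℕ C.X n).rTensor M (C.twisted.d ρ.toMod z) =
        ρ.twistedD n ((DirectSum.component k ℕ C.X (n + 1)).rTensor M z) := by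
    intro C ρ n z
    refine hind C (P := fun z => (DirectSum.component k ℕ C.X n).rTensor M (C.twisted.d ρ.toMod z) =
      ρ.twistedD n ((DirectSum.component k ℕ C.X (n + 1)).rTensor M z))
      (fun m x => ?_) (fun x y hx hy => by simp only [map_add, hx, hy]) z
    obtain _ | m := m
    · rw [ρ.twisted_d_incl_zero, hcomp' C 0 (n + 1) (by omega), map_zero, map_zero]
    · rw [ρ.twisted_d_incl_succ]
      by_cases hmn : m = n
      · subst hmn
        rw [hcomp, hcomp]
      · rw [hcomp' C m n hmn, hcomp' C (m + 1) (n + 1) (by omega), map_zero]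
  have hf : ∀ n (z : C.Tot ⊗[k] M),
      (DirectSum.component k ℕ C'.X n).rTensor M (φ.tot.rTensor M z) =
        (φ.f n).rTensor M ((DirectSum.component k ℕ C.X n).rTensor M z) := by
    intro n z
    refine hind C (P := fun z => (DirectSum.component k ℕ C'.X n).rTensor M (φ.tot.rTensor M z) =
      (φ.f n).rTensor M ((DirectSum.component k ℕ C.X n).rTensor M z))
      (fun m x => ?_) (fun x y hx hy => by simp only [map_add, hx, hy]) z
    rw [hφincl]
    by_cases hmn : m = n
    · subst hmn
      rw [hcomp, hcomp]
    · rw [hcomp' C' m n hmn, hcomp' C m n hmn, map_zero]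
  rw [chainComplex_quasiIso_iff]
  constructor
  · intro (y : C'.X 0 ⊗[k] M)
    obtain ⟨x', y', -, h2⟩ := key 0 ((C'.incl 0).rTensor M y) (map_zero _)
      (by rw [map_zero, ρ'.twisted_d_incl_zero])
    have h3 := congrArg ((DirectSum.component k ℕ C'.X 0).rTensor M) h2
    rw [map_sub, hf, hd, hcomp] at h3
    refine ⟨(DirectSum.component k ℕ C.X 0).rTensor M x',
      (DirectSum.component k ℕ C'.X 1).rTensor M y', ?_⟩
    rw [DegZeroAction.twistedTensor_d]
    exact h3
  · intro n (x : C.X n ⊗[k] M) (y : C'.X (n + 1) ⊗[k] M) hx hy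
    rw [DegZeroAction.twistedTensor_d] at hy
    obtain ⟨x', y', h1, h2⟩ := key ((C.incl n).rTensor M x) ((C'.incl (n + 1)).rTensor M y)
      (by
        obtain _ | n := n
        · exact ρ.twisted_d_incl_zero x
        · change ρ.twistedTensor.d (n + 1) n x = 0 at hx
          rw [DegZeroAction.twistedTensor_d] at hx
          rw [ρ.twisted_d_incl_succ, show ρ.twistedD n x = 0 from hx, map_zero])
      (by
        rw [ρ'.twisted_d_incl_succ, hφincl, show (φ.f n).rTensor M x = ρ'.twistedD n y from hy])
    have h3 := congrArg ((DirectSum.component k ℕ C.X n).rTensor M) h1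
    have h4 := congrArg ((DirectSum.component k ℕ C'.X (n + 1)).rTensor M) h2
    rw [hd, hcomp] at h3
    rw [map_sub, hf, hd, hcomp] at h4
    refine ⟨(DirectSum.component k ℕ C.X (n + 1)).rTensor M x',
      (DirectSum.component k ℕ C'.X (n + 2)).rTensor M y', ?_, ?_⟩
    · rw [DegZeroAction.twistedTensor_d]
      exact h3
    · rw [DegZeroAction.twistedTensor_d]
      exact h4

end ConnDGCoalg

open Classical in
instance NChain.projective (k : Type v) [CommRing k] (S : SSet.{u}) (n : ℕ) :
    Module.Projective k (NChain k S n) := by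
  refine Module.Projective.of_split
    (NChain.lift (fun σ => if σ ∈ S.degenerate n then 0 else Finsupp.single σ (1 : k))
      fun σ hσ => if_pos hσ) (Finsupp.linearCombination k (NChain.cls k))
    (NChain.hom_ext fun σ => ?_)
  rw [LinearMap.comp_apply, NChain.lift_cls]
  split_ifs with h
  · rw [map_zero, NChain.cls_eq_zero k h, map_zero]
  · rw [Finsupp.linearCombination_single, one_smul, LinearMap.id_apply]

end

theorem mainTheorem3 {k : Type v} [CommRing k] {X Y : Type u} [TopologicalSpace X]
    [TopologicalSpace Y] [PathConnectedSpace X] [PathConnectedSpace Y] (x : X) (y : Y)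
    (f : C(X, Y)) (hf : f x = y) (hΩ : (singCoalgMap k f hf).IsOmegaQuasiIso)
    (M : Type w) [AddCommGroup M] [Module k M] [Module (MonoidAlgebra k (Pi1 Y y)) M]
    [IsScalarTower k (MonoidAlgebra k (Pi1 Y y)) M] :
    QuasiIso (localChainsMap f hf
      (Algebra.lsmul k k M : MonoidAlgebra k (Pi1 Y y) →ₐ[k] Module.End k M)) := by
  have hX : ∀ n, Module.Projective k ((singCoalg k x).X n) := fun n => NChain.projective k _ n
  have hY : ∀ n, Module.Projective k ((singCoalg k y).X n) := fun n => NChain.projective k _ n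
  exact (singCoalgMap k f hf).quasiIso_twistedMap hΩ _ _ _
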